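/- Let $R$ be a commutative ring and $F$ a commutative one-dimensional formal group law over $R$. Let $\Sigma\hookrightarrow\Lambda^\vee$ be a non-empty, finite, reduced, semisimple root datum in a lattice $\Lambda$, with simple roots $\alpha_1,\dots,\alpha_n$, simple reflections $s_i=s_{\alpha_i}$, Weyl group $W$, length function $\ell$, Bruhat order $\le$, and $m_{ij}$ the order of $s_is_j$. For a lattice $M$ let $R[\![M]\!]_F$ be the formal group algebra: the quotient of $R[\![x_M]\!]$ (the completion of the polynomial ring $R[x_\mu\mid \mu\in M]$ at the ideal generated by all the variables) by the closure of the ideal generated by $x_0$ and all $F(x_\lambda,x_\mu)-x_{\lambda+\mu}$. Let $\Gamma=\mathbb Z\gamma$ and $$S=R[\![\Gamma\oplus\Lambda]\!]_F,\qquad Q=S\left[\tfrac1{x_\alpha}\;\middle|\;\alpha\in\Sigma\right],$$ with the action of $W$ given by $w(x_\gamma)=x_\gamma$, $w(x_\lambda)=x_{w(\lambda)}$, and let $Q_W=\bigoplus_{w\in W}Q\,\delta_w$ be the twisted group algebra, with product $(q\delta_w)(q'\delta_{w'})=q\,w(q')\,\delta_{ww'}$. Put $$T_i=x_\gamma\left(\tfrac1{x_{\alpha_i}}-\tfrac1{x_{\alpha_i}}\delta_{s_i}\right)+\delta_{s_i},\qquad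 \kappa_i=\tfrac1{x_{\alpha_i}}+\tfrac1{x_{-\alpha_i}},\qquad \Delta_i(f)=\tfrac{f-s_i(f)}{x_{\alpha_i}}\quad(f\in S),$$ and $T_I=T_{i_1}\cdots T_{i_l}$ for a sequence $I=(i_1,\dots,i_l)$. Let $\mathbf H_F$ be the $R$-subalgebra of $Q_W$ generated by $S$ and $T_1,\dots,T_n$. Suppose that $R[\![\Lambda]\!]_F$ is $\Sigma$-regular, i.e. that $x_\alpha$ is regular in $R[\![\Lambda]\!]_F$ for every $\alpha\in\Sigma$. Fix a reduced sequence $I_w$ of every $w\in W$. Then: 1. $\mathbf H_F$ is a free left $S$-module with basis $\{T_{I_w}\}_{w\in W}$. 2. If $I'_v$ is another reduced sequence of $v\in W$, then $T_{I_v}-T_{I'_v}=\sum_{w<v}a_wT_{I_w}$ with $a_w\in S$. 3. $\kappa_i\in S$ and $\Delta_i(S)\subseteq S$ for all $i$; for $i\ne j$ there are $u^{ij}_v\in S$ with $$\underbrace{T_iT_jT_i\cdots}_{m_{ij}}-\underbrace{T_jT_iT_j\cdots}_{m_{ij}}=\sum_{\ell(v)\le m_{ij}-2}u^{ij}_vT_{I_v},\qquad(\ast)$$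 where the right-hand side is $0$ if $m_{ij}=2$, and is $x_\gamma^2\left(\kappa_{ji}T_j-\kappa_{ij}T_i+\frac{\kappa_j-\kappa_i}{x_{\alpha_i+\alpha_j}}\right)$ with $\kappa_{ij}=\frac1{x_{\alpha_i+\alpha_j}}\left(\frac1{x_{\alpha_j}}-\frac1{x_{-\alpha_i}}\right)-\frac1{x_{\alpha_i}x_{\alpha_j}}$ if $m_{ij}=3$. The $R$-algebra $\mathbf H_F$ is presented by the $R$-algebra $S$ and generators $T_1,\dots,T_n$, subject to $$T_if-s_i(f)T_i=x_\gamma\Delta_i(f)\ (f\in S),\qquad (T_i-1)(T_i+1-x_\gamma\kappa_i)=0,$$ and the relations $(\ast)$ for all $i\neq j$. -/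

import Mathlib

noncomputable section

namespace FormalHecke

/-! ### The formal group algebra -/

section FormalGroupAlgebra

variable {R : Type*} [CommRing R]

/-- The ring `R⟦x_Λ⟧` of power series in the (possibly infinitely many) variables `x_l`, `l ∈ Λ`:
the completion of the polynomial ring `R[x_Λ]` at the augmentation ideal, the ideal generated by
all the variables. -/
abbrev PowerSeriesRing (R : Type*) [CommRing R] (Λ : Type*) : Type _ :=
  AdicCompletion (MvPolynomial.idealOfVars Λ R) (MvPolynomial Λ R)

/-- The variable `x_l` in `R⟦x_Λ⟧`. -/
def psVar (R : Type*) [CommRing R] {Λ : Type*} (l : Λ) : PowerSeriesRing R Λ :=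
  algebraMap (MvPolynomial Λ R) _ (MvPolynomial.X l)

theorem idealOfVars_pow_le_comap_rename {Λ M : Type*} (f : Λ → M) (n : ℕ) :
    MvPolynomial.idealOfVars Λ R ^ n ≤
      (MvPolynomial.idealOfVars M R ^ n).comap (MvPolynomial.rename f : _ →ₐ[R] _) := by
  refine le_trans (Ideal.pow_right_mono ?_ n) (Ideal.le_comap_pow _ n)
  rw [MvPolynomial.idealOfVars, Ideal.span_le]
  rintro _ ⟨l, rfl⟩
  simpa [MvPolynomial.idealOfVars] using Ideal.subset_span (Set.mem_range_self (f l))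

theorem quotMap_mk {A B : Type*} [CommRing A] [CommRing B] [Algebra R A] [Algebra R B]
    {I : Ideal A} (J : Ideal B) (f : A →ₐ[R] B) (H : I ≤ J.comap f) (p : A) :
    Ideal.quotientMapₐ J f H (Ideal.Quotient.mk I p) = Ideal.Quotient.mk J (f p) := rfl

theorem psMap_aux {Λ M : Type*} (f : Λ → M) {m n : ℕ} (hle : m ≤ n) :
    (Ideal.Quotient.factorₐ R (Ideal.pow_le_pow_right hle)).comp
      ((Ideal.quotientMapₐ (MvPolynomial.idealOfVars M R ^ n) (MvPolynomial.rename f)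
          (idealOfVars_pow_le_comap_rename f n)).comp
        ((AdicCompletion.evalₐ (MvPolynomial.idealOfVars Λ R) n).restrictScalars R)) =
      (Ideal.quotientMapₐ (MvPolynomial.idealOfVars M R ^ m) (MvPolynomial.rename f)
          (idealOfVars_pow_le_comap_rename f m)).comp
        ((AdicCompletion.evalₐ (MvPolynomial.idealOfVars Λ R) m).restrictScalars R) := by
  ext x
  obtain ⟨p, rfl⟩ := AdicCompletion.mk_surjective _ _ x
  simp only [AlgHom.comp_apply, AlgHom.restrictScalars_apply, AdicCompletion.evalₐ_mk]
  rw [quotMap_mk, quotMap_mk]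
  simp only [Ideal.Quotient.factorₐ_apply_mk]
  rw [Ideal.Quotient.eq, ← map_sub]
  apply idealOfVars_pow_le_comap_rename (R := R) f m
  rw [← Ideal.Quotient.eq]
  exact AdicCompletion.Ideal.mk_eq_mk _ hle p

/-- The continuous `R`-algebra homomorphism `R⟦x_Λ⟧ → R⟦x_M⟧` with `x_l ↦ x_{f l}`. -/
def psMap (R : Type*) [CommRing R] {Λ M : Type*} (f : Λ → M) :
    PowerSeriesRing R Λ →ₐ[R] PowerSeriesRing R M :=
  AdicCompletion.liftAlgHom (MvPolynomial.idealOfVars M R)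
    (fun n => (Ideal.quotientMapₐ (MvPolynomial.idealOfVars M R ^ n) (MvPolynomial.rename f)
        (idealOfVars_pow_le_comap_rename f n)).comp
      ((AdicCompletion.evalₐ (MvPolynomial.idealOfVars Λ R) n).restrictScalars R))
    (fun hle => psMap_aux f hle)

theorem eval_psMap {Λ M : Type*} (f : Λ → M) (n : ℕ) (z : PowerSeriesRing R Λ) :
    AdicCompletion.evalₐ (MvPolynomial.idealOfVars M R) n (psMap R f z) =
      Ideal.quotientMapₐ (MvPolynomial.idealOfVars M R ^ n) (MvPolynomial.rename f)
        (idealOfVars_pow_le_comap_rename f n)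
        (AdicCompletion.evalₐ (MvPolynomial.idealOfVars Λ R) n z) :=
  AdicCompletion.evalₐ_liftAlgHom _ _ (fun hle => psMap_aux f hle) n z

theorem psMap_psVar {Λ M : Type*} (f : Λ → M) (l : Λ) :
    psMap R f (psVar R l) = psVar R (f l) := by
  apply AdicCompletion.ext_evalₐ
  intro n
  rw [eval_psMap, psVar, psVar, AlgHom.commutes, AlgHom.commutes]
  exact (Ideal.quotient_map_mkₐ _ _ _).trans (by simp)

theorem psMap_psMap {Λ M N : Type*} (f : Λ → M) (g : M → N) (z : PowerSeriesRing R Λ) :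
    psMap R g (psMap R f z) = psMap R (g ∘ f) z := by
  apply AdicCompletion.ext_evalₐ
  intro n
  rw [eval_psMap, eval_psMap, eval_psMap]
  obtain ⟨p, hp⟩ := Ideal.Quotient.mk_surjective
    (AdicCompletion.evalₐ (MvPolynomial.idealOfVars Λ R) n z)
  rw [← hp]
  rw [quotMap_mk, quotMap_mk, quotMap_mk, MvPolynomial.rename_rename]

theorem psMap_id {Λ : Type*} (z : PowerSeriesRing R Λ) : psMap R (id : Λ → Λ) z = z := by
  apply AdicCompletion.ext_evalₐ
  intro n
  rw [eval_psMap]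
  obtain ⟨p, hp⟩ := Ideal.Quotient.mk_surjective
    (AdicCompletion.evalₐ (MvPolynomial.idealOfVars Λ R) n z)
  rw [← hp]
  rw [quotMap_mk, MvPolynomial.rename_id_apply]

/-- The element `x_l +_F x_m = F(x_l, x_m)` of `R⟦x_Λ⟧`: the image of `F ∈ R⟦X₀, X₁⟧` under the
continuous homomorphism with `X₀ ↦ x_l`, `X₁ ↦ x_m`. -/
def psFormalSum (F : FormalGroup R) {Λ : Type*} (l m : Λ) : PowerSeriesRing R Λ :=
  psMap R ![l, m] (MvPowerSeries.toAdicCompletion (Fin 2) R F.toPowerSeries)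

/-- The ideal of `R⟦x_Λ⟧` generated by `x_0` and all `x_l +_F x_m - x_{l+m}`. -/
def relIdeal (F : FormalGroup R) (Λ : Type*) [AddCommGroup Λ] : Ideal (PowerSeriesRing R Λ) :=
  Ideal.span (insert (psVar R (0 : Λ))
    (Set.range fun p : Λ × Λ => psFormalSum F p.1 p.2 - psVar R (p.1 + p.2)))

/-- The closure of `relIdeal` in the topology of `R⟦x_Λ⟧`, a basis of neighbourhoods of zero of
which is formed by the kernels of the projections `R⟦x_Λ⟧ → R[x_Λ] / I ^ n`, where `I` is the
augmentation ideal. -/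
def closedRelIdeal (F : FormalGroup R) (Λ : Type*) [AddCommGroup Λ] :
    Ideal (PowerSeriesRing R Λ) :=
  ⨅ n : ℕ, relIdeal F Λ ⊔ RingHom.ker (AdicCompletion.evalₐ (MvPolynomial.idealOfVars Λ R) n)

/-- The formal group algebra `R⟦Λ⟧_F`. -/
def FormalGroupAlgebra (F : FormalGroup R) (Λ : Type*) [AddCommGroup Λ] : Type _ :=
  PowerSeriesRing R Λ ⧸ closedRelIdeal F Λ

variable (F : FormalGroup R)

instance (Λ : Type*) [AddCommGroup Λ] : CommRing (FormalGroupAlgebra F Λ) :=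
  inferInstanceAs (CommRing (PowerSeriesRing R Λ ⧸ closedRelIdeal F Λ))

instance (Λ : Type*) [AddCommGroup Λ] : Algebra R (FormalGroupAlgebra F Λ) :=
  inferInstanceAs (Algebra R (PowerSeriesRing R Λ ⧸ closedRelIdeal F Λ))

/-- The element `x_l` of `R⟦Λ⟧_F`. -/
def xvar {Λ : Type*} [AddCommGroup Λ] (l : Λ) : FormalGroupAlgebra F Λ :=
  Ideal.Quotient.mk (closedRelIdeal F Λ) (psVar R l)

theorem closedRelIdeal_le_comap {Λ M : Type*} [AddCommGroup Λ] [AddCommGroup M] (f : Λ →+ M) :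
    closedRelIdeal F Λ ≤ (closedRelIdeal F M).comap (psMap R f) := by
  intro z hz
  simp only [closedRelIdeal, Ideal.mem_comap, Submodule.mem_iInf] at hz ⊢
  intro n
  suffices h : relIdeal F Λ ⊔ RingHom.ker (AdicCompletion.evalₐ (MvPolynomial.idealOfVars Λ R) n) ≤
      (relIdeal F M ⊔ RingHom.ker (AdicCompletion.evalₐ (MvPolynomial.idealOfVars M R) n)).comap
        (psMap R f) from h (hz n)
  refine sup_le ?_ ?_
  · rw [relIdeal, Ideal.span_le]
    rintro _ (rfl | ⟨⟨l, m⟩, rfl⟩)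
    · refine Ideal.mem_sup_left (Ideal.subset_span (Or.inl ?_))
      rw [psMap_psVar, map_zero]
    · refine Ideal.mem_sup_left (Ideal.subset_span (Or.inr ⟨(f l, f m), ?_⟩))
      have : (f : Λ → M) ∘ ![l, m] = ![f l, f m] := by
        ext i; fin_cases i <;> rfl
      simp only [psFormalSum, map_sub, psMap_psVar, psMap_psMap, map_add, this]
  · intro y hy
    refine Ideal.mem_sup_right ?_
    rw [RingHom.mem_ker] at hy ⊢
    rw [eval_psMap, hy, map_zero]

/-- The `R`-algebra homomorphism `R⟦Λ⟧_F → R⟦M⟧_F`, `x_l ↦ x_{f l}`, induced by `f : Λ →+ M`. -/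
def fgaMap {Λ M : Type*} [AddCommGroup Λ] [AddCommGroup M] (f : Λ →+ M) :
    FormalGroupAlgebra F Λ →ₐ[R] FormalGroupAlgebra F M :=
  Ideal.quotientMapₐ (closedRelIdeal F M) (psMap R f) (closedRelIdeal_le_comap F f)

theorem fgaMap_xvar {Λ M : Type*} [AddCommGroup Λ] [AddCommGroup M] (f : Λ →+ M) (l : Λ) :
    fgaMap F f (xvar F l) = xvar F (f l) :=
  (Ideal.quotient_map_mkₐ _ _ _).trans (by rw [psMap_psVar]; rfl)

theorem fgaMap_fgaMap {Λ M N : Type*} [AddCommGroup Λ] [AddCommGroup M] [AddCommGroup N]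
    (f : Λ →+ M) (g : M →+ N) (z : FormalGroupAlgebra F Λ) :
    fgaMap F g (fgaMap F f z) = fgaMap F (g.comp f) z := by
  obtain ⟨p, rfl⟩ := Ideal.Quotient.mk_surjective z
  exact congrArg (Ideal.Quotient.mk (closedRelIdeal F N)) (psMap_psMap f g p)

theorem fgaMap_id {Λ : Type*} [AddCommGroup Λ] (z : FormalGroupAlgebra F Λ) :
    fgaMap F (AddMonoidHom.id Λ) z = z := by
  obtain ⟨p, rfl⟩ := Ideal.Quotient.mk_surjective z
  exact congrArg (Ideal.Quotient.mk (closedRelIdeal F Λ)) (psMap_id p)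

end FormalGroupAlgebra

/-! ### The Weyl group -/

section Weyl

variable {ι X Y : Type*} [AddCommGroup X] [AddCommGroup Y] {P : RootDatum ι X Y} (b : P.Base)

/-- The root datum is semisimple: the roots span `X ⊗ ℚ`. -/
def IsSemisimple (P : RootDatum ι X Y) : Prop :=
  ∀ l : X, ∃ n : ℤ, n ≠ 0 ∧ n • l ∈ Submodule.span ℤ (Set.range P.root)

/-- The simple reflection `s_i`. -/
def simpleRefl (i : b.support) : P.weylGroup := RootPairing.weylGroup.ofIdx P i

/-- `s_{i_1} ⋯ s_{i_k}` for a sequence `I = (i_1, …, i_k)` of simple roots. -/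
def wordProd (I : List b.support) : P.weylGroup := (I.map (simpleRefl b)).prod

/-- `I` is a reduced sequence of `w`. -/
def IsReducedWord (I : List b.support) (w : P.weylGroup) : Prop :=
  wordProd b I = w ∧ ∀ J : List b.support, wordProd b J = w → I.length ≤ J.length

/-- The length `ℓ(w)`. -/
def len (w : P.weylGroup) : ℕ := sInf {n | ∃ J : List b.support, wordProd b J = w ∧ J.length = n}

/-- The strict Bruhat order: the transitive closure of `x < x s_a` for a root `a` with
`ℓ(x) < ℓ(x s_a)`. -/
def BruhatLT (v w : P.weylGroup) : Prop :=
  Relation.TransGen (fun x y : P.weylGroup =>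
    (∃ a : ι, y = x * RootPairing.weylGroup.ofIdx P a) ∧ len b x < len b y) v w

/-- The order `m_{ij}` of `s_i s_j`. -/
def coxNum (i j : b.support) : ℕ := orderOf (simpleRefl b i * simpleRefl b j)

/-- The sequence `(i, j, i, …)` of length `m`. -/
def altWord {B : Type*} : B → B → ℕ → List B
  | _, _, 0 => []
  | i, j, m + 1 => i :: altWord j i m

end Weyl

/-! ### Extension of an action to a localization -/

section Localization

variable {G A : Type*} [Monoid G] [CommRing A] (M : Submonoid A) (φ : G → A →+* A)
  (h1 : ∀ z, φ 1 z = z) (h2 : ∀ v w z, φ (v * w) z = φ v (φ w z))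
  (hM : ∀ w, M ≤ M.comap (φ w))

/-- The action on `M⁻¹ A` induced by an action `φ` on `A` by ring homomorphisms preserving `M`. -/
abbrev locAction : MulSemiringAction G (Localization M) where
  smul w := IsLocalization.map (Localization M) (φ w) (hM w)
  one_smul q := by
    obtain ⟨f, s, rfl⟩ := IsLocalization.exists_mk'_eq M q
    refine (IsLocalization.map_mk' _ _ _).trans ?_
    congr 1
    · exact h1 f
    · exact Subtype.ext (h1 s)
  mul_smul v w q := by
    obtain ⟨f, s, rfl⟩ := IsLocalization.exists_mk'_eq M q
    refine (IsLocalization.map_mk' _ _ _).trans ?_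
    refine Eq.trans ?_ (congrArg _ (IsLocalization.map_mk' _ _ _)).symm
    refine Eq.trans ?_ (IsLocalization.map_mk' _ _ _).symm
    congr 1
    · exact h2 v w f
    · exact Subtype.ext (h2 v w s)
  smul_zero w := map_zero (IsLocalization.map (Localization M) (φ w) (hM w))
  smul_add w := map_add (IsLocalization.map (Localization M) (φ w) (hM w))
  smul_one w := map_one (IsLocalization.map (Localization M) (φ w) (hM w))
  smul_mul w := map_mul (IsLocalization.map (Localization M) (φ w) (hM w))

theorem locAction_algebraMap (w : G) (f : A) :
    letI := locAction M φ h1 h2 hM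
    w • algebraMap A (Localization M) f = algebraMap A (Localization M) (φ w f) :=
  IsLocalization.map_eq (hM w) f

end Localization

/-! ### The formal affine Hecke algebra -/

section Hecke

variable {R : Type*} [CommRing R] (F : FormalGroup R)
variable {ι X Y : Type*} [AddCommGroup X] [AddCommGroup Y] (P : RootDatum ι X Y)

/-- `R⟦Λ⟧_F` is `Σ`-regular: `x_a` is regular in `R⟦Λ⟧_F` for every root `a`. -/
def IsSigmaRegular : Prop := ∀ a : ι, IsRegular (xvar F (P.root a))

/-- `S = R⟦Γ ⊕ Λ⟧_F`, with `Γ = ℤ` generated by `γ = 1`, for the root datum `P` in `Λ = X`. -/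
abbrev BaseRing (_P : RootDatum ι X Y) : Type _ := FormalGroupAlgebra F (ℤ × X)

/-- The element `x_l ∈ S` for `l ∈ Λ`. -/
def sx (l : X) : BaseRing F P := xvar F ((0, l) : ℤ × X)

/-- The element `x_γ ∈ S`. -/
def sgamma : BaseRing F P := xvar F ((1, 0) : ℤ × X)

/-- The Weyl group acts on `S` by `w(x_γ) = x_γ` and `w(x_l) = x_{w(l)}`. -/
def weylMap (w : P.weylGroup) : BaseRing F P →ₐ[R] BaseRing F P :=
  fgaMap F ((AddMonoidHom.id ℤ).prodMap (DistribSMul.toAddMonoidHom X w))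

theorem weylMap_one (z : BaseRing F P) : weylMap F P 1 z = z := by
  have : (AddMonoidHom.id ℤ).prodMap (DistribSMul.toAddMonoidHom X (1 : P.weylGroup)) =
      AddMonoidHom.id (ℤ × X) := by
    ext <;> simp
  rw [weylMap, this, fgaMap_id]

theorem weylMap_mul (v w : P.weylGroup) (z : BaseRing F P) :
    weylMap F P (v * w) z = weylMap F P v (weylMap F P w z) := by
  rw [weylMap, weylMap, weylMap, fgaMap_fgaMap]
  have : ((AddMonoidHom.id ℤ).prodMap (DistribSMul.toAddMonoidHom X v)).comp
      ((AddMonoidHom.id ℤ).prodMap (DistribSMul.toAddMonoidHom X w)) =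
      (AddMonoidHom.id ℤ).prodMap (DistribSMul.toAddMonoidHom X (v * w)) := by
    ext <;> simp [mul_smul]
  rw [this]

theorem weylMap_sx (w : P.weylGroup) (l : X) : weylMap F P w (sx F P l) = sx F P (w • l) :=
  fgaMap_xvar F _ _

theorem weylMap_sgamma (w : P.weylGroup) : weylMap F P w (sgamma F P) = sgamma F P :=
  (fgaMap_xvar F _ _).trans (by simp [sgamma])

/-- The multiplicative set generated by the `x_a`, `a` a root. -/
def rootMonoid : Submonoid (BaseRing F P) :=
  Submonoid.closure (Set.range fun a : ι => sx F P (P.root a))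

theorem weylMap_root (w : P.weylGroup) (a : ι) :
    weylMap F P w (sx F P (P.root a)) = sx F P (P.root (P.weylGroupToPerm w a)) := by
  rw [weylMap_sx, RootPairing.weylGroup_apply_root]

theorem rootMonoid_le_comap (w : P.weylGroup) :
    rootMonoid F P ≤ (rootMonoid F P).comap (weylMap F P w : BaseRing F P →+* BaseRing F P) := by
  conv_lhs => rw [rootMonoid]
  rw [Submonoid.closure_le]
  rintro _ ⟨a, rfl⟩
  rw [SetLike.mem_coe, Submonoid.mem_comap]
  have h : (weylMap F P w : BaseRing F P →+* BaseRing F P) (sx F P (P.root a)) =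
      sx F P (P.root (P.weylGroupToPerm w a)) := weylMap_root F P w a
  rw [h]
  exact Submonoid.subset_closure ⟨P.weylGroupToPerm w a, rfl⟩

/-- `Q^F = S[1 / x_a | a a root]`. Since `x_{-a}` is a unit multiple of `x_a`, it does not matter
whether all roots or only the positive ones are used. -/
abbrev LocRing : Type _ := Localization (rootMonoid F P)

/-- The Weyl group acts on `Q^F` by ring automorphisms that extend its action on `S`. -/
instance : MulSemiringAction P.weylGroup (LocRing F P) :=
  locAction (rootMonoid F P) (fun w => (weylMap F P w : BaseRing F P →+* BaseRing F P))
    (weylMap_one F P) (weylMap_mul F P) (rootMonoid_le_comap F P)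

theorem weyl_smul_algebraMap (w : P.weylGroup) (f : BaseRing F P) :
    w • algebraMap (BaseRing F P) (LocRing F P) f =
      algebraMap (BaseRing F P) (LocRing F P) (weylMap F P w f) :=
  locAction_algebraMap (rootMonoid F P)
    (fun w => (weylMap F P w : BaseRing F P →+* BaseRing F P))
    (weylMap_one F P) (weylMap_mul F P) (rootMonoid_le_comap F P) w f

instance : SMulCommClass P.weylGroup R (LocRing F P) where
  smul_comm w r q := by
    rw [Algebra.smul_def, Algebra.smul_def, smul_mul',
      IsScalarTower.algebraMap_apply R (BaseRing F P) (LocRing F P), weyl_smul_algebraMap,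
      AlgHom.commutes]

/-- The twisted formal group algebra `Q^F_W = Q^F ⋊ R[W]`: finite sums of elements `q δ_w`
(`SkewMonoidAlgebra.single w q`), multiplied by `(q δ_w) (q' δ_w') = q w(q') δ_{w w'}`.
Its left `S`-module structure is multiplication from the left by elements `f δ_e`, `f ∈ S`. -/
abbrev TwistedAlgebra : Type _ := SkewMonoidAlgebra (LocRing F P) P.weylGroup

/-- The embedding `S → Q^F_W`, `f ↦ f δ_e`. -/
def sEmb : BaseRing F P →ₐ[R] TwistedAlgebra F P where
  __ := (SkewMonoidAlgebra.singleOneRingHom (k := LocRing F P) (G := P.weylGroup)).comp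
    (algebraMap (BaseRing F P) (LocRing F P))
  commutes' r := by
    rw [SkewMonoidAlgebra.coe_algebraMap, Function.comp_apply,
      IsScalarTower.algebraMap_apply R (BaseRing F P) (LocRing F P)]
    rfl

/-- The element `1 / x_l` of `Q^F`, for those `l ∈ Λ` for which `x_l` is invertible in `Q^F`;
this is the case for every root. -/
def xInv (l : X) : LocRing F P := Ring.inverse (algebraMap (BaseRing F P) (LocRing F P) (sx F P l))

theorem isUnit_root (a : ι) :
    IsUnit (algebraMap (BaseRing F P) (LocRing F P) (sx F P (P.root a))) :=
  IsLocalization.map_units (LocRing F P)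
    (⟨sx F P (P.root a), Submonoid.subset_closure ⟨a, rfl⟩⟩ : rootMonoid F P)

/-- The formal Demazure element `X_a = 1 / x_a - (1 / x_a) δ_{s_a}`. -/
def demazureElt (a : ι) : TwistedAlgebra F P :=
  SkewMonoidAlgebra.single 1 (xInv F P (P.root a)) -
    SkewMonoidAlgebra.single (RootPairing.weylGroup.ofIdx P a) (xInv F P (P.root a))

/-- The Demazure-Lusztig element `T_a = x_γ X_a + δ_{s_a}`. -/
def lusztigElt (a : ι) : TwistedAlgebra F P :=
  sEmb F P (sgamma F P) * demazureElt F P a +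
    SkewMonoidAlgebra.single (RootPairing.weylGroup.ofIdx P a) 1

/-- `κ_a = 1 / x_a + 1 / x_{-a}`. -/
def kappa (a : ι) : LocRing F P := xInv F P (P.root a) + xInv F P (-P.root a)

/-- The formal Demazure operator `Δ_a(f) = (f - s_a(f)) / x_a`. -/
def demazureOp (a : ι) (f : BaseRing F P) : LocRing F P :=
  algebraMap (BaseRing F P) (LocRing F P)
    (f - weylMap F P (RootPairing.weylGroup.ofIdx P a) f) * xInv F P (P.root a)

/-- `κ_{ij} = (1 / x_{i+j}) (1 / x_j - 1 / x_{-i}) - 1 / (x_i x_j)`, used when the sum of the roots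
`i` and `j` is a root. -/
def kappaTwo (i j : ι) : LocRing F P :=
  xInv F P (P.root i + P.root j) * (xInv F P (P.root j) - xInv F P (-P.root i)) -
    xInv F P (P.root i) * xInv F P (P.root j)

variable {P} (b : P.Base)

/-- The product `T_I = T_{i_1} ⋯ T_{i_k}` for a sequence `I = (i_1, …, i_k)` of simple roots. -/
def lusztigWord (I : List b.support) : TwistedAlgebra F P :=
  (I.map fun i => lusztigElt F P i).prod

/-- The formal affine Hecke algebra: the `R`-subalgebra of `Q^F_W` generated by `S` and the `T_i`
for the simple roots `i`. -/
def heckeAlgebra : Subalgebra R (TwistedAlgebra F P) :=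
  Algebra.adjoin R (Set.range (sEmb F P) ∪ Set.range fun i : b.support => lusztigElt F P i)

theorem sEmb_mem (f : BaseRing F P) : sEmb F P f ∈ heckeAlgebra F b :=
  Algebra.subset_adjoin (Or.inl ⟨f, rfl⟩)

theorem lusztigElt_mem (i : b.support) : lusztigElt F P i ∈ heckeAlgebra F b :=
  Algebra.subset_adjoin (Or.inr ⟨i, rfl⟩)

/-- The symbol attached to `f ∈ S` in the free `R`-algebra on the disjoint union of `S` and the set
of simple roots. -/
def gS (f : BaseRing F P) : FreeAlgebra R (BaseRing F P ⊕ b.support) := FreeAlgebra.ι R (Sum.inl f)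

/-- The symbol `T_i` in the free `R`-algebra on the disjoint union of `S` and the set of simple
roots. -/
def gT (i : b.support) : FreeAlgebra R (BaseRing F P ⊕ b.support) := FreeAlgebra.ι R (Sum.inr i)

/-- The product of the symbols `T_i` along a sequence. -/
def gWord (I : List b.support) : FreeAlgebra R (BaseRing F P ⊕ b.support) :=
  (I.map (gT F b)).prod

/-- The defining relations. The first three say that `S` is embedded by a homomorphism of
`R`-algebras; the others are the commutation relation between `T_i` and `S`, the quadratic relation
and the deformed braid relation. The data are `k i = κ_i`, `D i f = Δ_i(f)`, a set `I` of reduced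
sequences, and the coefficients `u i j v` of the deformed braid relations. -/
inductive HeckeRel (k : b.support → BaseRing F P)
    (D : b.support → BaseRing F P → BaseRing F P) (I : P.weylGroup → List b.support)
    (u : b.support → b.support → P.weylGroup →₀ BaseRing F P) :
    FreeAlgebra R (BaseRing F P ⊕ b.support) → FreeAlgebra R (BaseRing F P ⊕ b.support) → Prop
  | add (f g : BaseRing F P) : HeckeRel k D I u (gS F b (f + g)) (gS F b f + gS F b g)
  | mul (f g : BaseRing F P) : HeckeRel k D I u (gS F b (f * g)) (gS F b f * gS F b g)
  | scalar (r : R) : HeckeRel k D I u (gS F b (algebraMap R _ r)) (algebraMap R _ r)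
  | comm (i : b.support) (f : BaseRing F P) : HeckeRel k D I u
      (gT F b i * gS F b f - gS F b (weylMap F P (simpleRefl b i) f) * gT F b i)
      (gS F b (sgamma F P * D i f))
  | quad (i : b.support) : HeckeRel k D I u
      ((gT F b i - 1) * (gT F b i + 1 - gS F b (sgamma F P * k i))) 0
  | braid (i j : b.support) (hij : i ≠ j) : HeckeRel k D I u
      (gWord F b (altWord i j (coxNum b i j)) - gWord F b (altWord j i (coxNum b i j)))
      ((u i j).sum fun v c => gS F b c * gWord F b (I v))

end Hecke

end FormalHecke

end

open FormalHecke

/-!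
# The formal affine Hecke algebra of a root datum

Write `t = x_γ`, so that `T_i = t / x_i + (1 - t / x_i) δ_i` in the twisted group algebra `Q_W`, where
`x_i = x_{α_i}` and `δ_i = δ_{s_i}`.

*Linear independence.* The product of the `T_i` along a reduced word of `w` has at `δ_w` the
coefficient `∏ (1 - t / x_a)`, with `a` running through the inversions of `w`, and is otherwise
supported on smaller elements in the Bruhat order (`TwistDatum.coeff_of_reduced`,
`TwistDatum.exists_sublist_of_coeff_ne_zero`, `bruhat_of_sublist`). Up to units, the factors are
`x_{γ - a} / x_a`, and `x_{γ - a}` is carried to `x_γ` by a shear of `ℤ γ ⊕ Λ`; hence they are not zero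
divisors (`gamma_sub_mul_cancel`), while `Σ`-regularity makes `S → Q` injective.

*Spanning.* It has to be shown that the product along any word is a combination of the products
along the chosen reduced words with coefficients in `S`. The elements of `Q_W` in question have two
properties that are stable under left multiplication by the `T_i`: along `x_a`, their coefficients
have at most simple poles, with opposite residues at `w` and `s_a w`; and the coefficient at `w` is
divisible by the leading coefficient at `w`. If the elements of `S` behave like regular functions,
in that a quotient without poles along any `x_a` lies in `S`, then for an element with these
properties the coefficient at a `w` of maximal length, divided by the leading coefficient, has no
poles, and the top layer can be subtracted (`TwistDatum.IsResidual.word_mem_span`).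

Over a general ring, `S` need not behave this way, and the `x_a` may have common divisors. But a
combination that expresses a word specializes along maps of coefficient rings and lattices, so the
universal case suffices: the universal formal group law over the Lazard ring, and the lattice
spanned by the roots, in which every root is a primitive vector. By Lazard's theorem
(`lazardEquiv`) the Lazard ring is a polynomial ring over `ℤ`, so it is a domain of characteristic
zero; the formal group algebra of a free abelian group is a power series ring
(`toFga_injective`, `toFga_surjective`), so it is a domain as well, and modulo `x_a`, with `a`
primitive, `x_l` is not a zero divisor unless `l` is a multiple of `a` (`xvar_dvd_of_dvd_mul`). This
gives the hypotheses of the residue argument (`univDatum_isResidual`) and, after specialization,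
`lusztigWord_mem_span`. The surjective half of Lazard's theorem rests on the fact that the
coefficients of a given degree form a symmetric two-cocycle up to decomposable elements
(`isBinomialCocycle_coeff`, `IsBinomialCocycle.eq_smul_sum`); the injective half on the formal group
laws over `ℚ` with prescribed logarithm (`logLaw`, `lazardHom_injective`).

*Relations.* The difference of the products along two reduced words of the same element is expanded
in the basis, and the comparison of leading coefficients, starting from the top, shows that only
smaller elements occur (`exists_bruhat_expansion`). For the two braid words in `T_i` and `T_j`, the
coefficients in lengths `m_{ij}` and `m_{ij} - 1` agree, so that only elements of length at most
`m_{ij} - 2` occur (`TwistDatum.coeff_braid_sub`, `exists_braid_expansion`); for `m_{ij} = 2, 3` the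
remaining coefficients are read off from those at `δ_1`, `δ_i` and `δ_j`.

*Presentation.* In any algebra with elements satisfying the relations, braid moves change the
product along a word by products along shorter words. By Matsumoto's theorem (`eqvGen_braidMove`)
reduced words of the same element are connected by braid moves, and a word that is not reduced can
be shortened by the quadratic relation; so the algebra is spanned over `S` by the products along
the chosen reduced words (`IsHeckeSystem.exists_prodWord_eq_sum`). The surjection from the
presented algebra to `H_F` maps this spanning set to a basis, and so it is an isomorphism
(`exists_presentation`).
-/


namespace FormalHecke

/-! ### The Weyl group as a Coxeter group -/

section Weyl

variable {ι X Y : Type*} [AddCommGroup X] [AddCommGroup Y] {P : RootDatum ι X Y}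

open RootPairing.weylGroup (ofIdx)

theorem root_smul (w : P.weylGroup) (a : ι) : P.root (w • a) = w • P.root a :=
  (RootPairing.weylGroup_apply_root P w a).symm

theorem weylGroup_ext {v w : P.weylGroup} (h : ∀ x : X, v • x = w • x) : v = w :=
  Subtype.ext (RootPairing.Equiv.weightHom_injective P (LinearEquiv.ext h))

theorem refl_smul_eq (a : ι) (x : X) : ofIdx P a • x = P.reflection a x := rfl

theorem refl_mul_self (a : ι) : ofIdx P a * ofIdx P a = 1 :=
  weylGroup_ext fun x => by rw [mul_smul, refl_smul_eq, refl_smul_eq, one_smul]; simp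

theorem refl_inv (a : ι) : (ofIdx P a)⁻¹ = ofIdx P a :=
  inv_eq_of_mul_eq_one_left (refl_mul_self a)

theorem refl_mul_cancel (a : ι) (w : P.weylGroup) : ofIdx P a * (ofIdx P a * w) = w := by
  rw [← mul_assoc, refl_mul_self, one_mul]

theorem refl_idx_smul (a c : ι) : ofIdx P a • c = P.reflectionPerm a c := rfl

theorem refl_idx_smul_self (a c : ι) : ofIdx P a • ofIdx P a • c = c := by
  rw [smul_smul, refl_mul_self, one_smul]

theorem refl_reflectionPerm (a c : ι) :
    ofIdx P (P.reflectionPerm c a) = ofIdx P c * ofIdx P a * ofIdx P c := by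
  refine weylGroup_ext fun x => ?_
  rw [mul_smul, mul_smul]
  simp only [refl_smul_eq, RootPairing.reflection_reflectionPerm]
  rfl

theorem refl_smul (w : P.weylGroup) (a : ι) : ofIdx P (w • a) = w * ofIdx P a * w⁻¹ := by
  obtain ⟨w, hw⟩ := w
  induction hw using RootPairing.weylGroup.induction generalizing a with
  | mem c =>
    have : (⟨RootPairing.Equiv.reflection P c, P.reflection_mem_weylGroup c⟩ : P.weylGroup) =
      ofIdx P c := rfl
    rw [this, refl_inv, refl_idx_smul, refl_reflectionPerm]
  | one =>
    have : (⟨1, one_mem _⟩ : P.weylGroup) = 1 := rfl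
    rw [this]; simp
  | mul x y hx hy ihx ihy =>
    have : (⟨x * y, mul_mem hx hy⟩ : P.weylGroup) = ⟨x, hx⟩ * ⟨y, hy⟩ := rfl
    rw [this, mul_smul, ihx, ihy, mul_inv_rev]
    simp only [mul_assoc]

theorem refl_neg (a : ι) : ofIdx P (ofIdx P a • a) = ofIdx P a := by
  rw [refl_smul, refl_inv, refl_mul_self, one_mul]

variable (b : P.Base)

theorem wordProd_nil : wordProd b [] = 1 := rfl

theorem wordProd_cons (i : b.support) (J : List b.support) :
    wordProd b (i :: J) = ofIdx P i * wordProd b J := by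
  simp [wordProd, simpleRefl]

theorem wordProd_append (J K : List b.support) :
    wordProd b (J ++ K) = wordProd b J * wordProd b K := by
  simp [wordProd]

theorem wordProd_reverse (J : List b.support) : wordProd b J.reverse = (wordProd b J)⁻¹ := by
  induction J with
  | nil => simp [wordProd_nil]
  | cons i J ih =>
    rw [List.reverse_cons, wordProd_append, ih, wordProd_cons, wordProd_cons, wordProd_nil,
      mul_inv_rev, refl_inv, mul_one]

theorem isPos_refl_self (a : ι) : b.IsPos (ofIdx P a • a) ↔ ¬ b.IsPos a :=
  RootPairing.Base.IsPos.neg_iff_not b a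

theorem isPos_simple (i : b.support) : b.IsPos i :=
  RootPairing.Base.isPos_of_mem_support i.2

theorem exists_isPos_refl_eq (a : ι) : ∃ c, b.IsPos c ∧ ofIdx P c = ofIdx P a := by
  by_cases h : b.IsPos a
  · exact ⟨a, h, rfl⟩
  · exact ⟨ofIdx P a • a, (isPos_refl_self b a).2 h, refl_neg a⟩

theorem isPos_smul_neg (w : P.weylGroup) (a : ι) :
    b.IsPos (w • ofIdx P a • a) ↔ ¬ b.IsPos (w • a) := by
  rw [← isPos_refl_self b (w • a), refl_smul]
  simp only [smul_smul, inv_mul_cancel_right]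

section Reduced

variable [Finite ι] [P.IsReduced]

theorem isPos_refl_smul {a : ι} (ha : b.IsPos a) {i : b.support} (h : a ≠ i) :
    b.IsPos (ofIdx P i • a) :=
  ha.reflectionPerm i.2 h

theorem exists_wordProd_refl (a : ι) : ∃ J, wordProd b J = ofIdx P a := by
  induction a using b.induction_reflect with
  | h₀ a ha =>
    obtain ⟨J, hJ⟩ := ha
    exact ⟨J, hJ.trans (refl_neg a).symm⟩
  | h₁ i hi => exact ⟨[⟨i, hi⟩], by rw [wordProd_cons, wordProd_nil, mul_one]⟩
  | h₂ a i ha hi =>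
    obtain ⟨J, hJ⟩ := ha
    refine ⟨⟨i, hi⟩ :: (J ++ [⟨i, hi⟩]), ?_⟩
    rw [wordProd_cons, wordProd_append, hJ, wordProd_cons, wordProd_nil, mul_one,
      refl_reflectionPerm, mul_assoc]

/-- The Weyl group is generated by the simple reflections. -/
theorem exists_wordProd (w : P.weylGroup) : ∃ J, wordProd b J = w := by
  obtain ⟨w, hw⟩ := w
  induction hw using RootPairing.weylGroup.induction with
  | mem a => exact exists_wordProd_refl b a
  | one => exact ⟨[], rfl⟩
  | mul x y hx hy ihx ihy =>
    obtain ⟨J, hJ⟩ := ihx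
    obtain ⟨K, hK⟩ := ihy
    exact ⟨J ++ K, by rw [wordProd_append, hJ, hK]; rfl⟩

/-- The strong exchange condition. -/
theorem exchange (J : List b.support) {a : ι} (ha : b.IsPos a)
    (hn : ¬ b.IsPos ((wordProd b J)⁻¹ • a)) :
    ∃ L i M, J = L ++ i :: M ∧ ofIdx P a * wordProd b J = wordProd b (L ++ M) := by
  induction J generalizing a with
  | nil => simp [wordProd_nil, ha] at hn
  | cons i J ih =>
    by_cases hai : a = i
    · exact ⟨[], i, J, rfl, by rw [wordProd_cons, hai, refl_mul_cancel]; rfl⟩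
    · obtain ⟨L, j, M, rfl, h⟩ := ih (isPos_refl_smul b ha hai) (by
        rwa [wordProd_cons, mul_inv_rev, mul_smul, refl_inv] at hn)
      refine ⟨i :: L, j, M, rfl, ?_⟩
      rw [refl_smul, refl_inv] at h
      rw [List.cons_append, wordProd_cons _ i (L ++ M), ← h, wordProd_cons]
      simp only [mul_assoc, refl_mul_cancel]

/-! ### The length function -/

omit [Finite ι] [P.IsReduced] in
theorem len_wordProd_le (J : List b.support) : len b (wordProd b J) ≤ J.length :=
  Nat.sInf_le ⟨J, rfl, rfl⟩

theorem exists_length_eq_len (w : P.weylGroup) : ∃ J, wordProd b J = w ∧ J.length = len b w :=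
  Nat.sInf_mem (s := {n | ∃ J : List b.support, wordProd b J = w ∧ J.length = n})
    ((exists_wordProd b w).elim fun J h => ⟨_, J, h, rfl⟩)

theorem isReducedWord_iff {J : List b.support} {w : P.weylGroup} :
    IsReducedWord b J w ↔ wordProd b J = w ∧ J.length = len b w := by
  refine ⟨fun h => ⟨h.1, ?_⟩, fun h => ⟨h.1, fun K hK => ?_⟩⟩
  · obtain ⟨K, hK, hl⟩ := exists_length_eq_len b w
    exact le_antisymm (hl ▸ h.2 K hK) (h.1 ▸ len_wordProd_le b J)
  · rw [h.2, ← hK]; exact len_wordProd_le b K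

theorem len_inv (w : P.weylGroup) : len b w⁻¹ = len b w := by
  have key : ∀ v : P.weylGroup, len b v⁻¹ ≤ len b v := fun v => by
    obtain ⟨J, rfl, hl⟩ := exists_length_eq_len b v
    rw [← hl, ← wordProd_reverse, ← List.length_reverse]
    exact len_wordProd_le b _
  exact le_antisymm (key w) (by simpa using key w⁻¹)

omit [Finite ι] [P.IsReduced] in
theorem len_one : len b (1 : P.weylGroup) = 0 :=
  Nat.le_zero.1 (len_wordProd_le b [])

theorem len_refl_mul_lt {w : P.weylGroup} {a : ι} (ha : b.IsPos a) (h : ¬ b.IsPos (w⁻¹ • a)) :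
    len b (ofIdx P a * w) < len b w := by
  obtain ⟨J, rfl, hl⟩ := exists_length_eq_len b w
  obtain ⟨L, i, M, rfl, hLM⟩ := exchange b J ha h
  rw [hLM, ← hl]
  refine (len_wordProd_le b _).trans_lt ?_
  simp

theorem len_lt_refl_mul {w : P.weylGroup} {a : ι} (ha : b.IsPos a) (h : b.IsPos (w⁻¹ • a)) :
    len b w < len b (ofIdx P a * w) := by
  have := len_refl_mul_lt b (w := ofIdx P a * w) ha (by
    rwa [mul_inv_rev, mul_smul, refl_inv, isPos_smul_neg, not_not])
  rwa [refl_mul_cancel] at this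

theorem len_lt_refl_mul_iff {w : P.weylGroup} {a : ι} (ha : b.IsPos a) :
    len b w < len b (ofIdx P a * w) ↔ b.IsPos (w⁻¹ • a) :=
  ⟨fun h => by_contra fun hp => (len_refl_mul_lt b ha hp).asymm h, len_lt_refl_mul b ha⟩

theorem len_simple_mul_le (i : b.support) (w : P.weylGroup) :
    len b (ofIdx P i * w) ≤ len b w + 1 := by
  obtain ⟨J, rfl, hl⟩ := exists_length_eq_len b w
  rw [← wordProd_cons, ← hl]
  exact len_wordProd_le b _

theorem len_simple_mul_of_isPos {i : b.support} {w : P.weylGroup} (h : b.IsPos (w⁻¹ • (i : ι))) :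
    len b (ofIdx P i * w) = len b w + 1 :=
  le_antisymm (len_simple_mul_le b i w) (len_lt_refl_mul b (isPos_simple b i) h)

theorem len_simple_mul_of_not_isPos {i : b.support} {w : P.weylGroup}
    (h : ¬ b.IsPos (w⁻¹ • (i : ι))) : len b (ofIdx P i * w) + 1 = len b w := by
  refine le_antisymm (len_refl_mul_lt b (isPos_simple b i) h) ?_
  simpa only [refl_mul_cancel] using len_simple_mul_le b i (ofIdx P i * w)

theorem len_simple (i : b.support) : len b (ofIdx P i) = 1 := by
  have := len_simple_mul_of_isPos b (i := i) (w := 1) (by simpa using isPos_simple b i)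
  rwa [mul_one, len_one] at this

theorem isReducedWord_self_iff {J : List b.support} :
    IsReducedWord b J (wordProd b J) ↔ len b (wordProd b J) = J.length := by
  rw [isReducedWord_iff]
  exact ⟨fun h => h.2.symm, fun h => ⟨rfl, h.symm⟩⟩

theorem len_tail_of_cons {i : b.support} {J : List b.support}
    (h : len b (wordProd b (i :: J)) = (i :: J).length) : len b (wordProd b J) = J.length := by
  have h1 := len_simple_mul_le b i (wordProd b J)
  have h2 := len_wordProd_le b J
  rw [← wordProd_cons, h, List.length_cons] at h1
  lia

theorem isPos_of_len_cons {i : b.support} {J : List b.support}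
    (h : len b (wordProd b (i :: J)) = (i :: J).length) :
    b.IsPos ((wordProd b J)⁻¹ • (i : ι)) := by
  rw [← len_lt_refl_mul_iff b (isPos_simple b i), ← wordProd_cons, h, len_tail_of_cons b h]
  simp

theorem simpleRefl_ne_one (i : b.support) : ofIdx P i ≠ 1 := fun h => by
  have := len_simple b i
  rw [h, len_one] at this
  exact absurd this (by simp)

omit [Finite ι] in
theorem refl_injective_of_isPos {a c : ι} (ha : b.IsPos a) (hc : b.IsPos c)
    (h : ofIdx P a = ofIdx P c) : a = c := by
  have : ¬ b.IsPos (ofIdx P c • a) := by rw [← h, isPos_refl_self]; exact not_not.2 ha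
  have h2 : P.root (ofIdx P a • a) = P.root (ofIdx P c • a) := by rw [h]
  rw [root_smul, root_smul, refl_smul_eq, refl_smul_eq, P.reflection_apply_self,
    P.reflection_apply_root, neg_eq_iff_add_eq_zero] at h2
  have h3 : (2 : ℤ) • P.root a = P.pairing a c • P.root c := by
    rw [two_smul, eq_comm, ← sub_eq_zero]; rw [← neg_eq_zero, ← h2]; abel
  have h4 := RootPairing.IsReduced.linearIndependent (P := P) (i := a) (j := c)
  by_contra hne
  rcases eq_or_ne (P.root a) (-P.root c) with hneg | hneg
  · have : a = ofIdx P c • c := P.root.injective (by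
      rw [hneg, root_smul, refl_smul_eq, P.reflection_apply_self])
    rw [this, isPos_refl_self] at ha
    exact ha hc
  · have := LinearIndependent.pair_iff.1 (h4 hne hneg) 2 (-P.pairing a c) (by rw [h3]; simp)
    simpa using this.1

omit [Finite ι] in
theorem simpleRefl_injective {i j : b.support} (h : ofIdx P (i : ι) = ofIdx P j) : i = j :=
  Subtype.ext (refl_injective_of_isPos b (isPos_simple b i) (isPos_simple b j) h)

end Reduced

end Weyl

section Weyl

variable {ι X Y : Type*} [AddCommGroup X] [AddCommGroup Y] {P : RootDatum ι X Y}

open RootPairing.weylGroup (ofIdx)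

variable (b : P.Base)

/-! ### Dihedral subgroups -/

theorem altWord_length {B : Type*} (i j : B) (k : ℕ) : (altWord i j k).length = k := by
  induction k generalizing i j with
  | zero => rfl
  | succ k ih => rw [altWord, List.length_cons, ih]

/-- The element of the dihedral group generated by `s_i` and `s_j` with index `N`:
`(s_i s_j) ^ z` if `N = 2 z`, and `(s_i s_j) ^ z s_i` if `N = 2 z + 1`. Alternating words of
length `k` have index `k` or `-k`. -/
noncomputable def dihedralElt (i j : b.support) (N : ℤ) : P.weylGroup :=
  (ofIdx P i * ofIdx P j) ^ (N / 2) * if Even N then 1 else ofIdx P i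

theorem refl_mul_zpow (i j : b.support) (z : ℤ) :
    ofIdx P i * (ofIdx P i * ofIdx P j) ^ z = (ofIdx P i * ofIdx P j) ^ (-z) * ofIdx P i := by
  have h : ofIdx P (i : ι) * (ofIdx P i * ofIdx P j) * (ofIdx P i)⁻¹ = (ofIdx P i * ofIdx P j)⁻¹ := by
    rw [mul_inv_rev, refl_inv, refl_inv, refl_mul_cancel]
  rw [zpow_neg, ← inv_zpow, ← h, conj_zpow, inv_mul_cancel_right]

theorem refl_mul_dihedralElt (i j : b.support) (N : ℤ) :
    ofIdx P i * dihedralElt b i j N = dihedralElt b i j (1 - N) := by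
  rcases Int.even_or_odd' N with ⟨z, rfl | rfl⟩
  · have h1 : (1 - 2 * z) / 2 = -z := by lia
    have h2 : ¬ Even (1 - 2 * z) := by rw [Int.even_sub]; simp
    simp [dihedralElt, h1, h2, refl_mul_zpow]
  · have h1 : (1 - (2 * z + 1)) / 2 = -z := by lia
    have h2 : Even (1 - (2 * z + 1)) := ⟨-z, by ring⟩
    have h3 : (2 * z + 1) / 2 = z := by lia
    have h4 : ¬ Even (2 * z + 1) := by simp
    rw [dihedralElt, dihedralElt, h1, h3, if_pos h2, if_neg h4, ← mul_assoc, refl_mul_zpow,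
      mul_assoc, refl_mul_self]

theorem refl_mul_dihedralElt' (i j : b.support) (N : ℤ) :
    ofIdx P j * dihedralElt b i j N = dihedralElt b i j (-1 - N) := by
  have h : ofIdx P (j : ι) = ofIdx P i * (ofIdx P i * ofIdx P j) := (refl_mul_cancel _ _).symm
  have h2 : (ofIdx P (i : ι) * ofIdx P j) * dihedralElt b i j N = dihedralElt b i j (N + 2) := by
    have h3 : (N + 2) / 2 = N / 2 + 1 := by lia
    have h4 : Even (N + 2) ↔ Even N := by rw [Int.even_add]; simp
    simp only [dihedralElt, h3, h4]
    rw [add_comm, zpow_add, zpow_one, ← mul_assoc]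
  rw [h, mul_assoc, h2, refl_mul_dihedralElt]
  congr 1
  ring

theorem dihedralElt_zero (i j : b.support) : dihedralElt b i j 0 = 1 := by
  simp [dihedralElt]

theorem wordProd_altWord (i j : b.support) (k : ℕ) :
    wordProd b (altWord i j k) = dihedralElt b i j k ∧
      wordProd b (altWord j i k) = dihedralElt b i j (-k) := by
  induction k with
  | zero => simp [altWord, wordProd_nil, dihedralElt_zero]
  | succ k ih =>
    rw [altWord, altWord, wordProd_cons, wordProd_cons, ih.1, ih.2, refl_mul_dihedralElt,
      refl_mul_dihedralElt']
    constructor <;> congr 1 <;> push_cast <;> ring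

theorem wordProd_eq_dihedralElt (i j : b.support) (K : List b.support)
    (hK : ∀ l ∈ K, l = i ∨ l = j) :
    ∃ N : ℤ, wordProd b K = dihedralElt b i j N ∧ |N| ≤ K.length ∧ (2 : ℤ) ∣ K.length - N := by
  induction K with
  | nil => exact ⟨0, by rw [dihedralElt_zero]; rfl, by simp, by simp⟩
  | cons l K ih =>
    obtain ⟨N, h1, h2, h3⟩ := ih fun l hl => hK l (List.mem_cons_of_mem _ hl)
    rw [abs_le] at h2
    rcases hK l List.mem_cons_self with rfl | rfl
    · refine ⟨1 - N, by rw [wordProd_cons, h1, refl_mul_dihedralElt], abs_le.2 ?_, ?_⟩ <;>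
        simp only [List.length_cons] <;> lia
    · refine ⟨-1 - N, by rw [wordProd_cons, h1, refl_mul_dihedralElt'], abs_le.2 ?_, ?_⟩ <;>
        simp only [List.length_cons] <;> lia

theorem coxNum_dvd_of_dihedralElt_eq {i j : b.support} {M N : ℤ} (hMN : (2 : ℤ) ∣ M - N)
    (h : dihedralElt b i j M = dihedralElt b i j N) : (coxNum b i j : ℤ) ∣ (M - N) / 2 := by
  obtain ⟨z, hz⟩ := hMN
  obtain rfl : M = N + 2 * z := by lia
  have h3 : (N + 2 * z) / 2 = N / 2 + z := by lia
  have h4 : Even (N + 2 * z) ↔ Even N := by rw [Int.even_add]; simp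
  simp only [dihedralElt, h3, h4] at h
  have h5 := mul_right_cancel h
  rw [zpow_add, mul_eq_left] at h5
  have h6 : (N + 2 * z - N) / 2 = z := by lia
  rw [h6]
  exact orderOf_dvd_iff_zpow_eq_one.2 h5

theorem coxNum_comm (i j : b.support) : coxNum b i j = coxNum b j i := by
  rw [coxNum, coxNum, ← orderOf_inv, mul_inv_rev]
  simp only [simpleRefl, refl_inv]

/-- The braid relation `s_i s_j s_i ⋯ = s_j s_i s_j ⋯`. -/
theorem wordProd_altWord_coxNum (i j : b.support) :
    wordProd b (altWord i j (coxNum b i j)) = wordProd b (altWord j i (coxNum b i j)) := by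
  rw [(wordProd_altWord b i j _).1, (wordProd_altWord b i j _).2]
  set m := coxNum b i j with hm
  have h1 : (ofIdx P (i : ι) * ofIdx P j) ^ m = 1 := pow_orderOf_eq_one _
  have h2 : (m : ℤ) / 2 = (-(m : ℤ)) / 2 + m := by lia
  simp only [dihedralElt, even_neg]
  rw [h2, zpow_add, zpow_natCast, h1, mul_one]

theorem mem_altWord {B : Type*} {i j l : B} {k : ℕ} (h : l ∈ altWord i j k) : l = i ∨ l = j := by
  induction k generalizing i j with
  | zero => simp [altWord] at h
  | succ k ih =>
    rw [altWord, List.mem_cons] at h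
    exact h.elim Or.inl fun h => (ih h).symm

section Reduced

variable [Finite ι] [P.IsReduced]

/-- Alternating words of length at most `m_{ij}` are reduced. -/
theorem len_altWord {i j : b.support} {k : ℕ} (hk : k ≤ coxNum b i j ∨ coxNum b i j = 0) :
    len b (wordProd b (altWord i j k)) = k := by
  induction k generalizing i j with
  | zero => exact len_one b
  | succ k ih =>
    have ih' : len b (wordProd b (altWord j i k)) = k :=
      ih (by rw [coxNum_comm]; exact hk.imp_left (by lia))
    rw [altWord, wordProd_cons]
    by_cases hp : b.IsPos ((wordProd b (altWord j i k))⁻¹ • (i : ι))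
    · rw [len_simple_mul_of_isPos b hp, ih']
    -- otherwise the exchange condition gives a shorter word in `s_i` and `s_j` for the same element
    exfalso
    obtain ⟨L, l, M, hLM, h⟩ := exchange b _ (isPos_simple b i) hp
    have hlen := altWord_length j i k
    rw [hLM, List.length_append, List.length_cons] at hlen
    obtain ⟨N, h1, h2, h3⟩ := wordProd_eq_dihedralElt b i j (L ++ M) fun l hl => by
      refine (mem_altWord (i := j) (j := i) (k := k) ?_).symm
      rw [hLM]
      simp only [List.mem_append, List.mem_cons] at hl ⊢
      tauto
    rw [h1, (wordProd_altWord b i j k).2, refl_mul_dihedralElt] at h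
    rw [abs_le] at h2
    simp only [List.length_append] at h2 h3
    have h4 := coxNum_dvd_of_dihedralElt_eq b (by lia) h
    rcases hk with hk | hk
    · have := Int.le_of_dvd (by lia) h4
      lia
    · rw [hk] at h4
      simp only [Nat.cast_zero, zero_dvd_iff] at h4
      lia

theorem len_simple_mul_lt_of_cons {i : b.support} {J : List b.support} {w : P.weylGroup}
    (h : IsReducedWord b (i :: J) w) : IsReducedWord b J (ofIdx P i * w) := by
  obtain ⟨rfl, hl⟩ := (isReducedWord_iff b).1 h
  refine (isReducedWord_iff b).2 ⟨by rw [wordProd_cons, refl_mul_cancel], ?_⟩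
  rw [wordProd_cons, refl_mul_cancel]
  exact (len_tail_of_cons b hl.symm).symm

theorem not_isPos_of_cons {i : b.support} {J : List b.support} {w : P.weylGroup}
    (h : IsReducedWord b (i :: J) w) : ¬ b.IsPos (w⁻¹ • (i : ι)) := by
  obtain ⟨rfl, hl⟩ := (isReducedWord_iff b).1 h
  have := isPos_of_len_cons b hl.symm
  rwa [wordProd_cons, mul_inv_rev, mul_smul, refl_inv, isPos_smul_neg, not_not]

/-- If `s_i` and `s_j` are left descents of `w`, then `w` has a reduced word that starts with an
alternating word. -/
theorem exists_reduced_altWord_append {w : P.weylGroup} {i j : b.support}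
    (hi : ¬ b.IsPos (w⁻¹ • (i : ι))) (hj : ¬ b.IsPos (w⁻¹ • (j : ι))) {k : ℕ}
    (hk : k ≤ coxNum b i j ∨ coxNum b i j = 0) :
    ∃ K, IsReducedWord b (altWord i j k ++ K) w := by
  induction k generalizing i j with
  | zero =>
    obtain ⟨K, h1, h2⟩ := exists_length_eq_len b w
    exact ⟨K, (isReducedWord_iff b).2 ⟨h1, h2⟩⟩
  | succ k ih =>
    obtain ⟨K, hK⟩ := ih hj hi (by rw [coxNum_comm]; exact hk.imp_left (by lia))
    obtain ⟨h1, h2⟩ := (isReducedWord_iff b).1 hK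
    set A := wordProd b (altWord j i k) with hA
    rw [wordProd_append, ← hA] at h1
    have hlen : len b (ofIdx P i * A) = k + 1 := by
      rw [hA, ← wordProd_cons]; exact len_altWord b hk
    have hp : b.IsPos (A⁻¹ • (i : ι)) := by
      rw [← len_lt_refl_mul_iff b (isPos_simple b i), hlen, hA,
        len_altWord b (by rw [coxNum_comm]; exact hk.imp_left (by lia))]
      exact Nat.lt_succ_self k
    obtain ⟨L, l, M, rfl, h⟩ := exchange b K hp (by
      rwa [← h1, mul_inv_rev, mul_smul] at hi)
    refine ⟨L ++ M, (isReducedWord_iff b).2 ⟨?_, ?_⟩⟩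
    · rw [altWord, List.cons_append, wordProd_cons, wordProd_append, ← hA, ← h, ← h1, refl_smul,
        inv_inv]
      simp only [mul_assoc, mul_inv_cancel_left, refl_mul_cancel]
    · rw [← h2]
      simp [altWord_length]
      lia

/-- The replacement of an alternating factor `(i, j, i, …)` of length `m_{ij}` by
`(j, i, j, …)`. -/
inductive BraidMove : List b.support → List b.support → Prop
  | mk (A B : List b.support) (i j : b.support) (hij : i ≠ j) :
      BraidMove (A ++ (altWord i j (coxNum b i j) ++ B)) (A ++ (altWord j i (coxNum b i j) ++ B))

omit [Finite ι] [P.IsReduced] in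
theorem BraidMove.cons {J K : List b.support} (h : BraidMove b J K) (l : b.support) :
    BraidMove b (l :: J) (l :: K) := by
  obtain ⟨A, B, i, j, hij⟩ := h
  exact BraidMove.mk (l :: A) B i j hij

omit [Finite ι] [P.IsReduced] in
theorem eqvGen_braidMove_cons {J K : List b.support} (h : Relation.EqvGen (BraidMove b) J K)
    (l : b.support) : Relation.EqvGen (BraidMove b) (l :: J) (l :: K) := by
  induction h with
  | rel _ _ h => exact .rel _ _ (h.cons b l)
  | refl => exact .refl _
  | symm _ _ _ ih => exact .symm _ _ ih
  | trans _ _ _ _ _ ih1 ih2 => exact .trans _ _ _ ih1 ih2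

theorem coxNum_ne_zero_of_descents {w : P.weylGroup} {i j : b.support}
    (hi : ¬ b.IsPos (w⁻¹ • (i : ι))) (hj : ¬ b.IsPos (w⁻¹ • (j : ι))) : coxNum b i j ≠ 0 := by
  intro h
  obtain ⟨K, hK⟩ := exists_reduced_altWord_append b hi hj (k := len b w + 1) (Or.inr h)
  have := ((isReducedWord_iff b).1 hK).2
  simp [altWord_length] at this
  lia

/-- **Matsumoto's theorem**: two reduced words of the same element are connected by braid
moves. -/
theorem eqvGen_braidMove {J K : List b.support} {w : P.weylGroup} (hJ : IsReducedWord b J w)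
    (hK : IsReducedWord b K w) : Relation.EqvGen (BraidMove b) J K := by
  induction hn : J.length generalizing J K w with
  | zero =>
    have h := ((isReducedWord_iff b).1 hK).2
    rw [← ((isReducedWord_iff b).1 hJ).2, hn] at h
    rw [List.length_eq_zero_iff.1 hn, List.length_eq_zero_iff.1 h]
    exact .refl _
  | succ n ih =>
    have hlen : K.length = n + 1 := by
      rw [((isReducedWord_iff b).1 hK).2, ← ((isReducedWord_iff b).1 hJ).2, hn]
    obtain ⟨i, J, rfl⟩ := List.exists_cons_of_length_eq_add_one hn
    obtain ⟨j, K, rfl⟩ := List.exists_cons_of_length_eq_add_one hlen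
    have key : ∀ (l : b.support) {M M' : List b.support}, IsReducedWord b (l :: M) w →
        IsReducedWord b (l :: M') w → M.length = n →
        Relation.EqvGen (BraidMove b) (l :: M) (l :: M') := fun l M M' hM hM' hl =>
      eqvGen_braidMove_cons b (ih (len_simple_mul_lt_of_cons b hM)
        (len_simple_mul_lt_of_cons b hM') hl) l
    by_cases hij : i = j
    · subst hij
      exact key i hJ hK (by simpa using hn)
    · have hi := not_isPos_of_cons b hJ
      have hj := not_isPos_of_cons b hK
      obtain ⟨M, hM⟩ := exists_reduced_altWord_append b hi hj (Or.inl le_rfl)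
      have hM' : IsReducedWord b (altWord j i (coxNum b i j) ++ M) w := by
        obtain ⟨h1, h2⟩ := (isReducedWord_iff b).1 hM
        refine (isReducedWord_iff b).2 ⟨?_, ?_⟩
        · rw [← h1, wordProd_append, wordProd_append, wordProd_altWord_coxNum]
        · rw [← h2]; simp [altWord_length]
      obtain ⟨m, hm⟩ := Nat.exists_eq_succ_of_ne_zero (coxNum_ne_zero_of_descents b hi hj)
      have hb : BraidMove b (altWord i j (coxNum b i j) ++ M) (altWord j i (coxNum b i j) ++ M) :=
        BraidMove.mk [] M i j hij
      rw [hm] at hM hM' hb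
      exact .trans _ _ _ (key i hJ hM (by simpa using hn))
        (.trans _ _ _ (.rel _ _ hb) (.symm _ _ (key j hK hM' (by simpa using hlen))))

/-! ### The Bruhat order -/

omit [Finite ι] [P.IsReduced] in
theorem bruhatLT_refl_mul {w : P.weylGroup} {a : ι} (h : len b w < len b (ofIdx P a * w)) :
    BruhatLT b w (ofIdx P a * w) :=
  .single ⟨⟨w⁻¹ • a, by rw [refl_smul, inv_inv]; simp only [mul_assoc, mul_inv_cancel_left]⟩, h⟩

/-- The lifting property of the Bruhat order. -/
theorem bruhat_simple_mul {i : b.support} {x y : P.weylGroup} (h : BruhatLT b x y) :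
    ofIdx P i * x = y ∨ BruhatLT b (ofIdx P i * x) y ∨ BruhatLT b (ofIdx P i * x) (ofIdx P i * y) := by
  have step : ∀ x z : P.weylGroup, (∃ a, z = x * ofIdx P a) ∧ len b x < len b z →
      ofIdx P i * x = z ∨ BruhatLT b (ofIdx P i * x) (ofIdx P i * z) := by
    rintro x z ⟨⟨a, rfl⟩, hl⟩
    obtain ⟨c, hc, hca⟩ := exists_isPos_refl_eq b (x • a)
    have hxa : x * ofIdx P a = ofIdx P c * x := by rw [hca, refl_smul, inv_mul_cancel_right]
    rw [hxa] at hl ⊢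
    by_cases hci : c = i
    · exact Or.inl (by rw [hci])
    · right
      have h2 : ofIdx P i * (ofIdx P c * x) = ofIdx P (ofIdx P i • c) * (ofIdx P i * x) := by
        rw [refl_smul, refl_inv]
        simp only [mul_assoc, refl_mul_cancel]
      rw [h2]
      refine bruhatLT_refl_mul b (len_lt_refl_mul b (isPos_refl_smul b hc hci) ?_)
      rw [len_lt_refl_mul_iff b hc] at hl
      rwa [mul_inv_rev, mul_smul, refl_inv, refl_idx_smul_self]
  induction h using Relation.TransGen.head_induction_on with
  | single h => exact (step _ _ h).imp_right Or.inr
  | head h hzy ih =>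
    rcases step _ _ h with h1 | h1
    · exact Or.inr (Or.inl (h1 ▸ hzy))
    · rcases ih with h2 | h2 | h2
      · exact Or.inr (Or.inl (h2 ▸ h1))
      · exact Or.inr (Or.inl (h1.trans h2))
      · exact Or.inr (Or.inr (h1.trans h2))

/-- The product of a subword of a reduced word of `w` is at most `w` in the Bruhat order. -/
theorem bruhat_of_sublist {J K : List b.support} (h : K.Sublist J)
    (hJ : len b (wordProd b J) = J.length) :
    wordProd b K = wordProd b J ∨ BruhatLT b (wordProd b K) (wordProd b J) := by
  induction h with
  | slnil => exact Or.inl rfl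
  | @cons K J i h ih =>
    have hlt : BruhatLT b (wordProd b J) (wordProd b (i :: J)) := by
      rw [wordProd_cons]
      refine bruhatLT_refl_mul b ?_
      rw [← wordProd_cons, hJ, len_tail_of_cons b hJ]
      simp
    rcases ih (len_tail_of_cons b hJ) with h1 | h1
    · exact Or.inr (h1 ▸ hlt)
    · exact Or.inr (h1.trans hlt)
  | @cons_cons K J i h ih =>
    have hlt : BruhatLT b (wordProd b J) (ofIdx P i * wordProd b J) := by
      refine bruhatLT_refl_mul b ?_
      rw [← wordProd_cons, hJ, len_tail_of_cons b hJ]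
      simp
    rw [wordProd_cons, wordProd_cons]
    rcases ih (len_tail_of_cons b hJ) with h1 | h1
    · exact Or.inl (by rw [h1])
    · rcases bruhat_simple_mul b (i := i) h1 with h2 | h2 | h2
      · exact Or.inr (h2 ▸ hlt)
      · exact Or.inr (h2.trans hlt)
      · exact Or.inr h2

omit [Finite ι] [P.IsReduced] in
theorem BruhatLT.len_lt {v w : P.weylGroup} (h : BruhatLT b v w) : len b v < len b w := by
  induction h with
  | single h => exact h.2
  | tail _ h ih => exact ih.trans h.2

end Reduced

end Weyl

/-! ### Demazure-Lusztig words in a twisted group algebra -/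

section Twisted

open RootPairing.weylGroup (ofIdx)

variable {ι X Y : Type*} [AddCommGroup X] [AddCommGroup Y] {P : RootDatum ι X Y}

/-- A commutative ring `Q` with an action of the Weyl group, an invariant element `t` and units
`x a`, one for each root `a`, that are permuted by the Weyl group. The inverse of `x a` is `y a`.
This is what is needed to define the elements `T_a = t / x_a + (1 - t / x_a) δ_{s_a}`. -/
structure TwistDatum (P : RootDatum ι X Y) (Q : Type*) [CommRing Q]
    [MulSemiringAction P.weylGroup Q] where
  x : ι → Q
  y : ι → Q
  t : Q
  x_mul_y : ∀ a, x a * y a = 1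
  smul_x : ∀ (w : P.weylGroup) a, w • x a = x (w • a)
  smul_t : ∀ w : P.weylGroup, w • t = t

namespace TwistDatum

variable {Q : Type*} [CommRing Q] [MulSemiringAction P.weylGroup Q] (E : TwistDatum P Q)

theorem smul_y (w : P.weylGroup) (a : ι) : w • E.y a = E.y (w • a) := by
  have h : w • (E.x a * E.y a) = 1 := by rw [E.x_mul_y, smul_one]
  rw [smul_mul', E.smul_x] at h
  calc w • E.y a = (E.x (w • a) * E.y (w • a)) * w • E.y a := by rw [E.x_mul_y, one_mul]
    _ = E.y (w • a) * (E.x (w • a) * w • E.y a) := by ring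
    _ = E.y (w • a) := by rw [h, mul_one]

/-- The Demazure-Lusztig element `T_a = t / x_a + (1 - t / x_a) δ_{s_a}`. -/
noncomputable def T (a : ι) : SkewMonoidAlgebra Q P.weylGroup :=
  .single 1 (E.t * E.y a) + .single (ofIdx P a) (1 - E.t * E.y a)

theorem coeff_T_mul (a : ι) (z : SkewMonoidAlgebra Q P.weylGroup) (w : P.weylGroup) :
    (E.T a * z).coeff w = E.t * E.y a * z.coeff w +
      (1 - E.t * E.y a) * ofIdx P a • z.coeff (ofIdx P a * w) := by
  rw [T, add_mul, SkewMonoidAlgebra.coeff_add, Finsupp.add_apply,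
    SkewMonoidAlgebra.coeff_single_one_mul, SkewMonoidAlgebra.coeff_single_mul, refl_inv]

variable (b : P.Base)

/-- The product of the elements `T_i` along a word in the simple roots. -/
noncomputable def word (J : List b.support) : SkewMonoidAlgebra Q P.weylGroup :=
  (J.map fun i : b.support => E.T i).prod

theorem word_cons (i : b.support) (J : List b.support) :
    E.word b (i :: J) = E.T i * E.word b J := by simp [word]

theorem word_append (J K : List b.support) :
    E.word b (J ++ K) = E.word b J * E.word b K := by simp [word]

/-- Each factor `T_i` contributes either `δ_1` or `δ_{s_i}`, so the support of a word consists of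
products of its subwords. -/
theorem exists_sublist_of_coeff_ne_zero {J : List b.support} {w : P.weylGroup}
    (h : (E.word b J).coeff w ≠ 0) : ∃ K, K.Sublist J ∧ wordProd b K = w := by
  induction J generalizing w with
  | nil =>
    refine ⟨[], .slnil, ?_⟩
    by_contra hw
    rw [word, List.map_nil, List.prod_nil, SkewMonoidAlgebra.coeff_one] at h
    exact h (Finsupp.single_eq_of_ne (Ne.symm hw))
  | cons i J ih =>
    rw [word_cons, coeff_T_mul] at h
    by_cases h1 : (E.word b J).coeff w = 0
    · have h2 : (E.word b J).coeff (ofIdx P i * w) ≠ 0 := fun h2 => h (by simp [h1, h2])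
      obtain ⟨K, hK, hw⟩ := ih h2
      exact ⟨i :: K, hK.cons_cons i, by rw [wordProd_cons, hw, refl_mul_cancel]⟩
    · obtain ⟨K, hK, hw⟩ := ih h1
      exact ⟨K, hK.cons i, hw⟩

theorem len_le_of_coeff_ne_zero {J : List b.support} {w : P.weylGroup}
    (h : (E.word b J).coeff w ≠ 0) : len b w ≤ J.length := by
  obtain ⟨K, hK, rfl⟩ := E.exists_sublist_of_coeff_ne_zero b h
  exact (len_wordProd_le b K).trans hK.length_le

theorem coeff_of_length_lt {J : List b.support} {w : P.weylGroup} (h : J.length < len b w) :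
    (E.word b J).coeff w = 0 :=
  by_contra fun hw => h.not_ge (E.len_le_of_coeff_ne_zero b hw)

variable [Finite ι]

/-- The positive roots `a` for which `w⁻¹ a` is negative. -/
noncomputable def _root_.FormalHecke.inversions (w : P.weylGroup) : Finset ι :=
  (Set.toFinite {a | b.IsPos a ∧ ¬ b.IsPos (w⁻¹ • a)}).toFinset

theorem _root_.FormalHecke.mem_inversions {w : P.weylGroup} {a : ι} :
    a ∈ inversions b w ↔ b.IsPos a ∧ ¬ b.IsPos (w⁻¹ • a) := by
  simp [inversions]

theorem _root_.FormalHecke.inversions_one : inversions b (1 : P.weylGroup) = ∅ := by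
  ext a; simp [mem_inversions]

/-- The product of `1 - t / x_a` over the inversions `a` of `w`, which turns out to be the
coefficient of `δ_w` in `T_J` for each reduced word `J` of `w`. -/
noncomputable def lead (w : P.weylGroup) : Q := ∏ a ∈ inversions b w, (1 - E.t * E.y a)

theorem lead_one : E.lead b 1 = 1 := by rw [lead, inversions_one, Finset.prod_empty]

variable [P.IsReduced]

theorem _root_.FormalHecke.inversions_simple_mul [DecidableEq ι] {i : b.support}
    {w : P.weylGroup} (h : b.IsPos (w⁻¹ • (i : ι))) :
    inversions b (ofIdx P i * w) = insert (i : ι) ((inversions b w).image (ofIdx P i • ·)) := by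
  ext a
  rw [Finset.mem_insert, Finset.mem_image, mem_inversions]
  constructor
  · rintro ⟨h1, h2⟩
    by_cases ha : a = i
    · exact Or.inl ha
    · refine Or.inr ⟨ofIdx P i • a, (mem_inversions b).2 ⟨isPos_refl_smul b h1 ha, ?_⟩,
        refl_idx_smul_self _ _⟩
      rwa [mul_inv_rev, mul_smul, refl_inv] at h2
  · rintro (rfl | ⟨c, hc, rfl⟩)
    · refine ⟨isPos_simple b i, ?_⟩
      rw [mul_inv_rev, mul_smul, refl_inv, isPos_smul_neg, not_not]
      exact h
    · obtain ⟨h1, h2⟩ := (mem_inversions b).1 hc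
      refine ⟨isPos_refl_smul b h1 (by rintro rfl; exact h2 h), ?_⟩
      rwa [mul_inv_rev, mul_smul, refl_inv, refl_idx_smul_self]

/-- Here `s_i w` has one more inversion than `w`, namely `α_i`, the others being the images under
`s_i` of the inversions of `w`. -/
theorem lead_simple_mul {i : b.support} {w : P.weylGroup} (h : b.IsPos (w⁻¹ • (i : ι))) :
    E.lead b (ofIdx P i * w) = (1 - E.t * E.y i) * ofIdx P i • E.lead b w := by
  classical
  rw [lead, inversions_simple_mul b h, Finset.prod_insert, Finset.prod_image, lead,
    Finset.smul_prod']
  · simp only [smul_sub, smul_mul', smul_one, E.smul_t, E.smul_y]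
  · exact fun a _ c _ h => MulAction.injective (ofIdx P (i : ι)) h
  · intro hi
    obtain ⟨c, hc, hci⟩ := Finset.mem_image.1 hi
    have : c = ofIdx P i • (i : ι) := by rw [← refl_idx_smul_self (P := P) (i : ι) c]; exact congrArg _ hci
    rw [mem_inversions, this, isPos_refl_self] at hc
    exact hc.1 (isPos_simple b i)

/-- The coefficient at the top of a reduced word does not depend on the word. -/
theorem coeff_of_reduced {J : List b.support} {w : P.weylGroup} (h : IsReducedWord b J w) :
    (E.word b J).coeff w = E.lead b w := by
  induction J generalizing w with
  | nil =>
    obtain rfl : 1 = w := h.1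
    rw [lead_one]
    simp [word]
  | cons i J ih =>
    obtain ⟨rfl, hl⟩ := (isReducedWord_iff b).1 h
    have hJ := len_tail_of_cons b hl.symm
    rw [word_cons, coeff_T_mul, E.coeff_of_length_lt b (w := wordProd b (i :: J)) (by
      rw [← hl]; simp), wordProd_cons, refl_mul_cancel,
      ih ((isReducedWord_self_iff b).2 hJ), lead_simple_mul E b (isPos_of_len_cons b hl.symm)]
    ring

theorem coeff_eq_zero_of_reduced {J : List b.support} {v w : P.weylGroup}
    (h : IsReducedWord b J w) (hv : v ≠ w) (hl : len b w ≤ len b v) :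
    (E.word b J).coeff v = 0 := by
  by_contra hne
  obtain ⟨K, hK, rfl⟩ := E.exists_sublist_of_coeff_ne_zero b hne
  obtain ⟨rfl, hJ⟩ := (isReducedWord_iff b).1 h
  have h1 := len_wordProd_le b K
  rw [hK.eq_of_length_le (by lia)] at hv
  exact hv rfl

end TwistDatum

end Twisted

/-! ### The lattice spanned by the Demazure-Lusztig words, by residues -/

section Residues

open RootPairing.weylGroup (ofIdx)

variable {ι X Y : Type*} [AddCommGroup X] [AddCommGroup Y] {P : RootDatum ι X Y}
variable {Q : Type*} [CommRing Q] [MulSemiringAction P.weylGroup Q]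

/-- A subring `S` of `Q` that has the divisibility properties of a formal group algebra over a
domain of characteristic zero inside its localization at the `x_a`: Demazure operators
preserve `S`, the elements `1 / x_a + 1 / x_{-a}` lie in `S`, and modulo `x_a` neither the `x_c`
with `c ≠ ± a` nor the `t - x_c` are zero divisors. -/
structure TwistDatum.IsResidual (E : TwistDatum P Q) (S : Subring Q) : Prop where
  x_mem : ∀ a, E.x a ∈ S
  t_mem : E.t ∈ S
  smul_mem : ∀ (w : P.weylGroup), ∀ f ∈ S, w • f ∈ S
  demazure_mem : ∀ a, ∀ f ∈ S, E.y a * (f - ofIdx P a • f) ∈ S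
  kappa_mem : ∀ a, E.y a + E.y (ofIdx P a • a) ∈ S
  div_x : ∀ a c, ∀ f ∈ S, c ≠ a → c ≠ ofIdx P a • a → E.x c * (f * E.y a) ∈ S → f * E.y a ∈ S
  div_t : ∀ a c, ∀ f ∈ S, (E.t - E.x c) * (f * E.y a) ∈ S → f * E.y a ∈ S
  exists_mul_mem : ∀ q, ∃ m ∈ Submonoid.closure (Set.range E.x), m * q ∈ S

namespace TwistDatum

variable (E : TwistDatum P Q) {S : Subring Q}

/-- The monomials in the `x_c`, `c ≠ ± a`. -/
def primeMonomials (a : ι) : Submonoid Q :=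
  Submonoid.closure (E.x '' {c | c ≠ a ∧ c ≠ ofIdx P a • a})

theorem x_mem_primeMonomials {a c : ι} (h : c ≠ a) (h' : c ≠ ofIdx P a • a) :
    E.x c ∈ E.primeMonomials a := Submonoid.subset_closure ⟨c, ⟨h, h'⟩, rfl⟩

theorem smul_mem_primeMonomials (w : P.weylGroup) {a : ι} {m : Q} (hm : m ∈ E.primeMonomials a) :
    w • m ∈ E.primeMonomials (w • a) := by
  induction hm using Submonoid.closure_induction with
  | mem m hm =>
    obtain ⟨c, ⟨h1, h2⟩, rfl⟩ := hm
    rw [E.smul_x]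
    refine E.x_mem_primeMonomials (fun h => h1 (MulAction.injective w h)) fun h => h2 ?_
    rw [refl_smul, mul_smul, mul_smul, inv_smul_smul] at h
    exact MulAction.injective w h
  | one => rw [smul_one]; exact one_mem _
  | mul m n _ _ h1 h2 => rw [smul_mul']; exact mul_mem h1 h2

theorem primeMonomials_neg (a : ι) : E.primeMonomials (ofIdx P a • a) = E.primeMonomials a := by
  have : {c | c ≠ ofIdx P a • a ∧ c ≠ ofIdx P (ofIdx P a • a) • ofIdx P a • a} =
      {c | c ≠ a ∧ c ≠ ofIdx P a • a} := by
    ext c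
    rw [Set.mem_ofPred_eq, Set.mem_ofPred_eq, refl_neg, refl_idx_smul_self, and_comm]
  rw [primeMonomials, this, primeMonomials]

/-- The elements of `Q` that have no pole along `x_a`. -/
def regularAt (S : Subring Q) (a : ι) : Set Q := {q | ∃ m ∈ E.primeMonomials a, m * q ∈ S}

variable {E} (h : E.IsResidual S)
include h

namespace IsResidual

theorem primeMonomials_le {a : ι} {m : Q} (hm : m ∈ E.primeMonomials a) : m ∈ S := by
  induction hm using Submonoid.closure_induction with
  | mem m hm => obtain ⟨c, -, rfl⟩ := hm; exact h.x_mem c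
  | one => exact one_mem _
  | mul m n _ _ h1 h2 => exact mul_mem h1 h2

/-- The ring of elements without pole along `x_a`. -/
def regularRing (a : ι) : Subring Q where
  carrier := E.regularAt S a
  mul_mem' := by
    rintro p q ⟨m, hm, hp⟩ ⟨n, hn, hq⟩
    exact ⟨m * n, mul_mem hm hn, by rw [mul_mul_mul_comm]; exact mul_mem hp hq⟩
  one_mem' := ⟨1, one_mem _, by rw [one_mul]; exact one_mem _⟩
  add_mem' := by
    rintro p q ⟨m, hm, hp⟩ ⟨n, hn, hq⟩
    refine ⟨m * n, mul_mem hm hn, ?_⟩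
    have : m * n * (p + q) = n * (m * p) + m * (n * q) := by ring
    rw [this]
    exact add_mem (mul_mem (h.primeMonomials_le hn) hp) (mul_mem (h.primeMonomials_le hm) hq)
  zero_mem' := ⟨1, one_mem _, by rw [mul_zero]; exact zero_mem _⟩
  neg_mem' := by
    rintro p ⟨m, hm, hp⟩
    exact ⟨m, hm, by rw [mul_neg]; exact neg_mem hp⟩

theorem mem_regularRing_of_mem {q : Q} (hq : q ∈ S) (a : ι) : q ∈ h.regularRing a :=
  ⟨1, one_mem _, by rwa [one_mul]⟩

theorem regularRing_neg (a : ι) : h.regularRing (ofIdx P a • a) = h.regularRing a := by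
  ext q
  change (∃ m ∈ E.primeMonomials _, _) ↔ ∃ m ∈ E.primeMonomials _, _
  rw [primeMonomials_neg]

theorem smul_mem_regularRing (w : P.weylGroup) {a : ι} {q : Q} (hq : q ∈ h.regularRing a) :
    w • q ∈ h.regularRing (w • a) := by
  obtain ⟨m, hm, hq⟩ := hq
  exact ⟨w • m, E.smul_mem_primeMonomials w hm, by rw [← smul_mul']; exact h.smul_mem w _ hq⟩

theorem y_mem_regularRing {a c : ι} (h1 : c ≠ a) (h2 : c ≠ ofIdx P a • a) :
    E.y c ∈ h.regularRing a :=
  ⟨E.x c, E.x_mem_primeMonomials h1 h2, by rw [E.x_mul_y]; exact one_mem _⟩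

theorem div_primeMonomials {a : ι} {m f : Q} (hm : m ∈ E.primeMonomials a) (hf : f ∈ S)
    (hmf : m * (f * E.y a) ∈ S) : f * E.y a ∈ S := by
  induction hm using Submonoid.closure_induction generalizing f with
  | mem m hm =>
    obtain ⟨c, ⟨h1, h2⟩, rfl⟩ := hm
    exact h.div_x a c f hf h1 h2 hmf
  | one => rwa [one_mul] at hmf
  | mul m n hm hn ih1 ih2 =>
    refine ih2 hf ?_
    rw [← mul_assoc]
    refine ih1 (mul_mem (h.primeMonomials_le hn) hf) ?_
    rwa [mul_assoc] at hmf ⊢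

/-- An element without poles lies in `S`. -/
theorem mem_of_forall_mem_regularRing {q : Q} (hq : ∀ a, q ∈ h.regularRing a) : q ∈ S := by
  obtain ⟨m, hm, hmq⟩ := h.exists_mul_mem q
  induction hm using Submonoid.closure_induction generalizing q with
  | mem m hm =>
    obtain ⟨a, rfl⟩ := hm
    obtain ⟨n, hn, hnq⟩ := hq a
    have e : E.x a * q * E.y a = q := by rw [mul_right_comm, E.x_mul_y, one_mul]
    have := h.div_primeMonomials hn hmq (by rwa [e])
    rwa [e] at this
  | one => rwa [one_mul] at hmq
  | mul m n hm hn ih1 ih2 =>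
    refine ih2 hq (ih1 (fun a => mul_mem (h.mem_regularRing_of_mem ?_ a) (hq a)) ?_)
    · exact Submonoid.closure_le (S := S.toSubmonoid).2
        (by rintro _ ⟨c, rfl⟩; exact h.x_mem c) hn
    · rwa [← mul_assoc]

/-- Elements of the form `t - x_c` can be cancelled in memberships in `S`. -/
theorem mem_of_t_sub_mul_mem {q : Q} (c : ι) (hq : (E.t - E.x c) * q ∈ S) : q ∈ S := by
  obtain ⟨m, hm, hmq⟩ := h.exists_mul_mem q
  induction hm using Submonoid.closure_induction generalizing q with
  | mem m hm =>
    obtain ⟨a, rfl⟩ := hm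
    have e : E.x a * q * E.y a = q := by rw [mul_right_comm, E.x_mul_y, one_mul]
    have := h.div_t a c _ hmq (by rwa [e])
    rwa [e] at this
  | one => rwa [one_mul] at hmq
  | mul m n hm hn ih1 ih2 =>
    refine ih2 hq (ih1 ?_ (by rwa [← mul_assoc]))
    rw [mul_left_comm]
    exact mul_mem (Submonoid.closure_le (S := S.toSubmonoid).2
      (by rintro _ ⟨c, rfl⟩; exact h.x_mem c) hn) hq

theorem mem_of_prod_t_sub_mul_mem {q : Q} (s : Finset ι)
    (hq : (∏ c ∈ s, (E.t - E.x c)) * q ∈ S) : q ∈ S := by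
  classical
  induction s using Finset.induction_on generalizing q with
  | empty => rwa [Finset.prod_empty, one_mul] at hq
  | insert c s hc ih =>
    rw [Finset.prod_insert hc, mul_assoc] at hq
    exact ih (h.mem_of_t_sub_mul_mem c hq)

theorem demazure_mem_regularRing {a : ι} {q : Q} (hq : q ∈ h.regularRing a) :
    E.y a * (q - ofIdx P a • q) ∈ h.regularRing a := by
  obtain ⟨m, hm, hmq⟩ := hq
  have hm' := E.smul_mem_primeMonomials (ofIdx P a) hm
  rw [E.primeMonomials_neg] at hm'
  refine ⟨m * ofIdx P a • m, mul_mem hm hm', ?_⟩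
  have := h.demazure_mem a (ofIdx P a • m * (m * q))
    (mul_mem (h.primeMonomials_le hm') hmq)
  rw [smul_mul', smul_mul', smul_smul, refl_mul_self, one_smul] at this
  convert this using 1
  ring

theorem unit_mem (a : ι) : E.x (ofIdx P a • a) * E.y a ∈ S := by
  have := sub_mem (one_mem S) (h.demazure_mem a (E.x a) (h.x_mem a))
  rw [E.smul_x] at this
  have e : E.x (ofIdx P a • a) * E.y a = 1 - E.y a * (E.x a - E.x (ofIdx P a • a)) := by
    linear_combination E.x_mul_y a
  rwa [e]

theorem unit_mem' (a : ι) : E.x a * E.y (ofIdx P a • a) ∈ S := by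
  have := h.unit_mem (ofIdx P a • a)
  rwa [refl_neg, refl_idx_smul_self] at this

end IsResidual

end TwistDatum

open TwistDatum

variable (E : TwistDatum P Q) (S : Subring Q)

/-- The local conditions satisfied by the coefficients of the elements of the affine Hecke algebra:
simple poles along the `x_a`, with opposite residues at `w` and `s_a w`. -/
def TwistDatum.OppositeResidues (z : SkewMonoidAlgebra Q P.weylGroup) : Prop :=
  ∀ (a : ι) (w : P.weylGroup), E.x a * z.coeff w ∈ E.regularAt S a ∧
    z.coeff w + z.coeff (ofIdx P a * w) ∈ E.regularAt S a

variable {E S}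

namespace TwistDatum.IsResidual

variable (h : E.IsResidual S)
include h

theorem oppositeResidues_one : E.OppositeResidues S 1 := by
  classical
  have key : ∀ w : P.weylGroup, (1 : SkewMonoidAlgebra Q P.weylGroup).coeff w ∈ S := fun w => by
    rw [SkewMonoidAlgebra.coeff_one, Finsupp.single_apply]
    split_ifs
    · exact one_mem _
    · exact zero_mem _
  exact fun a w => ⟨h.mem_regularRing_of_mem (mul_mem (h.x_mem a) (key w)) a,
    h.mem_regularRing_of_mem (add_mem (key _) (key _)) a⟩

theorem oppositeResidues_sub_smul {z z' : SkewMonoidAlgebra Q P.weylGroup}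
    (hz : E.OppositeResidues S z) (hz' : E.OppositeResidues S z') {c : Q} (hc : c ∈ S) :
    E.OppositeResidues S (z - c • z') := by
  intro a w
  change _ ∈ h.regularRing a ∧ _ ∈ h.regularRing a
  have hc' := h.mem_regularRing_of_mem hc a
  constructor
  · have := (h.regularRing a).sub_mem (hz a w).1 (mul_mem hc' (hz' a w).1)
    convert this using 1
    simp only [SkewMonoidAlgebra.coeff_sub, SkewMonoidAlgebra.coeff_smul, Finsupp.sub_apply,
      Finsupp.smul_apply, smul_eq_mul]
    ring
  · have := (h.regularRing a).sub_mem (hz a w).2 (mul_mem hc' (hz' a w).2)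
    convert this using 1
    simp only [SkewMonoidAlgebra.coeff_sub, SkewMonoidAlgebra.coeff_smul, Finsupp.sub_apply,
      Finsupp.smul_apply, smul_eq_mul]
    ring

/-- Left multiplication by `T_i` preserves opposite residues. Along `x_{±i}` the two summands of
`T_i z` have poles that cancel; along any other root, `T_i` has no pole and permutes the conditions. -/
theorem oppositeResidues_T_mul {z : SkewMonoidAlgebra Q P.weylGroup}
    (hz : E.OppositeResidues S z) (i : ι) : E.OppositeResidues S (E.T i * z) := by
  intro a w
  rw [coeff_T_mul, coeff_T_mul]
  change _ ∈ h.regularRing a ∧ _ ∈ h.regularRing a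
  replace hz : ∀ (a : ι) (w : P.weylGroup), E.x a * z.coeff w ∈ h.regularRing a ∧
    z.coeff w + z.coeff (ofIdx P a * w) ∈ h.regularRing a := hz
  have ht := h.mem_regularRing_of_mem h.t_mem a
  by_cases ha : i = a ∨ i = ofIdx P a • a
  · -- the poles along `x_i` of the two summands cancel
    have hR : h.regularRing a = h.regularRing i := by
      obtain rfl | rfl := ha
      · rfl
      · rw [h.regularRing_neg]
    have hs : ofIdx P a = ofIdx P i := by
      obtain rfl | rfl := ha
      · rfl
      · rw [refl_neg]
    have hx : E.x a * E.y i ∈ S := by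
      obtain rfl | rfl := ha
      · rw [E.x_mul_y]; exact one_mem _
      · exact h.unit_mem' a
    rw [hR] at ht ⊢
    have hx := h.mem_regularRing_of_mem hx i
    set s := ofIdx P i with hs'
    set u := E.x i * z.coeff w with hu
    set u' := E.x i * z.coeff (s * w) with hu'
    have hu1 : u ∈ h.regularRing i := (hz i w).1
    have hu1' : u' ∈ h.regularRing i := (hz i (s * w)).1
    have hzu : z.coeff w = E.y i * u := by rw [hu]; linear_combination -z.coeff w * E.x_mul_y i
    have hzu' : z.coeff (s * w) = E.y i * u' := by
      rw [hu']; linear_combination -z.coeff (s * w) * E.x_mul_y i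
    have hg := (hz i w).2
    set g := z.coeff w + z.coeff (s * w) with hgd
    rw [hs, refl_mul_cancel]
    have hdg := h.demazure_mem_regularRing hg
    have hsg := h.smul_mem_regularRing s hg
    rw [hs', h.regularRing_neg, ← hs'] at hsg
    have hsu := h.smul_mem_regularRing s hu1'
    rw [hs', h.regularRing_neg, ← hs'] at hsu
    have hdu := h.demazure_mem_regularRing hu1'
    have hk := h.mem_regularRing_of_mem (h.kappa_mem i) i
    have hv := h.mem_regularRing_of_mem (h.unit_mem' i) i
    constructor
    · have e : E.x a * (E.t * E.y i * z.coeff w + (1 - E.t * E.y i) * s • z.coeff (s * w)) =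
          E.x a * E.y i * (E.t * (g - E.y i * (u' - s • u')) +
            (E.x i * E.y (s • i)) * s • u' - E.t * (E.y i + E.y (s • i)) * s • u') := by
        rw [hgd, hzu, hzu', smul_mul', E.smul_y]
        linear_combination (- E.x a * E.y (s • i) * s • u') * E.x_mul_y i
      rw [e]
      exact mul_mem hx (sub_mem (add_mem (mul_mem ht (sub_mem hg hdu)) (mul_mem hv hsu))
        (mul_mem (mul_mem ht hk) hsu))
    · have e : E.t * E.y i * z.coeff w + (1 - E.t * E.y i) * s • z.coeff (s * w) +
          (E.t * E.y i * z.coeff (s * w) + (1 - E.t * E.y i) * s • z.coeff w) =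
          E.t * (E.y i * (g - s • g)) + s • g := by
        rw [hgd, smul_add]
        ring
      rw [e]
      exact add_mem (mul_mem ht hdg) hsg
  · -- here `1 / x_i` has no pole along `x_a`
    obtain ⟨h1, h2⟩ := not_or.1 ha
    have hy := h.y_mem_regularRing h1 h2
    set s := ofIdx P i with hs'
    have hback : ∀ {q}, q ∈ h.regularRing (s • a) → s • q ∈ h.regularRing a := fun hq => by
      simpa only [hs', refl_idx_smul_self] using h.smul_mem_regularRing s hq
    have h1y := sub_mem (one_mem (h.regularRing a)) (mul_mem ht hy)
    constructor
    · have := hback (hz (s • a) (s * w)).1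
      rw [smul_mul', E.smul_x, hs', refl_idx_smul_self] at this
      have := add_mem (mul_mem (mul_mem ht hy) (hz a w).1) (mul_mem h1y this)
      convert this using 1
      ring
    · have := hback (hz (s • a) (s * w)).2
      rw [refl_smul] at this
      rw [show s * ofIdx P a * s⁻¹ * (s * w) = s * (ofIdx P a * w) by group, smul_add] at this
      have := add_mem (mul_mem (mul_mem ht hy) (hz a w).2) (mul_mem h1y this)
      convert this using 1
      ring

end TwistDatum.IsResidual

section Reduced

variable [Finite ι] [P.IsReduced] (b : P.Base)

/-- Divisibility by the leading coefficients is also stable under left multiplication by `T_i`: if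
`s_i w` is longer than `w`, the image under `s_i` of its leading coefficient is a multiple of that
of `w`; if it is shorter, the factor `1 - t / x_i` of `T_i` supplies the missing one. -/
theorem TwistDatum.lead_dvd_coeff_T_mul {z : SkewMonoidAlgebra Q P.weylGroup}
    (hz : ∀ w, E.lead b w ∣ z.coeff w) (i : b.support) (w : P.weylGroup) :
    E.lead b w ∣ (E.T i * z).coeff w := by
  rw [coeff_T_mul]
  refine dvd_add ((hz w).mul_left _) ?_
  by_cases hi : b.IsPos (w⁻¹ • (i : ι))
  · obtain ⟨q, hq⟩ := hz (ofIdx P i * w)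
    rw [hq, E.lead_simple_mul b hi, smul_mul', smul_mul', smul_smul, refl_mul_self, one_smul]
    exact ⟨(1 - E.t * E.y i) * ofIdx P i • (1 - E.t * E.y i) * ofIdx P i • q, by ring⟩
  · obtain ⟨q, hq⟩ := hz (ofIdx P i * w)
    have h2 : b.IsPos ((ofIdx P i * w)⁻¹ • (i : ι)) := by
      rwa [mul_inv_rev, mul_smul, refl_inv, isPos_smul_neg]
    have := E.lead_simple_mul b h2
    rw [refl_mul_cancel] at this
    rw [hq, this, smul_mul']
    exact ⟨ofIdx P i • q, by ring⟩

namespace TwistDatum.IsResidual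

variable (h : E.IsResidual S)
include h

/-- The two properties that cut out the span of the words, for the words themselves. -/
theorem word_oppositeResidues (J : List b.support) :
    E.OppositeResidues S (E.word b J) ∧ ∀ w, E.lead b w ∣ (E.word b J).coeff w := by
  induction J with
  | nil =>
    refine ⟨h.oppositeResidues_one, fun w => ?_⟩
    by_cases hw : w = 1
    · rw [hw, lead_one]; exact one_dvd _
    · have : (E.word b []).coeff w = 0 := by
        simp [word, Finsupp.single_eq_of_ne hw]
      rw [this]
      exact dvd_zero _
  | cons i J ih =>
    rw [word_cons]
    exact ⟨h.oppositeResidues_T_mul ih.1 i, E.lead_dvd_coeff_T_mul b ih.2 i⟩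

/-- The coefficient of `δ_w`, `w` of maximal length, is the product of an element of `S` with the
leading coefficient of `T_{I_w}`. -/
theorem exists_eq_lead_mul {z : SkewMonoidAlgebra Q P.weylGroup} (hz : E.OppositeResidues S z)
    (hz' : ∀ w, E.lead b w ∣ z.coeff w) {w : P.weylGroup}
    (hw : ∀ v, len b w < len b v → z.coeff v = 0) : ∃ c ∈ S, z.coeff w = E.lead b w * c := by
  obtain ⟨q, hq⟩ := hz' w
  -- multiplying with `∏ x_a` over the inversions `a` of `w` removes all poles
  have hp : (∏ a ∈ inversions b w, E.x a) * z.coeff w ∈ S := by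
    classical
    refine h.mem_of_forall_mem_regularRing fun a => ?_
    have hprod : ∀ s : Finset ι, ∏ c ∈ s, E.x c ∈ h.regularRing a := fun s =>
      h.mem_regularRing_of_mem (prod_mem fun c _ => h.x_mem c) a
    have key : ∀ c, b.IsPos c → h.regularRing c = h.regularRing a →
        (∏ a ∈ inversions b w, E.x a) * z.coeff w ∈ h.regularRing a := by
      intro c hc hca
      by_cases hcw : b.IsPos (w⁻¹ • c)
      · have h1 : z.coeff w + z.coeff (ofIdx P c * w) ∈ h.regularRing c := (hz c w).2
        rw [hw _ (len_lt_refl_mul b hc hcw), add_zero, hca] at h1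
        exact mul_mem (hprod _) h1
      · have h1 : E.x c * z.coeff w ∈ h.regularRing c := (hz c w).1
        rw [← Finset.mul_prod_erase _ _ ((mem_inversions b).2 ⟨hc, hcw⟩), mul_right_comm, mul_comm]
        exact mul_mem (hprod _) (hca ▸ h1)
    by_cases ha : b.IsPos a
    · exact key a ha rfl
    · exact key (ofIdx P a • a) ((isPos_refl_self b a).2 ha) (h.regularRing_neg a)
  have e : (∏ a ∈ inversions b w, (E.t - E.x a)) * q =
      (-1) ^ (inversions b w).card * ((∏ a ∈ inversions b w, E.x a) * z.coeff w) := by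
    rw [hq, lead, ← mul_assoc, ← mul_assoc, ← Finset.prod_const, mul_assoc (Finset.prod _ _),
      ← Finset.prod_mul_distrib, ← Finset.prod_mul_distrib]
    congr 1
    refine Finset.prod_congr rfl fun a _ => ?_
    linear_combination -E.t * E.x_mul_y a
  exact ⟨q, h.mem_of_prod_t_sub_mul_mem _ (by
    rw [e]; exact mul_mem (pow_mem (neg_mem (one_mem S)) _) hp), hq⟩

/-- The words along arbitrary sequences lie in the `S`-span of those along chosen reduced
sequences of the elements of `W`. -/
theorem word_mem_span [Fintype P.weylGroup] {I : P.weylGroup → List b.support}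
    (hI : ∀ w, IsReducedWord b (I w) w) (J : List b.support) :
    ∃ c : P.weylGroup → Q, (∀ w, c w ∈ S) ∧ E.word b J = ∑ w, c w • E.word b (I w) := by
  classical
  -- all elements with opposite residues and divisible coefficients lie in the span, by induction on
  -- a bound for the lengths of the elements of the support
  suffices H : ∀ (n : ℕ) (z : SkewMonoidAlgebra Q P.weylGroup), E.OppositeResidues S z →
      (∀ w, E.lead b w ∣ z.coeff w) → (∀ w, n ≤ len b w → z.coeff w = 0) →
      ∃ c : P.weylGroup → Q, (∀ w, c w ∈ S) ∧ z = ∑ w, c w • E.word b (I w) from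
    H (J.length + 1) _ (h.word_oppositeResidues b J).1 (h.word_oppositeResidues b J).2
      fun w hw => E.coeff_of_length_lt b hw
  intro n
  induction n with
  | zero =>
    intro z _ _ hz
    refine ⟨0, fun _ => zero_mem _, ?_⟩
    simp only [Pi.zero_apply, zero_smul, Finset.sum_const_zero]
    exact SkewMonoidAlgebra.ext fun w => by rw [hz w (Nat.zero_le _)]; rfl
  | succ n ih =>
    intro z h1 h2 hz
    have hex : ∀ w, ∃ c ∈ S, (len b w = n → z.coeff w = E.lead b w * c) ∧
        (len b w ≠ n → c = 0) := fun w => by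
      by_cases hw : len b w = n
      · obtain ⟨c, hc, hzc⟩ := h.exists_eq_lead_mul b h1 h2 (w := w) fun v hv => hz v (by lia)
        exact ⟨c, hc, fun _ => hzc, fun hn => absurd hw hn⟩
      · exact ⟨0, zero_mem _, fun hn => absurd hn hw, fun _ => rfl⟩
    choose c hc hcz hc0 using hex
    -- subtract the top layer
    have hsum : ∀ s : Finset P.weylGroup,
        E.OppositeResidues S (z - ∑ w ∈ s, c w • E.word b (I w)) ∧
        ∀ w, E.lead b w ∣ (z - ∑ w ∈ s, c w • E.word b (I w)).coeff w := fun s => by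
      induction s using Finset.induction_on with
      | empty => rw [Finset.sum_empty, sub_zero]; exact ⟨h1, h2⟩
      | insert w s hw ih =>
        rw [Finset.sum_insert hw, add_comm, ← sub_sub]
        refine ⟨h.oppositeResidues_sub_smul ih.1 (h.word_oppositeResidues b _).1 (hc w),
          fun v => ?_⟩
        rw [SkewMonoidAlgebra.coeff_sub, Finsupp.sub_apply, SkewMonoidAlgebra.coeff_smul,
          Finsupp.smul_apply]
        exact dvd_sub (ih.2 v) (((h.word_oppositeResidues b _).2 v).mul_left _)
    obtain ⟨d, hd, hdz⟩ := ih _ (hsum Finset.univ).1 (hsum Finset.univ).2 (by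
      intro v hv
      have hcoeff : (∑ w, c w • E.word b (I w)).coeff v =
          ∑ w, c w * (E.word b (I w)).coeff v := by
        have := map_sum (SkewMonoidAlgebra.coeffAddEquiv (k := Q) (G := P.weylGroup))
          (fun w => c w • E.word b (I w)) Finset.univ
        rw [show (∑ w, c w • E.word b (I w)).coeff = ∑ w, (c w • E.word b (I w)).coeff from this,
          Finsupp.finsetSum_apply]
        rfl
      rw [SkewMonoidAlgebra.coeff_sub, Finsupp.sub_apply, hcoeff, Finset.sum_eq_single v]
      · rw [E.coeff_of_reduced b (hI v)]
        rcases hv.eq_or_lt with hv | hv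
        · rw [hcz v hv.symm]; ring
        · rw [hc0 v (by lia), hz v hv]; ring
      · intro w _ hwv
        by_cases hw : len b w = n
        · rw [E.coeff_eq_zero_of_reduced b (hI w) (Ne.symm hwv) (hw.trans_le hv), mul_zero]
        · rw [hc0 w hw, zero_mul]
      · exact fun hv => absurd (Finset.mem_univ v) hv)
    refine ⟨fun w => c w + d w, fun w => add_mem (hc w) (hd w), ?_⟩
    simp only [add_smul, Finset.sum_add_distrib]
    rw [← hdz]
    abel

end TwistDatum.IsResidual

end Reduced

end Residues

/-! ### Power series at topologically nilpotent elements -/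

section PowerSeries

variable {R : Type*} [CommRing R] {τ : Type*}

/-- The ideal of `R⟦X_τ⟧` generated by the variables. -/
noncomputable def varsIdeal (τ R : Type*) [CommRing R] : Ideal (MvPowerSeries τ R) :=
  Ideal.span (Set.range MvPowerSeries.X)

theorem X_mem_varsIdeal (i : τ) : (MvPowerSeries.X i : MvPowerSeries τ R) ∈ varsIdeal τ R :=
  Ideal.subset_span ⟨i, rfl⟩

theorem map_varsIdeal_le {B : Type*} [CommRing B] {N : Ideal B} {φ : MvPowerSeries τ R →+* B}
    (h : ∀ i, φ (MvPowerSeries.X i) ∈ N) : (varsIdeal τ R).map φ ≤ N := by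
  rw [varsIdeal, Ideal.map_span, Ideal.span_le]
  rintro _ ⟨_, ⟨i, rfl⟩, rfl⟩
  exact h i

theorem map_mem_pow_of_mem {B : Type*} [CommRing B] {N : Ideal B} {φ : MvPowerSeries τ R →+* B}
    (h : ∀ i, φ (MvPowerSeries.X i) ∈ N) {n : ℕ} {f : MvPowerSeries τ R}
    (hf : f ∈ varsIdeal τ R ^ n) : φ f ∈ N ^ n := by
  have := Ideal.mem_map_of_mem φ hf
  rw [Ideal.map_pow] at this
  exact Ideal.pow_right_mono (map_varsIdeal_le h) n this

variable [Finite τ]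

/-- In finitely many variables, vanishing of the coefficients of degree less than `n` implies
membership in the `n`-th power of the ideal generated by the variables; this comes from the
description of power series as an adic completion. -/
theorem mem_varsIdeal_pow {n : ℕ} {f : MvPowerSeries τ R}
    (h : ∀ m : τ →₀ ℕ, m.degree < n → MvPowerSeries.coeff m f = 0) : f ∈ varsIdeal τ R ^ n := by
  set e := (MvPowerSeries.toAdicCompletionAlgEquiv τ R).toRingEquiv with he
  have hmap : (varsIdeal τ R).map e =
      (MvPolynomial.idealOfVars τ R).map (algebraMap _ (PowerSeriesRing R τ)) := by
    change _ = (Ideal.span (Set.range MvPolynomial.X)).map (algebraMap _ (PowerSeriesRing R τ))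
    rw [varsIdeal, Ideal.map_span, Ideal.map_span, ← Set.range_comp, ← Set.range_comp]
    congr 2
    ext i : 1
    change MvPowerSeries.toAdicCompletion τ R _ = _
    rw [← MvPolynomial.coe_X]
    exact AlgHom.commutes (MvPowerSeries.toAdicCompletion τ R) (MvPolynomial.X i)
  have hfg : (MvPolynomial.idealOfVars τ R).FG := by
    exact Submodule.fg_span (Set.finite_range _)
  have hker : e f ∈ (MvPolynomial.idealOfVars τ R ^ n • ⊤ :
      Submodule (MvPolynomial τ R) (PowerSeriesRing R τ)) := by
    rw [AdicCompletion.pow_smul_top_eq_ker_eval hfg, LinearMap.mem_ker]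
    have : MvPowerSeries.truncTotal n f = 0 := by
      ext m
      by_cases hm : m.degree < n
      · rw [MvPowerSeries.coeff_truncTotal _ hm, h m hm, MvPolynomial.coeff_zero]
      · rw [MvPowerSeries.coeff_truncTotal_eq_zero _ (not_lt.1 hm), MvPolynomial.coeff_zero]
    change (MvPowerSeries.toAdicCompletion τ R f).val n = 0
    rw [MvPowerSeries.toAdicCompletion_apply_eq_mk_truncTotal, this]
    rfl
  have hmem : e f ∈ (varsIdeal τ R ^ n).map e := by
    rw [Ideal.map_pow, hmap, ← Ideal.map_pow]
    rw [Ideal.smul_top_eq_map] at hker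
    exact hker
  rw [← Ideal.comap_symm, Ideal.mem_comap] at hmem
  simpa using hmem

theorem sub_truncTotal_mem (n : ℕ) (f : MvPowerSeries τ R) :
    f - (MvPowerSeries.truncTotal n f : MvPolynomial τ R) ∈ varsIdeal τ R ^ n :=
  mem_varsIdeal_pow fun m hm => by
    rw [map_sub, MvPolynomial.coeff_coe, MvPowerSeries.coeff_truncTotal _ hm, sub_self]

instance : IsAdicComplete (varsIdeal τ R) (MvPowerSeries τ R) :=
  inferInstanceAs (IsAdicComplete (.span (.range MvPowerSeries.X) : Ideal (MvPowerSeries τ R)) _)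

theorem mem_varsIdeal_of_constantCoeff {f : MvPowerSeries τ R}
    (h : MvPowerSeries.constantCoeff f = 0) : f ∈ varsIdeal τ R := by
  rw [← pow_one (varsIdeal τ R)]
  refine mem_varsIdeal_pow fun m hm => ?_
  have : m = 0 := (Finsupp.degree_eq_zero_iff m).1 (by lia)
  rw [this, MvPowerSeries.coeff_zero_eq_constantCoeff_apply, h]

theorem eq_zero_of_forall_mem_pow {B : Type*} [CommRing B] (N : Ideal B) [IsHausdorff N B] {z : B}
    (h : ∀ n, z ∈ N ^ n) : z = 0 :=
  IsHausdorff.haus ‹_› z fun n => by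
    rw [SModEq.zero, smul_eq_mul, Ideal.mul_top]; exact h n

theorem isHausdorff_of_pow_eq_bot {B : Type*} [CommRing B] {N : Ideal B} {n : ℕ}
    (h : N ^ n = ⊥) : IsHausdorff N B := ⟨fun z hz => by
  have := hz n
  rwa [SModEq.zero, smul_eq_mul, Ideal.mul_top, h, Ideal.mem_bot] at this⟩

/-- A ring homomorphism from a power series ring that maps the variables to topologically
nilpotent elements is determined by its values on constants and variables. -/
theorem mvPowerSeries_ringHom_ext {B : Type*} [CommRing B] (N : Ideal B) [IsHausdorff N B]
    {φ ψ : MvPowerSeries τ R →+* B}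
    (hC : ∀ r, φ (MvPowerSeries.C r) = ψ (MvPowerSeries.C r))
    (hX : ∀ i, φ (MvPowerSeries.X i) = ψ (MvPowerSeries.X i))
    (hN : ∀ i, φ (MvPowerSeries.X i) ∈ N) : φ = ψ := by
  ext f
  rw [← sub_eq_zero]
  refine eq_zero_of_forall_mem_pow N fun n => ?_
  have h1 := map_mem_pow_of_mem hN (sub_truncTotal_mem n f)
  have h2 := map_mem_pow_of_mem (φ := ψ) (fun i => hX i ▸ hN i) (sub_truncTotal_mem n f)
  have h3 : φ.comp MvPolynomial.coeToMvPowerSeries.ringHom =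
      ψ.comp MvPolynomial.coeToMvPowerSeries.ringHom :=
    MvPolynomial.ringHom_ext (fun r => by simpa using hC r) (fun i => by simpa using hX i)
  have h4 := congrArg (fun g : MvPolynomial τ R →+* B => g (MvPowerSeries.truncTotal n f)) h3
  have h4' : φ (MvPowerSeries.truncTotal n f : MvPolynomial τ R) =
      ψ (MvPowerSeries.truncTotal n f : MvPolynomial τ R) := h4
  have := sub_mem h1 h2
  rwa [map_sub, map_sub, h4', sub_sub_sub_cancel_right] at this

theorem mvPowerSeries_algHom_ext {B : Type*} [CommRing B] [Algebra R B] (N : Ideal B)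
    [IsHausdorff N B] {φ ψ : MvPowerSeries τ R →ₐ[R] B}
    (hX : ∀ i, φ (MvPowerSeries.X i) = ψ (MvPowerSeries.X i))
    (hN : ∀ i, φ (MvPowerSeries.X i) ∈ N) : φ = ψ := by
  have : (φ : MvPowerSeries τ R →+* B) = ψ :=
    mvPowerSeries_ringHom_ext N (fun r => (φ.commutes r).trans (ψ.commutes r).symm) hX hN
  exact AlgHom.coe_ringHom_injective this

section NilEval

variable {B : Type*} [CommRing B] [Algebra R B] {N : Ideal B} {n : ℕ} (hN : N ^ n = ⊥)

theorem idealOfVars_pow_le_ker_aeval {Λ : Type*} {u : Λ → B} (hu : ∀ i, u i ∈ N)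
    (hN : N ^ n = ⊥) {p : MvPolynomial Λ R} (hp : p ∈ MvPolynomial.idealOfVars Λ R ^ n) :
    MvPolynomial.aeval u p = 0 := by
  have h1 : (MvPolynomial.idealOfVars Λ R).map (MvPolynomial.aeval (R := R) u) ≤ N := by
    rw [MvPolynomial.idealOfVars, Ideal.map_span, Ideal.span_le]
    rintro _ ⟨_, ⟨i, rfl⟩, rfl⟩
    simpa using hu i
  have h2 := Ideal.mem_map_of_mem (MvPolynomial.aeval (R := R) u) hp
  rw [Ideal.map_pow] at h2
  have := Ideal.pow_right_mono h1 n h2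
  rwa [hN] at this

/-- The value of a power series at elements of a nilpotent ideal. -/
noncomputable def nilEval (u : τ → B) (hu : ∀ i, u i ∈ N) : MvPowerSeries τ R →ₐ[R] B :=
  (Ideal.Quotient.liftₐ (MvPolynomial.idealOfVars τ R ^ n) (MvPolynomial.aeval u)
    fun _ hp => idealOfVars_pow_le_ker_aeval hu hN hp).comp
  ((MvPowerSeries.truncTotalAlgHom τ R n).restrictScalars R)

theorem nilEval_X {u : τ → B} (hu : ∀ i, u i ∈ N) (i : τ) :
    nilEval (R := R) hN u hu (MvPowerSeries.X i) = u i := by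
  have h : (MvPowerSeries.truncTotalAlgHom τ R n) (MvPowerSeries.X i) =
      Ideal.Quotient.mk _ (MvPolynomial.X i) := by
    rw [← MvPolynomial.coe_X]
    exact AlgHom.commutes (MvPowerSeries.truncTotalAlgHom τ R n) (MvPolynomial.X i)
  rw [nilEval, AlgHom.comp_apply, AlgHom.restrictScalars_apply, h]
  exact MvPolynomial.aeval_X u i

theorem eq_nilEval {u : τ → B} (hu : ∀ i, u i ∈ N) {φ : MvPowerSeries τ R →ₐ[R] B}
    (h : ∀ i, φ (MvPowerSeries.X i) = u i) : φ = nilEval hN u hu := by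
  have := isHausdorff_of_pow_eq_bot hN
  exact mvPowerSeries_algHom_ext N (fun i => by rw [h, nilEval_X]) fun i => by rw [h]; exact hu i

theorem nilEval_mem {u : τ → B} (hu : ∀ i, u i ∈ N) {f : MvPowerSeries τ R}
    (hf : MvPowerSeries.constantCoeff f = 0) : nilEval hN u hu f ∈ N := by
  have h := mem_varsIdeal_of_constantCoeff hf
  rw [← pow_one (varsIdeal τ R)] at h
  have := map_mem_pow_of_mem (N := N)
    (φ := ((nilEval hN u hu : MvPowerSeries τ R →ₐ[R] B) : MvPowerSeries τ R →+* B))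
    (fun i => by
      have := nilEval_X (R := R) hN hu i
      rw [RingHom.coe_coe, this]
      exact hu i) h
  rwa [pow_one] at this

theorem nilEval_subst {σ : Type*} [Finite σ] {u : τ → B} (hu : ∀ i, u i ∈ N)
    {a : σ → MvPowerSeries τ R} (ha : ∀ i, MvPowerSeries.constantCoeff (a i) = 0)
    (f : MvPowerSeries σ R) : nilEval hN u hu (f.subst a) =
      nilEval hN (fun i => nilEval hN u hu (a i)) (fun i => nilEval_mem hN hu (ha i)) f := by
  have hs := MvPowerSeries.hasSubst_of_constantCoeff_zero ha
  have := eq_nilEval (R := R) hN (u := fun i => nilEval hN u hu (a i))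
    (fun i => nilEval_mem hN hu (ha i))
    (φ := (nilEval hN u hu).comp (MvPowerSeries.substAlgHom hs)) fun i => by
      rw [AlgHom.comp_apply, MvPowerSeries.substAlgHom_X]
  rw [← this, AlgHom.comp_apply, MvPowerSeries.substAlgHom_apply]

theorem nilEval_congr {u v : τ → B} (hu : ∀ i, u i ∈ N) (huv : u = v)
    (f : MvPowerSeries τ R) : nilEval hN u hu f = nilEval hN v (huv ▸ hu) f := by
  subst huv; rfl

theorem map_nilEval {B' : Type*} [CommRing B'] [Algebra R B'] {N' : Ideal B'} {n' : ℕ}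
    (hN' : N' ^ n' = ⊥) {u : τ → B} (hu : ∀ i, u i ∈ N) (g : B →ₐ[R] B')
    (hg : ∀ i, g (u i) ∈ N') (f : MvPowerSeries τ R) :
    g (nilEval hN u hu f) = nilEval hN' (fun i => g (u i)) hg f := by
  rw [← eq_nilEval hN' hg (φ := g.comp (nilEval hN u hu)) fun i => by
    rw [AlgHom.comp_apply, nilEval_X], AlgHom.comp_apply]

end NilEval

end PowerSeries

section Divisibility

variable {R : Type*} [CommRing R]

theorem X_dvd_of_killCompl_eq_zero {σ τ : Type*} (e : σ ↪ τ) (s : τ)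
    (hs : ∀ k, k ∈ Set.range e ↔ k ≠ s) {f : MvPowerSeries τ R}
    (hf : MvPowerSeries.killCompl e f = 0) : MvPowerSeries.X s ∣ f := by
  classical
  rw [MvPowerSeries.X_dvd_iff]
  intro m hm
  have hsupp : (m.support : Set τ) ⊆ Set.range e := fun k hk => (hs k).2 <| by
    rintro rfl
    exact Finsupp.mem_support_iff.1 hk hm
  obtain ⟨x, rfl⟩ : ∃ x, Finsupp.embDomain e x = m := by
    refine ⟨m.comapDomain e e.injective.injOn, ?_⟩
    rw [Finsupp.embDomain_eq_mapDomain, Finsupp.mapDomain_comapDomain _ e.injective _ hsupp]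
  rw [← MvPowerSeries.coeff_killCompl, hf, map_zero]

theorem X_mul_cancel {τ : Type*} {s : τ} {f : MvPowerSeries τ R}
    (hf : MvPowerSeries.X s * f = 0) : f = 0 := by
  ext m
  have := congrArg (MvPowerSeries.coeff (Finsupp.single s 1 + m)) hf
  rw [MvPowerSeries.X, MvPowerSeries.coeff_add_monomial_mul, one_mul] at this
  rw [this, map_zero, map_zero]

end Divisibility

/-! ### Points of a formal group law in a nilpotent ideal -/

section Points

variable {R : Type*} [CommRing R] (F : FormalGroup R)

theorem constantCoeff_vec {τ : Type*} {f g : MvPowerSeries τ R}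
    (hf : MvPowerSeries.constantCoeff f = 0) (hg : MvPowerSeries.constantCoeff g = 0) (i : Fin 2) :
    MvPowerSeries.constantCoeff (![f, g] i) = 0 := by
  fin_cases i
  · exact hf
  · exact hg

theorem hasSubst_of_constantCoeff {τ : Type*} {f : MvPowerSeries τ R}
    (hf : MvPowerSeries.constantCoeff f = 0) : PowerSeries.HasSubst f := by
  rw [PowerSeries.HasSubst, hf]
  exact IsNilpotent.zero

/-- A formal group law has the form `X + Y + X Y G(X, Y)`. -/
theorem exists_eq_add_mul : ∃ G : MvPowerSeries (Fin 2) R,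
    F.toPowerSeries = .X 0 + .X 1 + .X 0 * .X 1 * G := by
  let e : Fin 2 → Unit ↪ Fin 2 := fun i => ⟨fun _ => i, fun _ _ _ => rfl⟩
  have hr : ∀ i j : Fin 2, i ≠ j → ∀ k, k ∈ Set.range (e i) ↔ k ≠ j := fun i j hij k => by
    rw [Set.mem_range]
    constructor
    · rintro ⟨_, rfl⟩; exact hij
    · intro hk; exact ⟨(), by change i = k; lia⟩
  have hX : ∀ i, MvPowerSeries.killCompl (R := R) (e i) (.X i) = .X () :=
    fun i => MvPowerSeries.killCompl_X (e := e i) ()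
  have hX' : ∀ i j : Fin 2, i ≠ j → MvPowerSeries.killCompl (R := R) (e i) (.X j) = 0 :=
    fun i j hij => MvPowerSeries.killCompl_X_eq_zero (e := e i) fun h => (hr i j hij j).1 h rfl
  have hX0 : MvPowerSeries.constantCoeff (MvPowerSeries.X () : MvPowerSeries Unit R) = 0 :=
    MvPowerSeries.constantCoeff_X ()
  have hF0 : MvPowerSeries.killCompl (e 0) F.toPowerSeries = .X () := by
    have hs := MvPowerSeries.hasSubst_of_constantCoeff_zero
      (constantCoeff_vec hX0 (map_zero (MvPowerSeries.constantCoeff (σ := Unit) (R := R))))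
    have : MvPowerSeries.killCompl (e 0) = MvPowerSeries.substAlgHom hs :=
      mvPowerSeries_algHom_ext (varsIdeal Unit R) (fun i => by
        rw [MvPowerSeries.substAlgHom_X]
        fin_cases i
        · exact hX 0
        · exact hX' 0 1 (by simp)) fun i => by
        fin_cases i
        · exact (hX 0).symm ▸ X_mem_varsIdeal ()
        · exact (hX' 0 1 (by simp)).symm ▸ zero_mem _
    rw [this, MvPowerSeries.substAlgHom_apply, F.add_zero (hasSubst_of_constantCoeff hX0)]
  have hF1 : MvPowerSeries.killCompl (e 1) F.toPowerSeries = .X () := by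
    have hs := MvPowerSeries.hasSubst_of_constantCoeff_zero
      (constantCoeff_vec (map_zero (MvPowerSeries.constantCoeff (σ := Unit) (R := R))) hX0)
    have : MvPowerSeries.killCompl (e 1) = MvPowerSeries.substAlgHom hs :=
      mvPowerSeries_algHom_ext (varsIdeal Unit R) (fun i => by
        rw [MvPowerSeries.substAlgHom_X]
        fin_cases i
        · exact hX' 1 0 (by simp)
        · exact hX 1) fun i => by
        fin_cases i
        · exact (hX' 1 0 (by simp)).symm ▸ zero_mem _
        · exact (hX 1).symm ▸ X_mem_varsIdeal ()
    rw [this, MvPowerSeries.substAlgHom_apply, F.zero_add (hasSubst_of_constantCoeff hX0)]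
  obtain ⟨H, hH⟩ := X_dvd_of_killCompl_eq_zero (e 1) 0 (hr 1 0 (by simp))
    (f := F.toPowerSeries - .X 0 - .X 1) (by
      rw [map_sub, map_sub, hF1, hX, hX' 1 0 (by simp), sub_zero, sub_self])
  have hH0 : MvPowerSeries.killCompl (e 0) H = 0 := by
    refine X_mul_cancel (s := ()) ?_
    rw [← hX 0, ← map_mul, ← hH, map_sub, map_sub, hF0, hX, hX' 0 1 (by simp), sub_self, sub_zero]
  obtain ⟨G, rfl⟩ := X_dvd_of_killCompl_eq_zero (e 0) 1 (hr 0 1 (by simp)) hH0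
  exact ⟨G, by linear_combination hH⟩

variable {B : Type*} [CommRing B] [Algebra R B] {N : Ideal B} {n : ℕ} (hN : N ^ n = ⊥)

/-- The points of a formal group law in a nilpotent ideal `N`, which form a group with respect to
`(x, y) ↦ F(x, y)`. -/
@[ext]
structure NilPoint (_F : FormalGroup R) (_hN : N ^ n = ⊥) where
  /-- The underlying element of the ring. -/
  val : B
  mem : val ∈ N

namespace NilPoint

theorem vec_mem {x y : B} (hx : x ∈ N) (hy : y ∈ N) (i : Fin 2) : ![x, y] i ∈ N := by
  fin_cases i
  · exact hx
  · exact hy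

variable {F hN}

/-- Points are added by the formal group law. -/
noncomputable instance : Add (NilPoint F hN) where
  add x y := ⟨nilEval hN ![x.1, y.1] (vec_mem x.2 y.2) F.toPowerSeries,
    nilEval_mem hN _ F.zero_constantCoeff⟩

theorem add_val (x y : NilPoint F hN) :
    (x + y).1 = nilEval hN ![x.1, y.1] (vec_mem x.2 y.2) F.toPowerSeries := rfl

instance : Zero (NilPoint F hN) where
  zero := ⟨0, zero_mem _⟩

theorem nilEval_subst_vec {τ : Type*} [Finite τ] {u : τ → B} (hu : ∀ i, u i ∈ N)
    {f g : MvPowerSeries τ R} (hf : MvPowerSeries.constantCoeff f = 0)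
    (hg : MvPowerSeries.constantCoeff g = 0) (f' : MvPowerSeries (Fin 2) R) :
    nilEval hN u hu (f'.subst ![f, g]) = nilEval hN ![nilEval hN u hu f, nilEval hN u hu g]
      (vec_mem (nilEval_mem hN hu hf) (nilEval_mem hN hu hg)) f' := by
  rw [nilEval_subst hN hu (constantCoeff_vec hf hg)]
  refine nilEval_congr hN _ ?_ _
  ext i
  fin_cases i <;> rfl

theorem constantCoeff_subst_vec {τ : Type*} {f g : MvPowerSeries τ R}
    (hf : MvPowerSeries.constantCoeff f = 0) (hg : MvPowerSeries.constantCoeff g = 0) :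
    MvPowerSeries.constantCoeff (F.toPowerSeries.subst ![f, g]) = 0 :=
  MvPowerSeries.constantCoeff_subst_eq_zero
    (MvPowerSeries.hasSubst_of_constantCoeff_zero (constantCoeff_vec hf hg))
    (constantCoeff_vec hf hg) F.zero_constantCoeff

theorem add_zero' (x : NilPoint F hN) : x + 0 = x := by
  refine NilPoint.ext ?_
  have hX : MvPowerSeries.constantCoeff (MvPowerSeries.X () : MvPowerSeries Unit R) = 0 :=
    MvPowerSeries.constantCoeff_X ()
  have h := congrArg (nilEval hN (fun _ : Unit => x.1) fun _ => x.2)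
    (F.add_zero (hasSubst_of_constantCoeff hX))
  rw [nilEval_subst_vec _ hX (map_zero _)] at h
  simp only [nilEval_X, map_zero] at h
  exact h

theorem add_assoc' (x y z : NilPoint F hN) : x + y + z = x + (y + z) := by
  refine NilPoint.ext ?_
  have hX : ∀ i, MvPowerSeries.constantCoeff (MvPowerSeries.X i : MvPowerSeries (Fin 3) R) = 0 :=
    fun i => MvPowerSeries.constantCoeff_X i
  have hu : ∀ i, ![x.1, y.1, z.1] i ∈ N := fun i => by
    fin_cases i
    exacts [x.2, y.2, z.2]
  have h := congrArg (nilEval hN ![x.1, y.1, z.1] hu) F.assoc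
  rw [nilEval_subst_vec _ (constantCoeff_subst_vec (hX 0) (hX 1)) (hX 2),
    nilEval_subst_vec _ (hX 0) (constantCoeff_subst_vec (hX 1) (hX 2))] at h
  simp only [nilEval_subst_vec _ (hX 0) (hX 1), nilEval_subst_vec _ (hX 1) (hX 2),
    nilEval_X] at h
  exact h

theorem add_comm' [F.IsComm] (x y : NilPoint F hN) : x + y = y + x := by
  refine NilPoint.ext ?_
  have hX : ∀ i, MvPowerSeries.constantCoeff (MvPowerSeries.X i : MvPowerSeries (Fin 2) R) = 0 :=
    fun i => MvPowerSeries.constantCoeff_X i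
  have h := congrArg (nilEval hN ![x.1, y.1] (vec_mem x.2 y.2)) (FormalGroup.IsComm.comm (F := F))
  rw [nilEval_subst_vec _ (hX 1) (hX 0)] at h
  simp only [nilEval_X] at h
  exact h

/-- Inverses exist by successive approximation: if `r = F(x, y)` is small, then `F(x, y - r)` is
smaller, since `F(x, y) = x + y + x y G(x, y)`. -/
theorem exists_add_eq_zero (x : NilPoint F hN) : ∃ y, x + y = 0 := by
  obtain ⟨G, hG⟩ := exists_eq_add_mul F
  -- an inverse modulo `N ^ k` can be improved to one modulo `N ^ (k + 1)`
  have key : ∀ k, ∃ y : NilPoint F hN, (x + y).1 ∈ N ^ (k + 1) := fun k => by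
    induction k with
    | zero => exact ⟨0, by rw [zero_add, pow_one]; exact (x + 0).2⟩
    | succ k ih =>
      obtain ⟨y, hy⟩ := ih
      set r := (x + y).1 with hr
      refine ⟨⟨y.1 - r, sub_mem y.2 (x + y).2⟩, ?_⟩
      change nilEval hN ![x.1, y.1 - r] (vec_mem x.2 (sub_mem y.2 (x + y).2)) F.toPowerSeries ∈ _
      rw [add_val, hG] at hr
      rw [hG]
      simp only [map_add, map_mul, nilEval_X] at hr ⊢
      set g := nilEval hN ![x.1, y.1] (vec_mem x.2 y.2) G with hg
      have hg' : nilEval hN ![x.1, y.1 - r] (vec_mem x.2 (sub_mem y.2 (x + y).2)) G - g ∈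
          N ^ (k + 1) := by
        -- modulo `N ^ (k + 1)` the two points are equal
        have hq : (N.map (Ideal.Quotient.mkₐ R (N ^ (k + 1)))) ^ (k + 1) = ⊥ := by
          rw [← Ideal.map_pow]
          exact Ideal.map_quotient_self _
        rw [← Ideal.Quotient.eq]
        change Ideal.Quotient.mkₐ R (N ^ (k + 1)) _ = Ideal.Quotient.mkₐ R (N ^ (k + 1)) _
        rw [map_nilEval hN hq _ _ (fun i => Ideal.mem_map_of_mem _ (vec_mem x.2
            (sub_mem y.2 (x + y).2) i)), hg, map_nilEval hN hq _ _ (fun i =>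
            Ideal.mem_map_of_mem _ (vec_mem x.2 y.2 i))]
        refine nilEval_congr hq _ ?_ _
        ext i
        fin_cases i
        · rfl
        · change Ideal.Quotient.mk _ (y.1 - r) = Ideal.Quotient.mk _ y.1
          rw [Ideal.Quotient.eq, sub_sub_cancel_left]
          exact neg_mem hy
      simp only [Matrix.cons_val_zero, Matrix.cons_val_one] at hr ⊢
      have e : x.1 + (y.1 - r) + x.1 * (y.1 - r) *
          nilEval hN ![x.1, y.1 - r] (vec_mem x.2 (sub_mem y.2 (x + y).2)) G =
          x.1 * (y.1 - r) * (nilEval hN ![x.1, y.1 - r] (vec_mem x.2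
            (sub_mem y.2 (x + y).2)) G - g) - x.1 * r * g := by
        linear_combination -hr
      rw [e, pow_succ']
      refine sub_mem ?_ ?_
      · rw [mul_assoc]
        exact Ideal.mul_mem_mul x.2 (Ideal.mul_mem_left _ _ hg')
      · rw [mul_assoc]
        exact Ideal.mul_mem_mul x.2 (Ideal.mul_mem_right _ _ hy)
  obtain ⟨y, hy⟩ := key n
  refine ⟨y, NilPoint.ext ?_⟩
  have := Ideal.pow_le_pow_right (Nat.le_succ n) hy
  rw [hN] at this
  exact this

noncomputable instance : Neg (NilPoint F hN) where
  neg x := (exists_add_eq_zero x).choose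

noncomputable instance [F.IsComm] : AddCommGroup (NilPoint F hN) where
  add_assoc := add_assoc'
  zero_add x := by rw [add_comm', add_zero']
  add_zero := add_zero'
  nsmul := nsmulRec
  zsmul := zsmulRec
  neg_add_cancel x := by
    rw [add_comm']
    exact (exists_add_eq_zero x).choose_spec
  add_comm := add_comm'

/-- The homomorphism between groups of points induced by a homomorphism of `R`-algebras. -/
noncomputable def map [F.IsComm] {B' : Type*} [CommRing B'] [Algebra R B'] {N' : Ideal B'} {n' : ℕ}
    (hN' : N' ^ n' = ⊥) (g : B →ₐ[R] B') (hg : ∀ x ∈ N, g x ∈ N') :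
    NilPoint F hN →+ NilPoint F hN' where
  toFun x := ⟨g x.1, hg _ x.2⟩
  map_zero' := NilPoint.ext (map_zero g)
  map_add' x y := NilPoint.ext <| by
    change g (x + y).1 = _
    rw [add_val, map_nilEval hN hN' _ g fun i => hg _ (vec_mem x.2 y.2 i)]
    refine nilEval_congr hN' _ ?_ _
    ext i
    fin_cases i <;> rfl

end NilPoint

end Points

/-! ### Formal group algebras of free abelian groups are power series rings -/

section FGA

variable {R : Type*} [CommRing R] (F : FormalGroup R)
variable {M : Type*} [AddCommGroup M]

/-- The ideal of `R⟦x_M⟧` of the elements that vanish in `R[x_M] / (I ^ n + relations)`. -/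
noncomputable def levelIdeal (M : Type*) [AddCommGroup M] (n : ℕ) : Ideal (PowerSeriesRing R M) :=
  relIdeal F M ⊔ RingHom.ker (AdicCompletion.evalₐ (MvPolynomial.idealOfVars M R) n)

/-- The image of `levelIdeal` in the formal group algebra. -/
noncomputable def fgaLevel (M : Type*) [AddCommGroup M] (n : ℕ) : Ideal (FormalGroupAlgebra F M) :=
  (levelIdeal F M n).map (Ideal.Quotient.mk (closedRelIdeal F M))

/-- The projection from `R⟦x_M⟧` to the formal group algebra. -/
noncomputable def fgaMk (M : Type*) [AddCommGroup M] :
    PowerSeriesRing R M →ₐ[R] FormalGroupAlgebra F M :=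
  Ideal.Quotient.mkₐ R (closedRelIdeal F M)

theorem fgaMk_surjective : Function.Surjective (fgaMk F M) := Ideal.Quotient.mk_surjective

theorem fgaMk_mem_fgaLevel {n : ℕ} {y : PowerSeriesRing R M} :
    fgaMk F M y ∈ fgaLevel F M n ↔ y ∈ levelIdeal F M n := by
  change Ideal.Quotient.mk (closedRelIdeal F M) y ∈ (levelIdeal F M n).map
    (Ideal.Quotient.mk (closedRelIdeal F M)) ↔ _
  rw [Ideal.mem_quotient_iff_mem]
  exact iInf_le _ n

theorem eq_zero_of_forall_mem_fgaLevel {z : FormalGroupAlgebra F M}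
    (h : ∀ n, z ∈ fgaLevel F M n) : z = 0 := by
  obtain ⟨y, rfl⟩ := fgaMk_surjective F z
  refine Ideal.Quotient.eq_zero_iff_mem.2 ?_
  rw [closedRelIdeal, Submodule.mem_iInf]
  exact fun n => (fgaMk_mem_fgaLevel F).1 (h n)

theorem fgaLevel_anti {m n : ℕ} (h : m ≤ n) : fgaLevel F M n ≤ fgaLevel F M m := by
  refine Ideal.map_mono (sup_le_sup_left (fun y hy => ?_) _)
  rw [RingHom.mem_ker] at hy ⊢
  obtain ⟨y, rfl⟩ := AdicCompletion.mk_surjective _ _ y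
  rw [AdicCompletion.evalₐ_mk] at hy ⊢
  rw [Ideal.Quotient.eq_zero_iff_mem] at hy
  rw [← AdicCompletion.Ideal.mk_eq_mk _ h, Ideal.Quotient.eq_zero_iff_mem]
  exact Ideal.pow_le_pow_right h hy

/-! ### Homomorphisms to rings with a nilpotent ideal -/

section Lift

variable {B : Type*} [CommRing B] [Algebra R B] {N : Ideal B} {n : ℕ} {hN : N ^ n = ⊥}

section Aux

variable {M : Type*}

/-- The continuous homomorphism `R⟦x_M⟧ → B` that maps the variables to given elements of a
nilpotent ideal. -/
noncomputable def psLift (hN : N ^ n = ⊥) (u : M → B) (hu : ∀ l, u l ∈ N) :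
    PowerSeriesRing R M →ₐ[R] B :=
  (Ideal.Quotient.liftₐ (MvPolynomial.idealOfVars M R ^ n) (MvPolynomial.aeval u)
    fun _ hp => idealOfVars_pow_le_ker_aeval hu hN hp).comp
  ((AdicCompletion.evalₐ (MvPolynomial.idealOfVars M R) n).restrictScalars R)

theorem psLift_algebraMap (u : M → B) (hu : ∀ l, u l ∈ N) (p : MvPolynomial M R) :
    psLift hN u hu (algebraMap _ (PowerSeriesRing R M) p) = MvPolynomial.aeval u p := by
  rw [psLift, AlgHom.comp_apply, AlgHom.restrictScalars_apply, AlgHom.commutes]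
  rfl

theorem psLift_psVar (u : M → B) (hu : ∀ l, u l ∈ N) (l : M) :
    psLift hN u hu (psVar R l) = u l := by
  rw [psVar, psLift_algebraMap, MvPolynomial.aeval_X]

/-- The continuous homomorphism `R⟦X_σ⟧ → R⟦x_M⟧` with `X_i ↦ x_{e i}`. -/
noncomputable def toPs {σ : Type*} [Finite σ] (e : σ → M) :
    MvPowerSeries σ R →ₐ[R] PowerSeriesRing R M :=
  (psMap R e).comp ((MvPowerSeries.toAdicCompletion σ R).restrictScalars R)

theorem toPs_X {σ : Type*} [Finite σ] (e : σ → M) (i : σ) :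
    toPs (R := R) e (MvPowerSeries.X i) = psVar R (e i) := by
  rw [toPs, AlgHom.comp_apply, AlgHom.restrictScalars_apply, ← MvPolynomial.coe_X,
    ← psMap_psVar (R := R) e i]
  congr 1
  exact AlgHom.commutes (MvPowerSeries.toAdicCompletion σ R) (MvPolynomial.X i)

theorem psFormalSum_eq {M : Type*} (l m : M) : psFormalSum F l m = toPs ![l, m] F.toPowerSeries := rfl

theorem psLift_toPs {σ : Type*} [Finite σ] (u : M → B) (hu : ∀ l, u l ∈ N) (e : σ → M) :
    (psLift hN u hu).comp (toPs e) = nilEval (R := R) hN (fun i => u (e i)) (fun i => hu (e i)) :=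
  eq_nilEval hN (fun i => hu (e i)) fun i => by rw [AlgHom.comp_apply, toPs_X, psLift_psVar]

end Aux

variable [F.IsComm] {F}

/-- A homomorphism from `M` to the points of `F` respects the relations of the formal group
algebra, and the nilpotency of the ideal takes care of their closure. -/
theorem psLift_eq_zero (β : M →+ NilPoint F hN) {y : PowerSeriesRing R M}
    (hy : y ∈ levelIdeal F M n) : psLift hN (fun l => (β l).val) (fun l => (β l).mem) y = 0 := by
  suffices levelIdeal F M n ≤
      RingHom.ker (psLift (R := R) hN (fun l => (β l).val) fun l => (β l).mem) from this hy
  refine sup_le ?_ fun z hz => ?_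
  · rw [relIdeal, Ideal.span_le]
    rintro _ (rfl | ⟨⟨l, m⟩, rfl⟩)
    · change psLift hN _ _ (psVar R (0 : M)) = 0
      rw [psLift_psVar, map_zero]
      rfl
    · change psLift hN _ _ (psFormalSum F l m - psVar R (l + m)) = 0
      rw [map_sub, psLift_psVar, psFormalSum_eq, ← AlgHom.comp_apply, psLift_toPs, map_add,
        NilPoint.add_val, sub_eq_zero]
      refine nilEval_congr hN _ ?_ _
      ext i
      fin_cases i <;> rfl
  · rw [RingHom.mem_ker] at hz ⊢
    rw [psLift, AlgHom.comp_apply, AlgHom.restrictScalars_apply, hz, map_zero]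

/-- The universal property of the formal group algebra for nilpotent test objects. -/
noncomputable def fgaLift (β : M →+ NilPoint F hN) : FormalGroupAlgebra F M →ₐ[R] B :=
  Ideal.Quotient.liftₐ (closedRelIdeal F M)
    (psLift hN (fun l => (β l).val) fun l => (β l).mem)
    fun _ hy => psLift_eq_zero β ((iInf_le _ n : closedRelIdeal F M ≤ levelIdeal F M n) hy)

theorem fgaLift_xvar (β : M →+ NilPoint F hN) (l : M) : fgaLift β (xvar F l) = (β l).val :=
  psLift_psVar (R := R) (hN := hN) (fun l => (β l).val) (fun l => (β l).mem) l

theorem fgaLift_eq_zero (β : M →+ NilPoint F hN) {z : FormalGroupAlgebra F M}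
    (hz : z ∈ fgaLevel F M n) : fgaLift β z = 0 := by
  obtain ⟨y, rfl⟩ := fgaMk_surjective F z
  exact psLift_eq_zero β ((fgaMk_mem_fgaLevel F).1 hz)

end Lift

/-- The homomorphism `R⟦X_σ⟧ → R⟦M⟧_F` with `X_i ↦ x_{e i}`. -/
noncomputable def toFga {σ : Type*} [Finite σ] (e : σ → M) :
    MvPowerSeries σ R →ₐ[R] FormalGroupAlgebra F M :=
  (fgaMk F M).comp (toPs e)

theorem toFga_X {σ : Type*} [Finite σ] (e : σ → M) (i : σ) :
    toFga F e (MvPowerSeries.X i) = xvar F (e i) :=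
  congrArg (fgaMk F M) (toPs_X e i)

theorem fgaMap_toFga {σ : Type*} [Finite σ] (e : σ → M) {M' : Type*} [AddCommGroup M']
    (f : M →+ M') (g : MvPowerSeries σ R) :
    fgaMap F f (toFga F e g) = toFga F (fun i => f (e i)) g :=
  congrArg (fgaMk F M') (psMap_psMap e f (MvPowerSeries.toAdicCompletion σ R g))

theorem xvar_zero : xvar F (0 : M) = 0 :=
  Ideal.Quotient.eq_zero_iff_mem.2 <| Submodule.mem_iInf _ |>.2 fun _ =>
    Ideal.mem_sup_left (Ideal.subset_span (Or.inl rfl))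

theorem xvar_add (l m : M) : xvar F (l + m) = toFga F ![l, m] F.toPowerSeries := by
  symm
  refine Ideal.Quotient.eq.2 ?_
  exact Submodule.mem_iInf _ |>.2 fun _ =>
    Ideal.mem_sup_left (Ideal.subset_span (Or.inr ⟨(l, m), rfl⟩))

section Level

/-- The quotient of the formal group algebra by `fgaLevel`, in which the variables generate a
nilpotent ideal. -/
abbrev FgaQuot (M : Type*) [AddCommGroup M] (n : ℕ) : Type _ :=
  FormalGroupAlgebra F M ⧸ fgaLevel F M n

/-- The ideal generated by the variables. -/
noncomputable def quotVars (M : Type*) [AddCommGroup M] (n : ℕ) : Ideal (FgaQuot F M n) :=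
  Ideal.span (Set.range fun l : M => Ideal.Quotient.mk _ (xvar F l))

theorem quotVars_pow (M : Type*) [AddCommGroup M] (n : ℕ) : quotVars F M n ^ n = ⊥ := by
  have h : quotVars F M n = (MvPolynomial.idealOfVars M R).map
      (((Ideal.Quotient.mk (fgaLevel F M n)).comp
        (fgaMk F M : PowerSeriesRing R M →+* FormalGroupAlgebra F M)).comp
        (algebraMap (MvPolynomial M R) (PowerSeriesRing R M))) := by
    change _ = (Ideal.span (Set.range MvPolynomial.X)).map _
    rw [Ideal.map_span, ← Set.range_comp]
    rfl
  rw [h, ← Ideal.map_pow, eq_bot_iff, Ideal.map_le_iff_le_comap]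
  intro p hp
  change Ideal.Quotient.mk (fgaLevel F M n) (fgaMk F M (algebraMap _ _ p)) = 0
  rw [Ideal.Quotient.eq_zero_iff_mem, fgaMk_mem_fgaLevel]
  refine Ideal.mem_sup_right ?_
  rw [RingHom.mem_ker, AlgHom.commutes]
  exact Ideal.Quotient.eq_zero_iff_mem.2 hp

variable [F.IsComm]

/-- The points `x_l` of a formal group law in the quotient of the formal group algebra. -/
noncomputable def quotPoint (M : Type*) [AddCommGroup M] (n : ℕ) :
    M →+ NilPoint F (quotVars_pow F M n) where
  toFun l := ⟨Ideal.Quotient.mk _ (xvar F l), Ideal.subset_span ⟨l, rfl⟩⟩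
  map_zero' := NilPoint.ext (by
    change Ideal.Quotient.mk _ (xvar F (0 : M)) = 0
    rw [xvar_zero, map_zero])
  map_add' l m := NilPoint.ext <| by
    change Ideal.Quotient.mkₐ R _ (xvar F (l + m)) = _
    rw [xvar_add, ← AlgHom.comp_apply, NilPoint.add_val]
    congr 1
    refine eq_nilEval _ _ fun i => ?_
    rw [AlgHom.comp_apply, toFga_X]
    fin_cases i <;> rfl

end Level

section Basis

theorem map_varsIdeal_pow (σ : Type*) (n : ℕ) :
    ((varsIdeal σ R).map (Ideal.Quotient.mkₐ R (varsIdeal σ R ^ n))) ^ n = ⊥ := by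
  rw [← Ideal.map_pow]
  exact Ideal.map_quotient_self _

variable [F.IsComm] {σ : Type*} [Finite σ] (e : Module.Basis σ ℤ M)

/-- The homomorphism from a free abelian group to the points in `R⟦X_σ⟧ / (X) ^ n` that maps
the `i`-th basis vector to `X_i`. -/
noncomputable def basisPoint (n : ℕ) : M →+ NilPoint F (map_varsIdeal_pow (R := R) σ n) :=
  (e.constr ℤ fun i => (⟨Ideal.Quotient.mkₐ R _ (MvPowerSeries.X i),
    Ideal.mem_map_of_mem _ (X_mem_varsIdeal i)⟩ :
      NilPoint F (map_varsIdeal_pow (R := R) σ n))).toAddMonoidHom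

omit [Finite σ] in
theorem basisPoint_basis (n : ℕ) (i : σ) : (basisPoint F e n (e i)).val =
    Ideal.Quotient.mkₐ R (varsIdeal σ R ^ n) (MvPowerSeries.X i) :=
  congrArg NilPoint.val (e.constr_basis ℤ _ i)

theorem fgaLift_basisPoint_toFga (n : ℕ) (g : MvPowerSeries σ R) :
    fgaLift (basisPoint F e n) (toFga F e g) = Ideal.Quotient.mkₐ R (varsIdeal σ R ^ n) g := by
  have := isHausdorff_of_pow_eq_bot (map_varsIdeal_pow (R := R) σ n)
  have h : (fgaLift (basisPoint F e n)).comp (toFga F e) =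
      Ideal.Quotient.mkₐ R (varsIdeal σ R ^ n) :=
    mvPowerSeries_algHom_ext _ (fun i => by
      rw [AlgHom.comp_apply, toFga_X, fgaLift_xvar, basisPoint_basis]) fun i => by
      rw [AlgHom.comp_apply, toFga_X, fgaLift_xvar]
      exact (basisPoint F e n (e i)).mem
  exact DFunLike.congr_fun h g

/-- The universal point with values in the power series ring modulo the `n`-th power of its ideal
of variables gives a left inverse modulo that power. -/
theorem toFga_injective : Function.Injective (toFga F e) := by
  rw [injective_iff_map_eq_zero]
  intro g hg
  refine eq_zero_of_forall_mem_pow (varsIdeal σ R) fun n => ?_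
  have := fgaLift_basisPoint_toFga F e n g
  rw [hg, map_zero] at this
  exact Ideal.Quotient.eq_zero_iff_mem.1 this.symm

theorem toFga_mem_fgaLevel_iff {n : ℕ} {g : MvPowerSeries σ R} :
    toFga F e g ∈ fgaLevel F M n ↔ g ∈ varsIdeal σ R ^ n := by
  constructor
  · intro h
    have := fgaLift_basisPoint_toFga F e n g
    rw [fgaLift_eq_zero _ h] at this
    exact Ideal.Quotient.eq_zero_iff_mem.1 this.symm
  · intro h
    have := map_mem_pow_of_mem (N := quotVars F M n)
      (φ := (Ideal.Quotient.mk (fgaLevel F M n)).comp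
        ((toFga F e : MvPowerSeries σ R →ₐ[R] _) : MvPowerSeries σ R →+* _)) (fun i => by
        rw [RingHom.comp_apply, RingHom.coe_coe, toFga_X]
        exact Ideal.subset_span ⟨_, rfl⟩) h
    rw [quotVars_pow] at this
    exact Ideal.Quotient.eq_zero_iff_mem.1 this

/-- Every element of the formal group algebra is congruent to an element of the power series ring
generated by the basis variables. -/
theorem exists_toFga_sub_mem (n : ℕ) (z : FormalGroupAlgebra F M) :
    ∃ g, toFga F e g - z ∈ fgaLevel F M n := by
  set q := Ideal.Quotient.mkₐ R (fgaLevel F M n) with hq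
  let θ : (MvPowerSeries σ R ⧸ varsIdeal σ R ^ n) →ₐ[R] FgaQuot F M n :=
    Ideal.Quotient.liftₐ _ (q.comp (toFga F e)) fun g hg =>
      Ideal.Quotient.eq_zero_iff_mem.2 ((toFga_mem_fgaLevel_iff F e).2 hg)
  have hθ : ∀ g, θ (Ideal.Quotient.mkₐ R _ g) = q (toFga F e g) := fun g => rfl
  have hθN : ∀ x ∈ (varsIdeal σ R).map (Ideal.Quotient.mkₐ R (varsIdeal σ R ^ n)),
      θ x ∈ quotVars F M n := by
    suffices ((varsIdeal σ R).map (Ideal.Quotient.mkₐ R (varsIdeal σ R ^ n))) ≤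
      (quotVars F M n).comap θ from this
    change (Ideal.span (Set.range MvPowerSeries.X)).map _ ≤ _
    rw [Ideal.map_span, Ideal.span_le]
    rintro _ ⟨_, ⟨i, rfl⟩, rfl⟩
    change θ (Ideal.Quotient.mkₐ R _ _) ∈ quotVars F M n
    rw [hθ, toFga_X]
    exact Ideal.subset_span ⟨_, rfl⟩
  -- both sides are homomorphisms from `M` to the group of points
  have hpt : (NilPoint.map (quotVars_pow F M n) θ hθN).comp (basisPoint F e n) =
      quotPoint F M n := by
    have : ((NilPoint.map (quotVars_pow F M n) θ hθN).comp (basisPoint F e n)).toIntLinearMap =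
        (quotPoint F M n).toIntLinearMap := e.ext fun i => NilPoint.ext <| by
      change θ (basisPoint F e n (e i)).val = q (xvar F (e i))
      rw [basisPoint_basis, hθ, toFga_X]
    exact AddMonoidHom.ext fun l => DFunLike.congr_fun this l
  have hx : ∀ l, ∃ g, q (toFga F e g) = q (xvar F l) := fun l => by
    obtain ⟨g, hg⟩ := Ideal.Quotient.mkₐ_surjective R _ (basisPoint F e n l).val
    refine ⟨g, ?_⟩
    rw [← hθ, hg]
    exact congrArg NilPoint.val (DFunLike.congr_fun hpt l)
  choose g hg using hx
  obtain ⟨y, rfl⟩ := fgaMk_surjective F z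
  obtain ⟨p, hp⟩ := Ideal.Quotient.mk_surjective
    (AdicCompletion.evalₐ (MvPolynomial.idealOfVars M R) n y)
  refine ⟨MvPolynomial.aeval g p, ?_⟩
  have h1 : fgaMk F M (algebraMap _ _ p - y) ∈ fgaLevel F M n := by
    refine (fgaMk_mem_fgaLevel F).2 (Ideal.mem_sup_right ?_)
    rw [RingHom.mem_ker, map_sub, ← hp, AlgHom.commutes]
    exact sub_self _
  have h2 : (q.comp (toFga F e)).comp (MvPolynomial.aeval g) =
      (q.comp (fgaMk F M)).comp (IsScalarTower.toAlgHom R (MvPolynomial M R)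
        (PowerSeriesRing R M)) := MvPolynomial.algHom_ext fun l => by
    rw [AlgHom.comp_apply, AlgHom.comp_apply, MvPolynomial.aeval_X, hg]
    rfl
  have h3 : toFga F e (MvPolynomial.aeval g p) - fgaMk F M (algebraMap _ _ p) ∈
      fgaLevel F M n := Ideal.Quotient.eq.1 (DFunLike.congr_fun h2 p)
  have := add_mem h3 h1
  rwa [map_sub, sub_add_sub_cancel] at this

theorem toFga_surjective : Function.Surjective (toFga F e) := by
  intro z
  choose g hg using fun n => exists_toFga_sub_mem F e n z
  obtain ⟨f, hf⟩ := IsPrecomplete.prec (I := varsIdeal σ R) (M := MvPowerSeries σ R)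
    inferInstance (f := g) fun {m n} hmn => by
      rw [SModEq.sub_mem, smul_eq_mul, Ideal.mul_top, ← toFga_mem_fgaLevel_iff F e, map_sub]
      have := sub_mem (hg m) (fgaLevel_anti F hmn (hg n))
      rwa [sub_sub_sub_cancel_right] at this
  refine ⟨f, ?_⟩
  rw [← sub_eq_zero]
  refine eq_zero_of_forall_mem_fgaLevel F fun n => ?_
  have h1 := hf n
  rw [SModEq.sub_mem, smul_eq_mul, Ideal.mul_top, ← toFga_mem_fgaLevel_iff F e, map_sub] at h1
  have := sub_mem (hg n) h1
  rwa [sub_sub_sub_cancel_left] at this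

/-- The formal group algebra of a free abelian group of finite rank is a power series ring. -/
noncomputable def fgaEquiv : MvPowerSeries σ R ≃ₐ[R] FormalGroupAlgebra F M :=
  AlgEquiv.ofBijective (toFga F e) ⟨toFga_injective F e, toFga_surjective F e⟩

end Basis

end FGA

/-! ### Divisibility in formal group algebras -/

section Divisibility

variable {R : Type*} [CommRing R] (F : FormalGroup R)
variable {M : Type*} [AddCommGroup M] {M' : Type*} [AddCommGroup M']

/-- The augmentation ideal of the formal group algebra. -/
noncomputable def augIdeal (M : Type*) [AddCommGroup M] : Ideal (FormalGroupAlgebra F M) :=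
  Ideal.span (Set.range fun l : M => xvar F l)

theorem xvar_mem_augIdeal (l : M) : xvar F l ∈ augIdeal F M := Ideal.subset_span ⟨l, rfl⟩

/-- A consequence of the closure taken in the definition of the formal group algebra. -/
instance : IsHausdorff (augIdeal F M) (FormalGroupAlgebra F M) := ⟨fun z hz => by
  refine eq_zero_of_forall_mem_fgaLevel F fun n => ?_
  have h := hz n
  rw [SModEq.zero, smul_eq_mul, Ideal.mul_top] at h
  have h2 : (augIdeal F M ^ n).map (Ideal.Quotient.mk (fgaLevel F M n)) = ⊥ := by
    rw [Ideal.map_pow, augIdeal, Ideal.map_span, ← Set.range_comp, ← quotVars_pow F M n]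
    rfl
  have h3 := Ideal.mem_map_of_mem (Ideal.Quotient.mk (fgaLevel F M n)) h
  rw [h2] at h3
  exact Ideal.Quotient.eq_zero_iff_mem.1 h3⟩

theorem eq_zero_of_forall_xvar_pow_dvd {l : M} {z : FormalGroupAlgebra F M}
    (h : ∀ n, xvar F l ^ n ∣ z) : z = 0 :=
  eq_zero_of_forall_mem_pow (augIdeal F M) fun n =>
    Ideal.mem_of_dvd _ (h n) (Ideal.pow_mem_pow (xvar_mem_augIdeal F l) n)

theorem isUnit_one_add_xvar_mul (l m : M) (G : MvPowerSeries (Fin 2) R) :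
    IsUnit (1 + xvar F m * toFga F ![l, m] G) := by
  have h : IsUnit (1 + MvPowerSeries.X 1 * G : MvPowerSeries (Fin 2) R) := by
    rw [MvPowerSeries.isUnit_iff_constantCoeff]
    simp
  have h2 := h.map (toFga F ![l, m])
  rw [map_add, map_one, map_mul, toFga_X] at h2
  exact h2

/-- The elements `x_l - x_m` and `x_{l - m}` agree up to a unit. -/
theorem exists_xvar_sub_eq (l m : M) :
    ∃ u, IsUnit u ∧ xvar F l - xvar F m = xvar F (l - m) * u := by
  obtain ⟨G, hG⟩ := exists_eq_add_mul F
  refine ⟨_, isUnit_one_add_xvar_mul F (l - m) m G, ?_⟩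
  have h := xvar_add F (l - m) m
  rw [hG, sub_add_cancel] at h
  simp only [map_add, map_mul, toFga_X, Matrix.cons_val_zero, Matrix.cons_val_one] at h
  rw [h]
  ring

theorem exists_xvar_add_neg (l : M) :
    ∃ g, xvar F l + xvar F (-l) = xvar F l * xvar F (-l) * g := by
  obtain ⟨G, hG⟩ := exists_eq_add_mul F
  refine ⟨-toFga F ![l, -l] G, ?_⟩
  have h := xvar_add F l (-l)
  rw [hG, add_neg_cancel, xvar_zero] at h
  simp only [map_add, map_mul, toFga_X, Matrix.cons_val_zero, Matrix.cons_val_one] at h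
  linear_combination -h

variable [F.IsComm]

/-- A ring homomorphism on the formal group algebra of a free abelian group that maps the variables
to topologically nilpotent elements is determined by its values on constants and on the `x_l` for
a basis. -/
theorem fga_ringHom_ext {σ : Type*} [Finite σ] (e : Module.Basis σ ℤ M) {B : Type*} [CommRing B]
    (N : Ideal B) [IsHausdorff N B] {φ ψ : FormalGroupAlgebra F M →+* B}
    (hC : ∀ r, φ (algebraMap R _ r) = ψ (algebraMap R _ r))
    (hX : ∀ i, φ (xvar F (e i)) = ψ (xvar F (e i)))
    (hN : ∀ i, φ (xvar F (e i)) ∈ N) : φ = ψ := by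
  have h : φ.comp (toFga F e : MvPowerSeries σ R →+* _) =
      ψ.comp (toFga F e : MvPowerSeries σ R →+* _) := by
    refine mvPowerSeries_ringHom_ext N (fun r => ?_) (fun i => ?_) fun i => ?_
    · have : toFga F e (MvPowerSeries.C r) = algebraMap R _ r := AlgHom.commutes _ r
      change φ (toFga F e _) = ψ (toFga F e _)
      rw [this, hC]
    · change φ (toFga F e _) = ψ (toFga F e _)
      rw [toFga_X, hX]
    · change φ (toFga F e _) ∈ N
      rw [toFga_X]
      exact hN i
  ext z
  obtain ⟨g, rfl⟩ := toFga_surjective F e z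
  exact DFunLike.congr_fun h g

/-- The kernel of the map induced by killing one basis vector is generated by its variable: in
power series coordinates this is the map setting that variable to zero. -/
theorem xvar_dvd_of_fgaMap_eq_zero_of_basis {σ τ : Type*} [Finite σ] [Finite τ]
    (e : Module.Basis τ ℤ M) (e' : Module.Basis σ ℤ M') (j : σ ↪ τ) (s : τ)
    (hs : ∀ k, k ∈ Set.range j ↔ k ≠ s) (f : M →+ M') (h0 : f (e s) = 0)
    (h1 : ∀ i, f (e (j i)) = e' i) {z : FormalGroupAlgebra F M} (hz : fgaMap F f z = 0) :
    xvar F (e s) ∣ z := by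
  obtain ⟨g, rfl⟩ := toFga_surjective F e z
  have hk : toFga F (fun i => f (e i)) = (toFga F e').comp (MvPowerSeries.killCompl j) := by
    refine mvPowerSeries_algHom_ext (augIdeal F M') (fun i => ?_) fun i => ?_
    · rw [AlgHom.comp_apply, toFga_X]
      by_cases hi : i = s
      · rw [MvPowerSeries.killCompl_X_eq_zero fun h => (hs i).1 h hi, hi, h0, xvar_zero, map_zero]
      · obtain ⟨k, rfl⟩ := (hs i).2 hi
        rw [MvPowerSeries.killCompl_X, toFga_X, h1]
    · rw [toFga_X]
      exact xvar_mem_augIdeal F _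
  rw [fgaMap_toFga, hk, AlgHom.comp_apply] at hz
  have := X_dvd_of_killCompl_eq_zero j s hs (toFga_injective F e' (hz.trans (map_zero _).symm))
  have := map_dvd (toFga F e) this
  rwa [toFga_X] at this

theorem xvar_basis_mul_cancel {σ : Type*} [Finite σ] (e : Module.Basis σ ℤ M) (i : σ)
    {z : FormalGroupAlgebra F M} (hz : xvar F (e i) * z = 0) : z = 0 := by
  obtain ⟨g, rfl⟩ := toFga_surjective F e z
  rw [← toFga_X, ← map_mul] at hz
  rw [X_mul_cancel (toFga_injective F e (hz.trans (map_zero _).symm)), map_zero]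

theorem isDomain_fga [IsDomain R] [Module.Free ℤ M] [Module.Finite ℤ M] :
    IsDomain (FormalGroupAlgebra F M) :=
  have : IsDomain (MvPowerSeries (Module.Free.ChooseBasisIndex ℤ M) R) := NoZeroDivisors.to_isDomain _
  (fgaEquiv F (Module.Free.chooseBasis ℤ M)).toMulEquiv.symm.isDomain _

section Free

variable [Module.Free ℤ M] [Module.Finite ℤ M]

/-- The basis of `ℤ × M` that consists of `(1, 0)` and a basis of `M`. -/
noncomputable def prodBasis (M : Type*) [AddCommGroup M] [Module.Free ℤ M] :
    Module.Basis (Unit ⊕ Module.Free.ChooseBasisIndex ℤ M) ℤ (ℤ × M) :=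
  (Module.Basis.singleton Unit ℤ).prod (Module.Free.chooseBasis ℤ M)

omit [Module.Finite ℤ M] in
theorem prodBasis_inl : prodBasis M (Sum.inl ()) = (1, 0) := by
  simp [prodBasis]

/-- The kernel of the map induced by the projection killing `γ` is generated by `x_γ`. -/
theorem gamma_dvd {z : FormalGroupAlgebra F (ℤ × M)}
    (hz : fgaMap F (AddMonoidHom.snd ℤ M) z = 0) : xvar F ((1, 0) : ℤ × M) ∣ z := by
  rw [← prodBasis_inl]
  refine xvar_dvd_of_fgaMap_eq_zero_of_basis F (prodBasis M) (Module.Free.chooseBasis ℤ M)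
    ⟨Sum.inr, Sum.inr_injective⟩ (Sum.inl ()) (fun k => ?_) (AddMonoidHom.snd ℤ M) ?_ ?_ hz
  · rcases k with k | k <;> simp
  · simp [prodBasis]
  · intro i
    simp [prodBasis]

theorem gamma_mul_cancel {z : FormalGroupAlgebra F (ℤ × M)}
    (hz : xvar F ((1, 0) : ℤ × M) * z = 0) : z = 0 := by
  rw [← prodBasis_inl] at hz
  exact xvar_basis_mul_cancel F (prodBasis M) _ hz

/-- If two homomorphisms differ by multiples of `v`, the induced homomorphisms of formal group
algebras differ by multiples of `x_v`. -/
theorem xvar_dvd_fgaMap_sub {M₀ : Type*} [AddCommGroup M₀] (f g : M₀ →+ M) (c : M₀ →+ ℤ) (v : M)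
    (h : ∀ m, f m = c m • v + g m) (z : FormalGroupAlgebra F M₀) :
    xvar F v ∣ fgaMap F f z - fgaMap F g z := by
  let p : ℤ × M →+ M := (zmultiplesHom M v).coprod (AddMonoidHom.id M)
  have hp : ∀ x, p x = x.1 • v + x.2 := fun x => by
    simp [p]
  have h1 : fgaMap F f z = fgaMap F p (fgaMap F (c.prod g) z) := by
    have : p.comp (c.prod g) = f := AddMonoidHom.ext fun m => (hp _).trans (h m).symm
    rw [fgaMap_fgaMap, this]
  have h2 : fgaMap F g z = fgaMap F p (fgaMap F ((0 : M₀ →+ ℤ).prod g) z) := by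
    have : p.comp ((0 : M₀ →+ ℤ).prod g) = g := AddMonoidHom.ext fun m => (hp _).trans (by simp)
    rw [fgaMap_fgaMap, this]
  have h3 := gamma_dvd F (z := fgaMap F (c.prod g) z - fgaMap F ((0 : M₀ →+ ℤ).prod g) z) (by
    rw [map_sub, fgaMap_fgaMap, fgaMap_fgaMap, sub_eq_zero]
    rfl)
  have h4 := map_dvd (fgaMap F p) h3
  rw [fgaMap_xvar, hp, map_sub, ← h1, ← h2] at h4
  simpa using h4

/-- Regular elements of `R⟦M⟧_F` remain regular in `R⟦ℤ ⊕ M⟧_F`. -/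
theorem xvar_inr_mul_cancel {l : M} (hl : IsRegular (xvar F l))
    {z : FormalGroupAlgebra F (ℤ × M)} (hz : xvar F ((0, l) : ℤ × M) * z = 0) : z = 0 := by
  have key : ∀ n, ∀ z, xvar F ((0, l) : ℤ × M) * z = 0 → xvar F ((1, 0) : ℤ × M) ^ n ∣ z := by
    intro n
    induction n with
    | zero => exact fun z _ => by rw [pow_zero]; exact one_dvd z
    | succ n ih =>
      intro z hz
      have h1 := congrArg (fgaMap F (AddMonoidHom.snd ℤ M)) hz
      rw [map_mul, fgaMap_xvar, map_zero] at h1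
      obtain ⟨y, rfl⟩ := gamma_dvd F (hl.left.mul_left_eq_zero_iff.1 h1)
      rw [mul_left_comm] at hz
      rw [pow_succ']
      exact mul_dvd_mul_left _ (ih y (gamma_mul_cancel F hz))
  exact eq_zero_of_forall_xvar_pow_dvd F fun n => key n z hz

/-- The difference `x_γ - x_l` is a unit times `x_{γ - l}`, and a shear of `ℤ γ ⊕ M` carries
`γ - l` to `γ`; hence it is not a zero divisor, whatever the ring of coefficients. -/
theorem gamma_sub_mul_cancel (l : M) {z : FormalGroupAlgebra F (ℤ × M)}
    (hz : (xvar F ((1, 0) : ℤ × M) - xvar F ((0, l) : ℤ × M)) * z = 0) : z = 0 := by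
  obtain ⟨u, hu, h⟩ := exists_xvar_sub_eq F ((1, 0) : ℤ × M) (0, l)
  let p : M → ℤ × M →+ ℤ × M := fun l =>
    (AddMonoidHom.fst ℤ M).prod ((zmultiplesHom M l).coprod (AddMonoidHom.id M))
  have hp : ∀ l x, p l x = (x.1, x.1 • l + x.2) := fun l x => by simp [p]
  rw [h, mul_right_comm, hu.mul_left_eq_zero] at hz
  have h2 := congrArg (fgaMap F (p l)) hz
  rw [map_mul, fgaMap_xvar, map_zero, hp] at h2
  have e : (((1, 0) : ℤ × M) - (0, l)).1 • l + (((1, 0) : ℤ × M) - (0, l)).2 = 0 := by simp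
  rw [e, Prod.fst_sub, sub_zero] at h2
  have h3 := gamma_mul_cancel F h2
  have h4 := congrArg (fgaMap F (p (-l))) h3
  rw [fgaMap_fgaMap, map_zero] at h4
  have : (p (-l)).comp (p l) = AddMonoidHom.id _ := by
    refine AddMonoidHom.ext fun x => ?_
    rw [AddMonoidHom.comp_apply, hp, hp]
    simp
  rwa [this, fgaMap_id] at h4

end Free

section CharZero

variable [IsDomain R] [CharZero R]

omit [IsDomain R] in
/-- Over a domain of characteristic zero, `x_l ≠ 0` for `l ≠ 0`. -/
theorem xvar_ne_zero [Module.Free ℤ M] {l : M} (hl : l ≠ 0) : xvar F l ≠ 0 := by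
  obtain ⟨i, hi⟩ : ∃ i, (Module.Free.chooseBasis ℤ M).coord i l ≠ 0 := by
    by_contra! h
    exact hl ((Module.Free.chooseBasis ℤ M).forall_coord_eq_zero_iff.1 h)
  set c := (Module.Free.chooseBasis ℤ M).coord i with hc
  -- over the dual numbers the formal group law is additive
  let N : Ideal (DualNumber R) := Ideal.span {DualNumber.eps}
  have hN : N ^ 2 = ⊥ := by
    rw [Ideal.span_singleton_pow, pow_two, DualNumber.eps_mul_eps, Ideal.span_singleton_eq_bot]
  obtain ⟨G, hG⟩ := exists_eq_add_mul F
  let β : M →+ NilPoint F hN :=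
    { toFun := fun m => ⟨((c m : R)) • DualNumber.eps, by
        rw [Algebra.smul_def]
        exact Ideal.mul_mem_left _ _ (Ideal.mem_span_singleton_self _)⟩
      map_zero' := NilPoint.ext <| by
        change ((c 0 : ℤ) : R) • (DualNumber.eps : DualNumber R) = 0
        rw [map_zero, Int.cast_zero, zero_smul]
      map_add' := fun m m' => NilPoint.ext <| by
        rw [NilPoint.add_val, hG]
        change ((c (m + m') : ℤ) : R) • (DualNumber.eps : DualNumber R) = _
        simp only [map_add, map_mul, nilEval_X, Matrix.cons_val_zero, Matrix.cons_val_one]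
        rw [smul_mul_smul_comm, DualNumber.eps_mul_eps, smul_zero, zero_mul, add_zero,
          Int.cast_add, add_smul] }
  intro h
  have h2 := fgaLift_xvar β l
  rw [h, map_zero] at h2
  have h3 := congrArg TrivSqZeroExt.snd h2.symm
  change (((c l : R)) • (DualNumber.eps : DualNumber R)).snd = _ at h3
  rw [TrivSqZeroExt.snd_smul, DualNumber.snd_eps, smul_eq_mul, mul_one, TrivSqZeroExt.snd_zero] at h3
  exact hi (Int.cast_eq_zero.1 h3)

variable [Module.Free ℤ M] [Module.Finite ℤ M]

/-- Over a domain of characteristic zero, the zero divisors modulo `x_v`, for a primitive vector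
`v`, among the elements `x_l` are those with `l ∈ ℤ v`. -/
theorem xvar_dvd_of_dvd_mul {v : M} (c : M →+ ℤ) (hc : c v = 1) {l : M} (hl : ∀ k : ℤ, l ≠ k • v)
    {z : FormalGroupAlgebra F M} (h : xvar F v ∣ xvar F l * z) : xvar F v ∣ z := by
  -- split `M` as `ℤ v ⊕ ker c` and pass to the quotient by `x_v`
  let K : AddSubgroup M := c.ker
  let K' : Submodule ℤ M := AddSubgroup.toIntSubmodule K
  have : Module.Free ℤ K := inferInstanceAs (Module.Free ℤ K')
  have : Module.Finite ℤ K := inferInstanceAs (Module.Finite ℤ K')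
  let pr : M →+ K := (AddMonoidHom.id M - (zmultiplesHom M v).comp c).codRestrict K fun m => by
    simp [K, AddMonoidHom.mem_ker, hc]
  have hpr : ∀ m, ((pr m : K) : M) = m - c m • v := fun m => rfl
  let p : M →+ ℤ × K := c.prod pr
  let q : ℤ × K →+ M := (zmultiplesHom M v).coprod K.subtype
  have hq : ∀ x, q x = x.1 • v + x.2 := fun x => by simp [q]
  have hqp : q.comp p = AddMonoidHom.id M := AddMonoidHom.ext fun m => by
    rw [AddMonoidHom.comp_apply, hq]
    change c m • v + ((pr m : K) : M) = m
    rw [hpr]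
    abel
  have hpv : p v = (1, 0) := Prod.ext hc (Subtype.ext (by
    change ((pr v : K) : M) = 0
    rw [hpr, hc, one_smul, sub_self]))
  obtain ⟨y, hy⟩ := h
  have h1 := congrArg (fgaMap F pr) hy
  rw [map_mul, map_mul, fgaMap_xvar, fgaMap_xvar] at h1
  have hprv : pr v = 0 := congrArg Prod.snd hpv
  rw [hprv, xvar_zero, zero_mul] at h1
  have := isDomain_fga (M := K) F
  have hprl : pr l ≠ 0 := fun h0 => hl (c l) <| by
    have := congrArg (fun x : K => (x : M)) h0
    change ((pr l : K) : M) = 0 at this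
    rw [hpr, sub_eq_zero] at this
    exact this
  have h2 : fgaMap F pr z = 0 := (mul_eq_zero.1 h1).resolve_left (xvar_ne_zero F hprl)
  have h3 : fgaMap F (AddMonoidHom.snd ℤ K) (fgaMap F p z) = 0 := by
    rw [fgaMap_fgaMap]
    exact h2
  have h4 := map_dvd (fgaMap F q) (gamma_dvd F h3)
  rwa [fgaMap_fgaMap, hqp, fgaMap_id, fgaMap_xvar, hq, one_smul, ZeroMemClass.coe_zero,
    add_zero] at h4

end CharZero

end Divisibility

/-! ### Symmetric two-cocycles of binomial type -/

section Cocycle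

/-- The relations between the coefficients in degree `n` of a formal group law, up to
decomposable elements. -/
structure IsBinomialCocycle {A : Type*} [AddCommGroup A] (n : ℕ) (γ : ℕ → A) : Prop where
  symm : ∀ i, 0 < i → i < n → γ (n - i) = γ i
  rel : ∀ i j k, 0 < i → 0 < j → 0 < k → i + j + k = n →
    ((i + j).choose i : ℤ) • γ (i + j) = ((j + k).choose j : ℤ) • γ i

variable {A : Type*} [AddCommGroup A] {n : ℕ} {γ : ℕ → A}

/-- A consequence of Lucas' theorem: modulo `p`, the binomial coefficient `u.choose (p ^ v)` is the
`v`-th digit of `u` in base `p`. -/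
theorem choose_pow_modEq (p : ℕ) [Fact p.Prime] (u v : ℕ) :
    u.choose (p ^ v) ≡ u / p ^ v [MOD p] := by
  induction v generalizing u with
  | zero => simp [Nat.ModEq.refl]
  | succ v ih =>
    have h := Choose.choose_modEq_choose_mod_mul_choose_div_nat (n := u) (k := p ^ (v + 1)) (p := p)
    have hp := (Fact.out : p.Prime).pos
    rw [pow_succ, Nat.mul_mod_left, Nat.choose_zero_right, one_mul, Nat.mul_div_cancel _ hp] at h
    rw [pow_succ]
    refine h.trans ((ih (u / p)).trans ?_)
    rw [Nat.div_div_eq_div_mul, mul_comm]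

/-- `γ i` is a multiple of `γ m` after localization at the prime `p`. -/
def IsLocalMultiple (γ : ℕ → A) (p i m : ℕ) : Prop :=
  ∃ q r : ℤ, ¬ (p : ℤ) ∣ q ∧ q • γ i = r • γ m

theorem IsLocalMultiple.trans {p i m l : ℕ} [hp : Fact p.Prime] (h1 : IsLocalMultiple γ p i m)
    (h2 : IsLocalMultiple γ p m l) : IsLocalMultiple γ p i l := by
  obtain ⟨q, r, hq, h⟩ := h1
  obtain ⟨q', r', hq', h'⟩ := h2
  refine ⟨q' * q, r * r', fun h => ((Nat.prime_iff_prime_int.1 hp.out).dvd_or_dvd h).elim hq' hq, ?_⟩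
  rw [mul_smul, h, smul_comm, h', mul_smul]

theorem IsLocalMultiple.of_eq {p i m : ℕ} [hp : Fact p.Prime] (h : γ i = γ m) :
    IsLocalMultiple γ p i m :=
  ⟨1, 1, fun h => hp.out.one_lt.ne' (by
    have := Int.natCast_dvd_natCast.1 (by exact_mod_cast h : (p : ℤ) ∣ (1 : ℕ))
    exact Nat.dvd_one.1 this), by rw [h]⟩

namespace IsBinomialCocycle

variable (h : IsBinomialCocycle n γ)
include h

/-- A nonzero digit of `u` in base `p` makes `γ u` a local multiple of `γ (p ^ v)`. -/
theorem isLocalMultiple_pow {p : ℕ} [hp : Fact p.Prime] {u v : ℕ} (hu : u < n)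
    (hv : ¬ p ∣ u / p ^ v) : IsLocalMultiple γ p u (p ^ v) := by
  have hpv : 0 < p ^ v := pow_pos hp.out.pos v
  have hle : p ^ v ≤ u := by
    by_contra hlt
    rw [Nat.div_eq_of_lt (not_le.1 hlt)] at hv
    exact hv (dvd_zero p)
  obtain hlt | heq := hle.lt_or_eq
  · refine ⟨u.choose (p ^ v), ((u - p ^ v) + (n - u)).choose (u - p ^ v), ?_, ?_⟩
    · rw [Int.natCast_dvd_natCast]
      intro hd
      exact hv ((Nat.modEq_zero_iff_dvd.1
        ((choose_pow_modEq p u v).symm.trans (Nat.modEq_zero_iff_dvd.2 hd))))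
    · have := h.rel (p ^ v) (u - p ^ v) (n - u) hpv (by lia) (by lia) (by lia)
      rwa [Nat.add_sub_cancel' hle] at this
  · exact .of_eq (by rw [heq])

theorem isLocalMultiple_of_symm {p i m : ℕ} [Fact p.Prime] (h0 : 0 < i) (hn : i < n)
    (hi : IsLocalMultiple γ p (n - i) m) : IsLocalMultiple γ p i m :=
  IsLocalMultiple.trans (.of_eq (h.symm i h0 hn).symm) hi

omit h in
/-- The lowest nonzero digit of `r` in base `p`. -/
theorem exists_digit {p r : ℕ} (hp : 1 < p) (hr : 0 < r) :
    ∃ w, p ^ w ≤ r ∧ ¬ p ∣ r / p ^ w :=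
  ⟨padicValNat p r, Nat.le_of_dvd hr pow_padicValNat_dvd, fun hd => by
    have h1 : p ^ (padicValNat p r + 1) ∣ r := by
      obtain ⟨k, hk⟩ := hd
      refine ⟨k, ?_⟩
      rw [pow_succ, mul_assoc, ← hk, Nat.mul_div_cancel' pow_padicValNat_dvd]
    exact (padicValNat_dvd_iff_le_of_ne_one hp.ne' hr.ne').1 h1 |>.not_gt (Nat.lt_succ_self _)⟩

/-- Locally at each prime, all `γ i` are multiples of a single one. -/
theorem exists_isLocalMultiple (p : ℕ) [hp : Fact p.Prime] :
    ∃ m, ∀ i, 0 < i → i < n → IsLocalMultiple γ p i m := by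
  by_cases hn : n = 0
  · exact ⟨0, fun i _ hi => by lia⟩
  have h1 := hp.out.one_lt
  obtain ⟨s, hs⟩ : ∃ s, s = Nat.log p n := ⟨_, rfl⟩
  have hs1 : p ^ s ≤ n := hs ▸ Nat.pow_log_le_self p hn
  have hs2 : n < p ^ (s + 1) := hs ▸ Nat.lt_pow_succ_log_self h1 n
  have hpos : ∀ v, 0 < p ^ v := fun v => pow_pos hp.out.pos v
  -- it suffices to treat powers of `p`
  suffices ∃ m, ∀ v, p ^ v < n → IsLocalMultiple γ p (p ^ v) m by
    obtain ⟨m, hm⟩ := this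
    refine ⟨m, fun i h0 hi => ?_⟩
    obtain ⟨w, hw, hd⟩ := exists_digit h1 h0
    exact (h.isLocalMultiple_pow hi hd).trans (hm w (hw.trans_lt hi))
  obtain hlt | heq := hs1.lt_or_eq
  · have htop : ∀ u, p ^ s ≤ u → u < n → IsLocalMultiple γ p u (p ^ s) := fun u hu hun =>
      h.isLocalMultiple_pow hun fun hd => by
        have h2 : u / p ^ s < p := by
          rw [Nat.div_lt_iff_lt_mul (hpos s), ← pow_succ']
          exact hun.trans hs2
        exact (Nat.le_of_dvd (Nat.div_pos hu (hpos s)) hd).not_gt h2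
    have hgood : ∀ v, p ^ v < n → p ^ s ≤ n - p ^ v → IsLocalMultiple γ p (p ^ v) (p ^ s) :=
      fun v hv hle => h.isLocalMultiple_of_symm (hpos v) hv
        (htop _ hle (Nat.sub_lt (by lia) (hpos v)))
    refine ⟨p ^ s, fun v hv => ?_⟩
    by_cases hle : p ^ s ≤ n - p ^ v
    · exact hgood v hv hle
    by_cases hvs : p ^ s ≤ p ^ v
    · exact htop _ hvs hv
    -- the lower digits of `n - p ^ v` are those of `n - p ^ s`
    obtain ⟨w, hw, hd⟩ := exists_digit h1 (show 0 < n - p ^ s by lia)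
    have hwv : w < v := (Nat.pow_lt_pow_iff_right h1).1 (by lia)
    have hvs' : v < s := (Nat.pow_lt_pow_iff_right h1).1 (not_le.1 hvs)
    refine (h.isLocalMultiple_of_symm (hpos v) hv (h.isLocalMultiple_pow (v := w)
      (Nat.sub_lt (by lia) (hpos v)) ?_)).trans (hgood w (by lia) (by lia))
    obtain ⟨a, rfl⟩ := Nat.exists_eq_add_of_lt hwv
    obtain ⟨c, rfl⟩ := Nat.exists_eq_add_of_lt hvs'
    have e1 : n - p ^ (w + a + 1) + p ^ w * (p * p ^ a) = (n - p ^ (w + a + 1 + c + 1)) +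
        p ^ w * (p * p ^ (a + 1 + c)) := by
      have e2 : p ^ w * (p * p ^ a) = p ^ (w + a + 1) := by ring
      have e3 : p ^ w * (p * p ^ (a + 1 + c)) = p ^ (w + a + 1 + c + 1) := by ring
      rw [e2, e3]
      lia
    have e4 := congrArg (· / p ^ w) e1
    simp only [Nat.add_mul_div_left _ _ (hpos w)] at e4
    intro hd'
    have h5 := dvd_add hd' (Dvd.intro (p ^ a) rfl : p ∣ p * p ^ a)
    rw [e4] at h5
    exact hd ((Nat.dvd_add_left (Dvd.intro (p ^ (a + 1 + c)) rfl)).1 h5)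
  · refine ⟨p ^ (s - 1), fun v hv => ?_⟩
    have hvs : v < s := (Nat.pow_lt_pow_iff_right h1).1 (heq ▸ hv)
    obtain ⟨c, rfl⟩ := Nat.exists_eq_add_of_lt hvs
    refine h.isLocalMultiple_of_symm (hpos v) hv (h.isLocalMultiple_pow
      (Nat.sub_lt (by lia) (hpos v)) fun hd => ?_)
    have hle : p ^ v ≤ p ^ (v + c) := Nat.pow_le_pow_right hp.out.pos (by lia)
    have hn2 : n = p * p ^ (v + c) := by rw [← heq]; ring
    have hmul : 2 * p ^ (v + c) ≤ n := hn2 ▸ Nat.mul_le_mul_right _ hp.out.two_le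
    rw [Nat.add_sub_cancel] at hd
    have h3 : 0 < (n - p ^ v) / p ^ (v + c) := Nat.div_pos (by lia) (hpos _)
    have h4 : (n - p ^ v) / p ^ (v + c) < p := by
      rw [Nat.div_lt_iff_lt_mul (hpos _), ← hn2]
      exact Nat.sub_lt (by lia) (hpos v)
    exact (Nat.le_of_dvd h3 hd).not_gt h4

end IsBinomialCocycle

/-- The greatest common divisor `d` of the binomial coefficients `n.choose i` with `0 < i < n`, the
quotients `β i`, and the coefficients of a Bézout relation between the latter. -/
theorem exists_choose_bezout {n : ℕ} (hn : 2 ≤ n) : ∃ (d : ℤ) (β c : ℕ → ℤ), d ≠ 0 ∧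
    (∀ i, 0 < i → i < n → (n.choose i : ℤ) = β i * d) ∧
    ∑ i ∈ Finset.Ioo 0 n, c i * β i = 1 := by
  set d := (Finset.Ioo 0 n).gcd fun i => (n.choose i : ℤ) with hd
  obtain ⟨c, hc⟩ := Finset.gcd_eq_sum_mul (Finset.Ioo 0 n) (fun i => (n.choose i : ℤ))
  have hdvd : ∀ i, 0 < i → i < n → d ∣ (n.choose i : ℤ) := fun i h0 h1 =>
    Finset.gcd_dvd (Finset.mem_Ioo.2 ⟨h0, h1⟩)
  have hd0 : d ≠ 0 := by
    intro h
    have := hdvd 1 one_pos (by lia)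
    rw [h, zero_dvd_iff, Nat.choose_one_right] at this
    lia
  refine ⟨d, fun i => (n.choose i : ℤ) / d, c, hd0, fun i h0 h1 =>
    (Int.ediv_mul_cancel (hdvd i h0 h1)).symm, ?_⟩
  apply mul_right_cancel₀ hd0
  rw [Finset.sum_mul, one_mul]
  conv_rhs => rw [hd, hc]
  refine Finset.sum_congr rfl fun i hi => ?_
  obtain ⟨h0, h1⟩ := Finset.mem_Ioo.1 hi
  rw [mul_assoc, Int.ediv_mul_cancel (hdvd i h0 h1), mul_comm]

theorem isBinomialCocycle_of_choose_eq {d : ℤ} (hd : d ≠ 0) {β : ℕ → ℤ}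
    (hβ : ∀ i, 0 < i → i < n → (n.choose i : ℤ) = β i * d) : IsBinomialCocycle n β where
  symm i h0 h1 := by
    apply mul_right_cancel₀ hd
    rw [← hβ i h0 h1, ← hβ (n - i) (by lia) (by lia), Nat.choose_symm h1.le]
  rel i j k hi hj hk hn := by
    apply mul_right_cancel₀ hd
    rw [smul_eq_mul, smul_eq_mul, mul_assoc, mul_assoc, ← hβ i hi (by lia),
      ← hβ (i + j) (by lia) (by lia)]
    have := Nat.choose_mul (n := n) (k := i + j) (s := i) (by lia)
    rw [show n - i = j + k by lia, Nat.add_sub_cancel_left] at this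
    rw [mul_comm, mul_comm ((j + k).choose j : ℤ)]
    exact_mod_cast this

/-- **Lazard's comparison lemma**, in terms of coefficients: every symmetric cocycle of degree `n`
is a multiple of the universal one, whose coefficients are the `n.choose i / d`. -/
theorem IsBinomialCocycle.eq_smul_sum (h : IsBinomialCocycle n γ) {d : ℤ} {β c : ℕ → ℤ}
    (hd : d ≠ 0) (hβ : ∀ i, 0 < i → i < n → (n.choose i : ℤ) = β i * d)
    (hc : ∑ i ∈ Finset.Ioo 0 n, c i * β i = 1) {i : ℕ} (h0 : 0 < i) (hi : i < n) :
    γ i = β i • ∑ l ∈ Finset.Ioo 0 n, c l • γ l := by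
  have hβ' := isBinomialCocycle_of_choose_eq hd hβ
  have hprod : IsBinomialCocycle n fun i => (γ i, β i) :=
    ⟨fun i h0 h1 => Prod.ext (h.symm i h0 h1) (hβ'.symm i h0 h1), fun i j k hi hj hk hn =>
      Prod.ext (h.rel i j k hi hj hk hn) (hβ'.rel i j k hi hj hk hn)⟩
  -- `γ` and `β` are proportional, as they are so locally at each prime
  have hzero : ∀ l, 0 < l → l < n → β l • γ i = β i • γ l := by
    intro l hl0 hl
    rw [← sub_eq_zero, ← AddMonoid.addOrderOf_eq_one_iff]
    by_contra hne
    obtain ⟨p, hp, hpd⟩ := Nat.exists_prime_and_dvd hne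
    have := Fact.mk hp
    obtain ⟨m, hm⟩ := hprod.exists_isLocalMultiple p
    obtain ⟨q, r, hq, e⟩ := hm i h0 hi
    obtain ⟨q', r', hq', e'⟩ := hm l hl0 hl
    have e1 : q • γ i = r • γ m := congrArg Prod.fst e
    have e2 : q * β i = r * β m := congrArg Prod.snd e
    have e3 : q' • γ l = r' • γ m := congrArg Prod.fst e'
    have e4 : q' * β l = r' * β m := congrArg Prod.snd e'
    have h5 : (q * q') • (β l • γ i - β i • γ l) = 0 := by
      have h6 : (q * q') • (β l • γ i - β i • γ l) =
          (q' * β l) • (q • γ i) - (q * β i) • (q' • γ l) := by module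
      rw [h6, e1, e2, e3, e4]
      module
    have h7 : (p : ℤ) ∣ q * q' :=
      (Int.natCast_dvd_natCast.2 hpd).trans (addOrderOf_dvd_iff_zsmul_eq_zero.2 h5)
    exact ((Nat.prime_iff_prime_int.1 hp).dvd_or_dvd h7).elim hq hq'
  rw [Finset.smul_sum]
  conv_lhs => rw [← one_smul ℤ (γ i), ← hc, Finset.sum_smul]
  refine Finset.sum_congr rfl fun l hl => ?_
  obtain ⟨hl0, hl⟩ := Finset.mem_Ioo.1 hl
  rw [mul_smul, hzero l hl0 hl, smul_comm]

end Cocycle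

/-! ### Comparison of power series in low degrees -/

section LowDegree

variable {τ R : Type*} [CommRing R]

theorem coeff_eq_zero_of_mem_varsIdeal_pow {n : ℕ} {f : MvPowerSeries τ R}
    (hf : f ∈ varsIdeal τ R ^ n) {m : τ →₀ ℕ} (hm : m.degree < n) :
    MvPowerSeries.coeff m f = 0 := by
  suffices h : (n : ℕ∞) ≤ f.order from
    MvPowerSeries.coeff_of_lt_order (lt_of_lt_of_le (by exact_mod_cast hm) h)
  clear hm
  induction n generalizing f with
  | zero => exact bot_le
  | succ n ih =>
    rw [pow_succ] at hf
    induction hf using Submodule.mul_induction_on' with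
    | mem_mul_mem g hg h hh =>
      refine le_trans ?_ MvPowerSeries.le_order_mul
      push_cast
      refine add_le_add (ih hg) (MvPowerSeries.one_le_order_iff_constCoeff_eq_zero.2 ?_)
      refine Submodule.span_induction (p := fun x _ => MvPowerSeries.constantCoeff x = 0) ?_
        (map_zero _) (fun _ _ _ _ hx hy => by rw [map_add, hx, hy, add_zero])
        (fun a x _ hx => by rw [smul_eq_mul, map_mul, hx, mul_zero]) hh
      rintro _ ⟨i, rfl⟩
      exact MvPowerSeries.constantCoeff_X i
    | add x _ y _ hx hy => exact le_trans (le_min hx hy) MvPowerSeries.min_order_le_add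

variable [Finite τ] {B : Type*} [CommRing B] [Algebra R B] {N : Ideal B} {φ ψ : MvPowerSeries τ R →ₐ[R] B}

theorem map_sub_map_mem {J : Ideal B} {k : ℕ} (hJ : N ^ k ≤ J)
    (hφ : ∀ i, φ (MvPowerSeries.X i) ∈ N)
    (h : ∀ i, φ (MvPowerSeries.X i) - ψ (MvPowerSeries.X i) ∈ J) (f : MvPowerSeries τ R) :
    φ f - ψ f ∈ J := by
  have hN : (N.map (Ideal.Quotient.mk J)) ^ k = ⊥ := by
    rw [← Ideal.map_pow, eq_bot_iff, Ideal.map_le_iff_le_comap]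
    intro x hx
    rw [Ideal.mem_comap, Ideal.mem_bot]
    exact Ideal.Quotient.eq_zero_iff_mem.2 (hJ hx)
  have := isHausdorff_of_pow_eq_bot hN
  have h2 := mvPowerSeries_algHom_ext (N.map (Ideal.Quotient.mk J))
    (φ := (Ideal.Quotient.mkₐ R J).comp φ) (ψ := (Ideal.Quotient.mkₐ R J).comp ψ)
    (fun i => Ideal.Quotient.eq.2 (h i)) (fun i => Ideal.mem_map_of_mem _ (hφ i))
  exact Ideal.Quotient.eq.1 (DFunLike.congr_fun h2 f)

/-- Moving the arguments of a power series of order `n` by elements of `N ^ (k + 1)` changes its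
value by an element of `N ^ (n + k)`. -/
theorem map_sub_map_mem_pow {n k : ℕ} (hφ : ∀ i, φ (MvPowerSeries.X i) ∈ N)
    (hψ : ∀ i, ψ (MvPowerSeries.X i) ∈ N)
    (h : ∀ i, φ (MvPowerSeries.X i) - ψ (MvPowerSeries.X i) ∈ N ^ (k + 1))
    {f : MvPowerSeries τ R} (hf : f ∈ varsIdeal τ R ^ n) : φ f - ψ f ∈ N ^ (n + k) := by
  induction n generalizing f with
  | zero =>
    rw [Nat.zero_add]
    exact map_sub_map_mem le_rfl hφ (fun i => Ideal.pow_le_pow_right (Nat.le_succ k) (h i)) f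
  | succ n ih =>
    rw [pow_succ] at hf
    induction hf using Submodule.mul_induction_on' with
    | mem_mul_mem x hx y hy =>
      have e : φ (x * y) - ψ (x * y) = (φ x - ψ x) * φ y + ψ x * (φ y - ψ y) := by
        rw [map_mul, map_mul]; ring
      rw [e]
      have h1 : φ y ∈ N := by
        have := map_mem_pow_of_mem (φ := (φ : MvPowerSeries τ R →+* B)) hφ (n := 1)
          (by rwa [pow_one])
        rwa [pow_one] at this
      have h2 : ψ x ∈ N ^ n := map_mem_pow_of_mem (φ := (ψ : MvPowerSeries τ R →+* B)) hψ hx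
      refine add_mem ?_ ?_
      · rw [show n + 1 + k = n + k + 1 by ring, pow_succ]
        exact Ideal.mul_mem_mul (ih hx) h1
      · rw [show n + 1 + k = n + (k + 1) by ring, pow_add]
        exact Ideal.mul_mem_mul h2 (map_sub_map_mem le_rfl hφ h y)
    | add x _ y _ hx hy =>
      rw [map_add, map_add, add_sub_add_comm]
      exact add_mem hx hy

end LowDegree

section Perturbation

variable {ρ R : Type*} [CommRing R]

theorem hasSubst_vec {f g : MvPowerSeries ρ R} (hf : MvPowerSeries.constantCoeff f = 0)
    (hg : MvPowerSeries.constantCoeff g = 0) : MvPowerSeries.HasSubst ![f, g] :=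
  MvPowerSeries.hasSubst_of_constantCoeff_zero (constantCoeff_vec hf hg)

theorem constantCoeff_subst_eq_zero {f : MvPowerSeries (Fin 2) R}
    (h : MvPowerSeries.constantCoeff f = 0) {u v : MvPowerSeries ρ R}
    (hu : MvPowerSeries.constantCoeff u = 0) (hv : MvPowerSeries.constantCoeff v = 0) :
    MvPowerSeries.constantCoeff (f.subst ![u, v]) = 0 :=
  MvPowerSeries.constantCoeff_subst_eq_zero (hasSubst_vec hu hv) (constantCoeff_vec hu hv) h

variable [Finite ρ]

theorem subst_mem_varsIdeal_pow {n : ℕ} {f : MvPowerSeries (Fin 2) R}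
    (hf : f ∈ varsIdeal (Fin 2) R ^ n) {u v : MvPowerSeries ρ R}
    (hu : MvPowerSeries.constantCoeff u = 0) (hv : MvPowerSeries.constantCoeff v = 0) :
    f.subst ![u, v] ∈ varsIdeal ρ R ^ n := by
  have hs := hasSubst_vec hu hv
  let φ : MvPowerSeries (Fin 2) R →ₐ[R] MvPowerSeries ρ R := MvPowerSeries.substAlgHom hs
  have hφ : ∀ g, φ g = g.subst ![u, v] := MvPowerSeries.substAlgHom_apply hs
  rw [← hφ]
  refine map_mem_pow_of_mem (φ := (φ : MvPowerSeries (Fin 2) R →+* MvPowerSeries ρ R))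
    (fun i => ?_) hf
  rw [RingHom.coe_coe, hφ, MvPowerSeries.subst_X hs]
  exact mem_varsIdeal_of_constantCoeff (constantCoeff_vec hu hv i)

/-- Changing the arguments in degrees above `k` changes the values of a series of order `n` in
degrees at least `n + k` only. -/
theorem subst_sub_subst_mem_pow {n k : ℕ} {u v u' v' : MvPowerSeries ρ R}
    (hu : MvPowerSeries.constantCoeff u = 0) (hv : MvPowerSeries.constantCoeff v = 0)
    (hu' : MvPowerSeries.constantCoeff u' = 0) (hv' : MvPowerSeries.constantCoeff v' = 0)
    (h1 : u - u' ∈ varsIdeal ρ R ^ (k + 1)) (h2 : v - v' ∈ varsIdeal ρ R ^ (k + 1))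
    {f : MvPowerSeries (Fin 2) R} (hf : f ∈ varsIdeal (Fin 2) R ^ n) :
    f.subst ![u, v] - f.subst ![u', v'] ∈ varsIdeal ρ R ^ (n + k) := by
  have hs := hasSubst_vec hu hv
  have hs' := hasSubst_vec hu' hv'
  rw [← MvPowerSeries.substAlgHom_apply hs, ← MvPowerSeries.substAlgHom_apply hs']
  refine map_sub_map_mem_pow (fun i => ?_) (fun i => ?_) (fun i => ?_) hf
  · rw [MvPowerSeries.substAlgHom_X]
    exact mem_varsIdeal_of_constantCoeff (constantCoeff_vec hu hv i)
  · rw [MvPowerSeries.substAlgHom_X]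
    exact mem_varsIdeal_of_constantCoeff (constantCoeff_vec hu' hv' i)
  · rw [MvPowerSeries.substAlgHom_X, MvPowerSeries.substAlgHom_X]
    fin_cases i
    exacts [h1, h2]

/-- First-order perturbation: up to terms of degree `> n`, changing `f = X₀ + X₁ + ⋯` by `K` and
its arguments by `u - u'` and `v - v'`, all of order `n`, changes the value by the sum of these
terms, and `K` may be evaluated at the linear parts `s`, `t` of the arguments. -/
theorem subst_perturbation {n : ℕ} (hn : 2 ≤ n) {u v u' v' s t : MvPowerSeries ρ R}
    (hu : MvPowerSeries.constantCoeff u = 0) (hv : MvPowerSeries.constantCoeff v = 0)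
    (hu' : MvPowerSeries.constantCoeff u' = 0) (hv' : MvPowerSeries.constantCoeff v' = 0)
    (hs : MvPowerSeries.constantCoeff s = 0) (ht : MvPowerSeries.constantCoeff t = 0)
    (h1 : u - u' ∈ varsIdeal ρ R ^ n) (h2 : v - v' ∈ varsIdeal ρ R ^ n)
    (h3 : u' - s ∈ varsIdeal ρ R ^ 2) (h4 : v' - t ∈ varsIdeal ρ R ^ 2)
    {f f' K : MvPowerSeries (Fin 2) R} (hf : f - .X 0 - .X 1 ∈ varsIdeal (Fin 2) R ^ 2)
    (hK : f - f' = K) (hK' : K ∈ varsIdeal (Fin 2) R ^ n) :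
    f.subst ![u, v] - f'.subst ![u', v'] - (u - u') - (v - v') - K.subst ![s, t] ∈
      varsIdeal ρ R ^ (n + 1) := by
  obtain ⟨k, rfl⟩ := Nat.exists_eq_add_of_le' (show 1 ≤ n by lia)
  have e1 := subst_sub_subst_mem_pow hu hv hu' hv' h1 h2 hf
  have e2 := subst_sub_subst_mem_pow hu' hv' hs ht h3 h4 hK'
  have hS := hasSubst_vec hu hv
  have hS' := hasSubst_vec hu' hv'
  rw [MvPowerSeries.subst_sub hS, MvPowerSeries.subst_sub hS, MvPowerSeries.subst_X hS,
    MvPowerSeries.subst_X hS, MvPowerSeries.subst_sub hS', MvPowerSeries.subst_sub hS',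
    MvPowerSeries.subst_X hS', MvPowerSeries.subst_X hS'] at e1
  have e3 : f' = f - K := by rw [← hK, sub_sub_cancel]
  rw [e3, MvPowerSeries.subst_sub hS']
  rw [show 2 + k = k + 1 + 1 by ring] at e1
  convert add_mem e1 e2 using 1
  simp only [Matrix.cons_val_zero, Matrix.cons_val_one]
  ring

end Perturbation

/-! ### Coefficients of substitutions -/

section Coefficients

variable {R : Type*} [CommRing R]

/-- The exponent of the monomial `X₀ ^ a X₁ ^ b`. -/
noncomputable def pairExp (a b : ℕ) : Fin 2 →₀ ℕ := Finsupp.single 0 a + Finsupp.single 1 b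

/-- The exponent of the monomial `X₀ ^ i X₁ ^ j X₂ ^ k`. -/
noncomputable def tripleExp (i j k : ℕ) : Fin 3 →₀ ℕ :=
  Finsupp.single 0 i + Finsupp.single 1 j + Finsupp.single 2 k

theorem degree_pairExp (a b : ℕ) : (pairExp a b).degree = a + b := by
  simp [pairExp]

theorem degree_tripleExp (i j k : ℕ) : (tripleExp i j k).degree = i + j + k := by
  simp [tripleExp]

theorem eq_pairExp (m : Fin 2 →₀ ℕ) : m = pairExp (m 0) (m 1) := by
  ext i
  fin_cases i <;> simp [pairExp]

theorem pairExp_inj {a b c d : ℕ} : pairExp a b = pairExp c d ↔ a = c ∧ b = d := by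
  refine ⟨fun h => ⟨?_, ?_⟩, fun ⟨h1, h2⟩ => h1 ▸ h2 ▸ rfl⟩
  · simpa [pairExp] using DFunLike.congr_fun h 0
  · simpa [pairExp] using DFunLike.congr_fun h 1

theorem tripleExp_inj {i j k i' j' k' : ℕ} :
    tripleExp i j k = tripleExp i' j' k' ↔ i = i' ∧ j = j' ∧ k = k' := by
  refine ⟨fun h => ⟨?_, ?_, ?_⟩, fun ⟨h1, h2, h3⟩ => h1 ▸ h2 ▸ h3 ▸ rfl⟩
  · simpa [tripleExp] using DFunLike.congr_fun h 0
  · simpa [tripleExp] using DFunLike.congr_fun h 1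
  · simpa [tripleExp] using DFunLike.congr_fun h 2

theorem coeff_tripleExp_monomial (i j k i' j' k' : ℕ) :
    MvPowerSeries.coeff (tripleExp i j k)
      (.X 0 ^ i' * .X 1 ^ j' * .X 2 ^ k' : MvPowerSeries (Fin 3) R) =
      if i = i' ∧ j = j' ∧ k = k' then 1 else 0 := by
  classical
  rw [MvPowerSeries.X_pow_eq, MvPowerSeries.X_pow_eq, MvPowerSeries.X_pow_eq,
    MvPowerSeries.monomial_mul_monomial, MvPowerSeries.monomial_mul_monomial,
    MvPowerSeries.coeff_monomial, one_mul, one_mul]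
  exact if_congr tripleExp_inj rfl rfl

theorem coeff_pairExp_monomial (a b a' b' : ℕ) :
    MvPowerSeries.coeff (pairExp a b) (.X 0 ^ a' * .X 1 ^ b' : MvPowerSeries (Fin 2) R) =
      if a = a' ∧ b = b' then 1 else 0 := by
  classical
  rw [MvPowerSeries.X_pow_eq, MvPowerSeries.X_pow_eq,
    MvPowerSeries.monomial_mul_monomial, MvPowerSeries.coeff_monomial, one_mul]
  exact if_congr pairExp_inj rfl rfl

theorem coeff_tripleExp_add_pow_left (i j k a b : ℕ) :
    MvPowerSeries.coeff (tripleExp i j k)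
      ((.X 0 + .X 1) ^ a * .X 2 ^ b : MvPowerSeries (Fin 3) R) =
      if a = i + j ∧ b = k then ((i + j).choose i : R) else 0 := by
  have hterm : ∀ m, MvPowerSeries.coeff (tripleExp i j k)
      (.X 0 ^ m * .X 1 ^ (a - m) * (a.choose m) * .X 2 ^ b : MvPowerSeries (Fin 3) R) =
      if i = m ∧ j = a - m ∧ k = b then (a.choose m : R) else 0 := fun m => by
    have : (.X 0 ^ m * .X 1 ^ (a - m) * (a.choose m) * .X 2 ^ b : MvPowerSeries (Fin 3) R) =
        (a.choose m) • (.X 0 ^ m * .X 1 ^ (a - m) * .X 2 ^ b) := by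
      rw [nsmul_eq_mul]; ring
    rw [this, map_nsmul, coeff_tripleExp_monomial, nsmul_eq_mul, mul_ite, mul_one, mul_zero]
  rw [add_pow, Finset.sum_mul, map_sum, Finset.sum_congr rfl fun m _ => hterm m]
  split_ifs with h
  · obtain ⟨rfl, rfl⟩ := h
    rw [Finset.sum_eq_single i]
    · simp
    · intro m _ hm
      rw [if_neg fun h => hm h.1.symm]
    · intro hi
      simp at hi
  · refine Finset.sum_eq_zero fun m hm => if_neg ?_
    rw [Finset.mem_range] at hm
    lia

theorem coeff_tripleExp_add_pow_right (i j k a b : ℕ) :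
    MvPowerSeries.coeff (tripleExp i j k)
      (.X 0 ^ a * (.X 1 + .X 2) ^ b : MvPowerSeries (Fin 3) R) =
      if a = i ∧ b = j + k then ((j + k).choose j : R) else 0 := by
  have hterm : ∀ m, MvPowerSeries.coeff (tripleExp i j k)
      (.X 0 ^ a * (.X 1 ^ m * .X 2 ^ (b - m) * (b.choose m)) : MvPowerSeries (Fin 3) R) =
      if i = a ∧ j = m ∧ k = b - m then (b.choose m : R) else 0 := fun m => by
    have : (.X 0 ^ a * (.X 1 ^ m * .X 2 ^ (b - m) * (b.choose m)) : MvPowerSeries (Fin 3) R) =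
        (b.choose m) • (.X 0 ^ a * .X 1 ^ m * .X 2 ^ (b - m)) := by
      rw [nsmul_eq_mul]; ring
    rw [this, map_nsmul, coeff_tripleExp_monomial, nsmul_eq_mul, mul_ite, mul_one, mul_zero]
  rw [add_pow, Finset.mul_sum, map_sum, Finset.sum_congr rfl fun m _ => hterm m]
  split_ifs with h
  · obtain ⟨rfl, rfl⟩ := h
    rw [Finset.sum_eq_single j]
    · simp
    · intro m _ hm
      rw [if_neg fun h => hm h.2.1.symm]
    · intro hi
      simp at hi
  · refine Finset.sum_eq_zero fun m hm => if_neg ?_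
    rw [Finset.mem_range] at hm
    lia

theorem coeff_subst_vec {τ : Type*} {u v : MvPowerSeries τ R}
    (h : MvPowerSeries.HasSubst ![u, v]) (f : MvPowerSeries (Fin 2) R) (e : τ →₀ ℕ) :
    MvPowerSeries.coeff e (f.subst ![u, v]) =
      ∑ᶠ d : Fin 2 →₀ ℕ, MvPowerSeries.coeff d f * MvPowerSeries.coeff e (u ^ d 0 * v ^ d 1) := by
  rw [MvPowerSeries.coeff_subst h]
  refine finsum_congr fun d => ?_
  rw [smul_eq_mul, Finsupp.prod_fintype _ _ fun i => pow_zero _, Fin.prod_univ_two]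
  rfl

theorem coeff_subst_vec_eq_single {τ : Type*} {u v : MvPowerSeries τ R}
    (h : MvPowerSeries.HasSubst ![u, v]) (f : MvPowerSeries (Fin 2) R) (e : τ →₀ ℕ) {a b : ℕ}
    (hab : ∀ a' b', ¬ (a' = a ∧ b' = b) → MvPowerSeries.coeff e (u ^ a' * v ^ b') = 0) :
    MvPowerSeries.coeff e (f.subst ![u, v]) =
      MvPowerSeries.coeff (pairExp a b) f * MvPowerSeries.coeff e (u ^ a * v ^ b) := by
  rw [coeff_subst_vec h, finsum_eq_single _ (pairExp a b)]
  · simp [pairExp]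
  · intro d hd
    rw [hab, mul_zero]
    rintro ⟨rfl, rfl⟩
    exact hd (eq_pairExp d)

theorem coeff_subst_vec_eq_zero {τ : Type*} {u v : MvPowerSeries τ R}
    (h : MvPowerSeries.HasSubst ![u, v]) (f : MvPowerSeries (Fin 2) R) (e : τ →₀ ℕ)
    (hab : ∀ a' b', MvPowerSeries.coeff e (u ^ a' * v ^ b') = 0) :
    MvPowerSeries.coeff e (f.subst ![u, v]) = 0 := by
  rw [coeff_subst_vec h, finsum_eq_zero_of_forall_eq_zero]
  intro d
  rw [hab, mul_zero]

end Coefficients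

/-! ### The coefficients of a formal group law modulo decomposables -/

section Lazard

open MvPowerSeries (C X coeff constantCoeff)

theorem mem_varsIdeal_sq_of_formalGroup {R : Type*} [CommRing R] (F : FormalGroup R) :
    F.toPowerSeries - X 0 - X 1 ∈ varsIdeal (Fin 2) R ^ 2 := by
  obtain ⟨G, hG⟩ := exists_eq_add_mul F
  rw [hG, show X 0 + X 1 + X 0 * X 1 * G - X 0 - X 1 = X 0 * X 1 * G by ring, pow_two]
  exact Ideal.mul_mem_right _ _ (Ideal.mul_mem_mul (X_mem_varsIdeal 0) (X_mem_varsIdeal 1))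

theorem coeff_pairExp_comm {R : Type*} [CommRing R] (F : FormalGroup R) [F.IsComm] (a b : ℕ) :
    coeff (pairExp a b) F.toPowerSeries = coeff (pairExp b a) F.toPowerSeries := by
  conv_lhs => rw [FormalGroup.IsComm.comm (F := F)]
  have hX : ∀ i, constantCoeff (X i : MvPowerSeries (Fin 2) R) = 0 :=
    MvPowerSeries.constantCoeff_X
  rw [coeff_subst_vec_eq_single (hasSubst_vec (hX 1) (hX 0)) (a := b) (b := a) F.toPowerSeries
    (pairExp a b), mul_comm (X 1 ^ b), coeff_pairExp_monomial, if_pos ⟨rfl, rfl⟩, mul_one]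
  intro a' b' h
  rw [mul_comm, coeff_pairExp_monomial, if_neg fun h' => h ⟨h'.2.symm, h'.1.symm⟩]

theorem coeff_pairExp_zero {R : Type*} [CommRing R] (F : FormalGroup R) {n : ℕ} (hn : 2 ≤ n) :
    coeff (pairExp n 0) F.toPowerSeries = 0 ∧ coeff (pairExp 0 n) F.toPowerSeries = 0 := by
  obtain ⟨G, hG⟩ := exists_eq_add_mul F
  have h1 : ∀ a b, coeff (pairExp a b) (X 0 : MvPowerSeries (Fin 2) R) =
      if a = 1 ∧ b = 0 then 1 else 0 := fun a b => by
    rw [← coeff_pairExp_monomial, pow_one, pow_zero, mul_one]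
  have h2 : ∀ a b, coeff (pairExp a b) (X 1 : MvPowerSeries (Fin 2) R) =
      if a = 0 ∧ b = 1 then 1 else 0 := fun a b => by
    rw [← coeff_pairExp_monomial, pow_one, pow_zero, one_mul]
  rw [hG]
  simp only [map_add, h1, h2]
  have h3 : coeff (pairExp n 0) (X 0 * X 1 * G) = 0 :=
    (MvPowerSeries.X_dvd_iff (s := (1 : Fin 2))).1 ⟨X 0 * G, by ring⟩ _ (by simp [pairExp])
  have h4 : coeff (pairExp 0 n) (X 0 * X 1 * G) = 0 :=
    (MvPowerSeries.X_dvd_iff (s := (0 : Fin 2))).1 ⟨X 1 * G, by ring⟩ _ (by simp [pairExp])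
  rw [h3, h4]
  constructor <;> rw [if_neg (by lia), if_neg (by lia)] <;> simp

section Assoc

variable {R : Type*} [CommRing R] {n : ℕ} {f f' : MvPowerSeries (Fin 2) R}

theorem subst_X_sub_mem (hlin : f - X 0 - X 1 ∈ varsIdeal (Fin 2) R ^ 2) (p q : Fin 3) :
    f.subst ![X p, X q] - (X p + X q) ∈ varsIdeal (Fin 3) R ^ 2 := by
  have hX := MvPowerSeries.constantCoeff_X (σ := Fin 3) (R := R)
  have := subst_mem_varsIdeal_pow hlin (hX p) (hX q)
  have hS := hasSubst_vec (hX p) (hX q)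
  rw [MvPowerSeries.subst_sub hS, MvPowerSeries.subst_sub hS, MvPowerSeries.subst_X hS,
    MvPowerSeries.subst_X hS, sub_sub] at this
  exact this

variable (hn : 2 ≤ n) (hlin : f - X 0 - X 1 ∈ varsIdeal (Fin 2) R ^ 2)
  (h0 : constantCoeff f = 0) (h0' : constantCoeff f' = 0) (hK : f - f' ∈ varsIdeal (Fin 2) R ^ n)
include hn hlin h0 h0' hK

/-- When `f` and `f'` agree below degree `n`, the difference between `f(f(x, y), z)` and
`f'(f'(x, y), z)` is linear in `f - f'` up to terms of degree greater than `n`. -/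
theorem subst_left_sub_mem : f.subst ![f.subst ![X 0, X 1], X 2] -
    f'.subst ![f'.subst ![X 0, X 1], X 2] - (f - f').subst ![X 0, X 1] -
    (f - f').subst ![X 0 + X 1, X 2] ∈ varsIdeal (Fin 3) R ^ (n + 1) := by
  have hX := MvPowerSeries.constantCoeff_X (σ := Fin 3) (R := R)
  have hlin' : f' - X 0 - X 1 ∈ varsIdeal (Fin 2) R ^ 2 := by
    rw [show f' - X 0 - X 1 = (f - X 0 - X 1) - (f - f') by ring]
    exact sub_mem hlin (Ideal.pow_le_pow_right hn hK)
  have hin : f.subst ![X 0, X 1] - f'.subst ![X 0, X 1] =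
      ((f - f').subst ![X 0, X 1] : MvPowerSeries (Fin 3) R) := by
    rw [MvPowerSeries.subst_sub (hasSubst_vec (hX 0) (hX 1))]
  have e1 := subst_perturbation hn (constantCoeff_subst_eq_zero h0 (hX 0) (hX 1)) (hX 2)
    (constantCoeff_subst_eq_zero h0' (hX 0) (hX 1)) (hX 2)
    (s := X 0 + X 1) (by rw [map_add, hX, hX, add_zero]) (hX 2)
    (hin ▸ subst_mem_varsIdeal_pow hK (hX 0) (hX 1))
    (by rw [sub_self]; exact zero_mem _) (subst_X_sub_mem hlin' 0 1)
    (by rw [sub_self]; exact zero_mem _) hlin rfl hK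
  rwa [hin, sub_self, sub_zero] at e1

/-- The counterpart of `subst_left_sub_mem` for the other side of associativity. -/
theorem subst_right_sub_mem : f.subst ![X 0, f.subst ![X 1, X 2]] -
    f'.subst ![X 0, f'.subst ![X 1, X 2]] - (f - f').subst ![X 1, X 2] -
    (f - f').subst ![X 0, X 1 + X 2] ∈ varsIdeal (Fin 3) R ^ (n + 1) := by
  have hX := MvPowerSeries.constantCoeff_X (σ := Fin 3) (R := R)
  have hlin' : f' - X 0 - X 1 ∈ varsIdeal (Fin 2) R ^ 2 := by
    rw [show f' - X 0 - X 1 = (f - X 0 - X 1) - (f - f') by ring]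
    exact sub_mem hlin (Ideal.pow_le_pow_right hn hK)
  have hin : f.subst ![X 1, X 2] - f'.subst ![X 1, X 2] =
      ((f - f').subst ![X 1, X 2] : MvPowerSeries (Fin 3) R) := by
    rw [MvPowerSeries.subst_sub (hasSubst_vec (hX 1) (hX 2))]
  have e1 := subst_perturbation hn (hX 0) (constantCoeff_subst_eq_zero h0 (hX 1) (hX 2)) (hX 0)
    (constantCoeff_subst_eq_zero h0' (hX 1) (hX 2)) (hX 0)
    (t := X 1 + X 2) (by rw [map_add, hX, hX, add_zero]) (by rw [sub_self]; exact zero_mem _)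
    (hin ▸ subst_mem_varsIdeal_pow hK (hX 1) (hX 2)) (by rw [sub_self]; exact zero_mem _)
    (subst_X_sub_mem hlin' 1 2) hlin rfl hK
  rwa [hin, sub_self, sub_zero] at e1

omit hn hlin h0 h0' hK in
theorem coeff_tripleExp_subst_left (K : MvPowerSeries (Fin 2) R) (i j k : ℕ) :
    coeff (tripleExp i j k) (K.subst ![X 0 + X 1, X 2] : MvPowerSeries (Fin 3) R) =
      coeff (pairExp (i + j) k) K * ((i + j).choose i) := by
  have hX := MvPowerSeries.constantCoeff_X (σ := Fin 3) (R := R)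
  rw [coeff_subst_vec_eq_single
    (hasSubst_vec (by rw [map_add, hX, hX, add_zero]) (hX 2)) (a := i + j) (b := k),
    coeff_tripleExp_add_pow_left, if_pos ⟨rfl, rfl⟩]
  intro a' b' h
  rw [coeff_tripleExp_add_pow_left, if_neg h]

omit hn hlin h0 h0' hK in
theorem coeff_tripleExp_subst_right (K : MvPowerSeries (Fin 2) R) (i j k : ℕ) :
    coeff (tripleExp i j k) (K.subst ![X 0, X 1 + X 2] : MvPowerSeries (Fin 3) R) =
      coeff (pairExp i (j + k)) K * ((j + k).choose j) := by
  have hX := MvPowerSeries.constantCoeff_X (σ := Fin 3) (R := R)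
  rw [coeff_subst_vec_eq_single
    (hasSubst_vec (hX 0) (by rw [map_add, hX, hX, add_zero])) (a := i) (b := j + k),
    coeff_tripleExp_add_pow_right, if_pos ⟨rfl, rfl⟩]
  intro a' b' h
  rw [coeff_tripleExp_add_pow_right, if_neg h]

omit hn hlin h0 h0' hK in
theorem coeff_tripleExp_subst_fst (K : MvPowerSeries (Fin 2) R) {i j k : ℕ} (hk : 0 < k) :
    coeff (tripleExp i j k) (K.subst ![X 0, X 1] : MvPowerSeries (Fin 3) R) = 0 := by
  have hX := MvPowerSeries.constantCoeff_X (σ := Fin 3) (R := R)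
  refine coeff_subst_vec_eq_zero (hasSubst_vec (hX 0) (hX 1)) _ _ fun a' b' => ?_
  rw [show (X 0 ^ a' * X 1 ^ b' : MvPowerSeries (Fin 3) R) = X 0 ^ a' * X 1 ^ b' * X 2 ^ 0 by
    rw [pow_zero, mul_one], coeff_tripleExp_monomial, if_neg (by lia)]

omit hn hlin h0 h0' hK in
theorem coeff_tripleExp_subst_snd (K : MvPowerSeries (Fin 2) R) {i j k : ℕ} (hi : 0 < i) :
    coeff (tripleExp i j k) (K.subst ![X 1, X 2] : MvPowerSeries (Fin 3) R) = 0 := by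
  have hX := MvPowerSeries.constantCoeff_X (σ := Fin 3) (R := R)
  refine coeff_subst_vec_eq_zero (hasSubst_vec (hX 1) (hX 2)) _ _ fun a' b' => ?_
  rw [show (X 1 ^ a' * X 2 ^ b' : MvPowerSeries (Fin 3) R) = X 0 ^ 0 * X 1 ^ a' * X 2 ^ b' by
    rw [pow_zero, one_mul], coeff_tripleExp_monomial, if_neg (by lia)]

/-- The terms of degree `n` in the associativity of `f`; only the part `f'` of lower degree
contributes nonlinearly. -/
theorem coeff_pairExp_assoc (hassoc : f.subst ![f.subst ![X 0, X 1], X 2] =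
      (f.subst ![X 0, f.subst ![X 1, X 2]] : MvPowerSeries (Fin 3) R))
    {i j k : ℕ} (hi : 0 < i) (hk : 0 < k) (hijk : i + j + k = n) :
    coeff (pairExp (i + j) k) (f - f') * ((i + j).choose i) -
      coeff (pairExp i (j + k)) (f - f') * ((j + k).choose j) =
    coeff (tripleExp i j k) (f'.subst ![X 0, f'.subst ![X 1, X 2]]) -
      coeff (tripleExp i j k) (f'.subst ![f'.subst ![X 0, X 1], X 2]) := by
  have hdeg : (tripleExp i j k).degree < n + 1 := by rw [degree_tripleExp]; lia
  have c1 := coeff_eq_zero_of_mem_varsIdeal_pow (subst_left_sub_mem hn hlin h0 h0' hK) hdeg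
  have c2 := coeff_eq_zero_of_mem_varsIdeal_pow (subst_right_sub_mem hn hlin h0 h0' hK) hdeg
  rw [map_sub, map_sub, map_sub, coeff_tripleExp_subst_fst _ hk, coeff_tripleExp_subst_left] at c1
  rw [map_sub, map_sub, map_sub, coeff_tripleExp_subst_snd _ hi, coeff_tripleExp_subst_right] at c2
  rw [hassoc] at c1
  linear_combination c2 - c1

end Assoc

theorem map_subst_vec {τ A R : Type*} [CommRing A] [CommRing R] (φ : A →+* R)
    (f : MvPowerSeries (Fin 2) A) {u v : MvPowerSeries τ A}
    (hu : constantCoeff u = 0) (hv : constantCoeff v = 0) :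
    (f.subst ![u, v]).map φ = (f.map φ).subst ![u.map φ, v.map φ] := by
  rw [MvPowerSeries.map_subst (hasSubst_vec hu hv)]
  congr 1
  ext1 q
  fin_cases q <;> rfl

/-- In degree `n`, the coefficients of a commutative formal group law form a symmetric cocycle,
modulo any subring that contains the coefficients of lower degree. -/
theorem isBinomialCocycle_coeff {R : Type*} [CommRing R] (F : FormalGroup R) [F.IsComm]
    (A : Subring R) {n : ℕ} (hn : 2 ≤ n)
    (hA : ∀ m : Fin 2 →₀ ℕ, m.degree < n → coeff m F.toPowerSeries ∈ A) :
    IsBinomialCocycle n fun a =>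
      QuotientAddGroup.mk (s := A.toAddSubgroup) (coeff (pairExp a (n - a)) F.toPowerSeries) where
  symm i h0 h1 := by rw [Nat.sub_sub_self h1.le, coeff_pairExp_comm]
  rel i j k hi hj hk hijk := by
    classical
    -- the part of degree `< n`, a power series over `A`
    let fA : MvPowerSeries (Fin 2) A := fun m =>
      if h : m.degree < n then ⟨coeff m F.toPowerSeries, hA m h⟩ else 0
    have hfA : ∀ m, coeff m (fA.map A.subtype) =
        if m.degree < n then coeff m F.toPowerSeries else 0 := fun m => by
      rw [MvPowerSeries.coeff_map]
      change A.subtype (if h : m.degree < n then ⟨coeff m F.toPowerSeries, hA m h⟩ else 0) = _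
      split_ifs <;> rfl
    have hK : F.toPowerSeries - fA.map A.subtype ∈ varsIdeal (Fin 2) R ^ n :=
      mem_varsIdeal_pow fun m hm => by rw [map_sub, hfA, if_pos hm, sub_self]
    have hKc : ∀ a b, a + b = n → coeff (pairExp a b) (F.toPowerSeries - fA.map A.subtype) =
        coeff (pairExp a b) F.toPowerSeries := fun a b hab => by
      rw [map_sub, hfA, degree_pairExp, if_neg (by lia), sub_zero]
    have hf0' : constantCoeff (fA.map A.subtype) = 0 := by
      rw [← MvPowerSeries.coeff_zero_eq_constantCoeff_apply, hfA, if_pos (by simp; lia)]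
      exact F.zero_constantCoeff
    have hfA0 : constantCoeff fA = 0 := Subtype.val_injective hf0'
    have hX := MvPowerSeries.constantCoeff_X (σ := Fin 3) (R := A)
    have key := coeff_pairExp_assoc hn (mem_varsIdeal_sq_of_formalGroup F) F.zero_constantCoeff
      hf0' hK F.assoc hi hk hijk
    rw [hKc _ _ hijk, hKc _ _ (by lia)] at key
    -- the contributions of the lower degrees lie in `A`
    have m1 := map_subst_vec A.subtype fA (constantCoeff_subst_eq_zero hfA0 (hX 0) (hX 1)) (hX 2)
    have m2 := map_subst_vec A.subtype fA (hX 0) (constantCoeff_subst_eq_zero hfA0 (hX 1) (hX 2))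
    rw [map_subst_vec A.subtype fA (hX 0) (hX 1), MvPowerSeries.map_X, MvPowerSeries.map_X,
      MvPowerSeries.map_X] at m1
    rw [map_subst_vec A.subtype fA (hX 1) (hX 2), MvPowerSeries.map_X, MvPowerSeries.map_X,
      MvPowerSeries.map_X] at m2
    rw [← m1, ← m2, MvPowerSeries.coeff_map, MvPowerSeries.coeff_map] at key
    rw [← QuotientAddGroup.mk_zsmul, ← QuotientAddGroup.mk_zsmul, QuotientAddGroup.eq,
      show n - (i + j) = k by lia, show n - i = j + k by lia]
    change _ ∈ A
    rw [show (-(((i + j).choose i : ℤ) • coeff (pairExp (i + j) k) F.toPowerSeries) +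
      ((j + k).choose j : ℤ) • coeff (pairExp i (j + k)) F.toPowerSeries) =
      -(coeff (pairExp (i + j) k) F.toPowerSeries * ((i + j).choose i) -
      coeff (pairExp i (j + k)) F.toPowerSeries * ((j + k).choose j)) by
        simp only [zsmul_eq_mul, Int.cast_natCast]; ring, key]
    exact neg_mem (sub_mem (Subtype.coe_prop _) (Subtype.coe_prop _))

end Lazard

/-! ### The Lazard ring -/

section LazardRing

open MvPowerSeries (C X coeff constantCoeff)

/-- The polynomial ring with one indeterminate for each exponent of degree at least two. -/
abbrev GenericRing : Type := MvPolynomial {m : Fin 2 →₀ ℕ // 2 ≤ m.degree} ℤ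

/-- The power series `X₀ + X₁ + ⋯` whose coefficients of degree at least two are indeterminates. -/
noncomputable def genericSeries : MvPowerSeries (Fin 2) GenericRing := fun m =>
  if h : 2 ≤ m.degree then MvPolynomial.X ⟨m, h⟩ else if m.degree = 1 then 1 else 0

theorem coeff_genericSeries (m : Fin 2 →₀ ℕ) : coeff m genericSeries =
    if h : 2 ≤ m.degree then MvPolynomial.X ⟨m, h⟩ else if m.degree = 1 then 1 else 0 := rfl

/-- The difference of the two sides of the associativity law of a power series. -/
noncomputable def assocDefect {A : Type*} [CommRing A] (f : MvPowerSeries (Fin 2) A) :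
    MvPowerSeries (Fin 3) A :=
  f.subst ![f.subst ![X 0, X 1], X 2] - f.subst ![X 0, f.subst ![X 1, X 2]]

/-- The difference of the two sides of the commutativity law of a power series. -/
noncomputable def commDefect {A : Type*} [CommRing A] (f : MvPowerSeries (Fin 2) A) :
    MvPowerSeries (Fin 2) A := f - f.subst ![X 1, X 0]

theorem map_assocDefect {A R : Type*} [CommRing A] [CommRing R] (φ : A →+* R)
    {f : MvPowerSeries (Fin 2) A} (hf : constantCoeff f = 0) :
    (assocDefect f).map φ = assocDefect (f.map φ) := by
  have hX := MvPowerSeries.constantCoeff_X (σ := Fin 3) (R := A)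
  rw [assocDefect, map_sub,
    map_subst_vec φ f (constantCoeff_subst_eq_zero hf (hX 0) (hX 1)) (hX 2),
    map_subst_vec φ f (hX 0) (constantCoeff_subst_eq_zero hf (hX 1) (hX 2)),
    map_subst_vec φ f (hX 0) (hX 1), map_subst_vec φ f (hX 1) (hX 2), MvPowerSeries.map_X,
    MvPowerSeries.map_X, MvPowerSeries.map_X, assocDefect]

theorem map_commDefect {A R : Type*} [CommRing A] [CommRing R] (φ : A →+* R)
    (f : MvPowerSeries (Fin 2) A) : (commDefect f).map φ = commDefect (f.map φ) := by
  have hX := MvPowerSeries.constantCoeff_X (σ := Fin 2) (R := A)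
  rw [commDefect, map_sub, map_subst_vec φ f (hX 1) (hX 0), MvPowerSeries.map_X,
    MvPowerSeries.map_X, commDefect]

/-- The ideal generated by the relations that make `genericSeries` a commutative formal group
law. -/
noncomputable def lazardIdeal : Ideal (GenericRing) :=
  Ideal.span (Set.range (fun m => coeff m (assocDefect genericSeries)) ∪
    Set.range (fun m => coeff m (commDefect genericSeries)))

/-- The Lazard ring, over which the universal commutative formal group law is defined. -/
def Lazard : Type := GenericRing ⧸ lazardIdeal

noncomputable instance : CommRing Lazard :=
  inferInstanceAs (CommRing (GenericRing ⧸ lazardIdeal))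

/-- The projection onto the Lazard ring. -/
noncomputable def lazardMk : GenericRing →+* Lazard :=
  Ideal.Quotient.mk lazardIdeal

theorem lazardMk_surjective : Function.Surjective lazardMk := Ideal.Quotient.mk_surjective

theorem constantCoeff_genericSeries : constantCoeff genericSeries = 0 := by
  rw [← MvPowerSeries.coeff_zero_eq_constantCoeff_apply, coeff_genericSeries, dif_neg (by simp),
    if_neg (by simp)]

theorem assocDefect_map_lazardMk : assocDefect (genericSeries.map lazardMk) = 0 := by
  rw [← map_assocDefect _ constantCoeff_genericSeries]
  ext m
  rw [MvPowerSeries.coeff_map, map_zero]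
  exact Ideal.Quotient.eq_zero_iff_mem.2 (Ideal.subset_span (Or.inl ⟨m, rfl⟩))

theorem commDefect_map_lazardMk : commDefect (genericSeries.map lazardMk) = 0 := by
  rw [← map_commDefect]
  ext m
  rw [MvPowerSeries.coeff_map, map_zero]
  exact Ideal.Quotient.eq_zero_iff_mem.2 (Ideal.subset_span (Or.inr ⟨m, rfl⟩))

/-- The universal commutative formal group law. -/
noncomputable def lazardLaw : FormalGroup Lazard where
  toPowerSeries := genericSeries.map lazardMk
  zero_constantCoeff := by
    rw [← MvPowerSeries.coeff_zero_eq_constantCoeff_apply, MvPowerSeries.coeff_map,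
      MvPowerSeries.coeff_zero_eq_constantCoeff_apply, constantCoeff_genericSeries, map_zero]
  lin_coeff_X := by
    rw [MvPowerSeries.coeff_map, coeff_genericSeries, dif_neg (by simp), if_pos (by simp), map_one]
  lin_coeff_Y := by
    rw [MvPowerSeries.coeff_map, coeff_genericSeries, dif_neg (by simp), if_pos (by simp), map_one]
  assoc := sub_eq_zero.1 assocDefect_map_lazardMk

instance : lazardLaw.IsComm := ⟨sub_eq_zero.1 commDefect_map_lazardMk⟩

section Universal

variable {R : Type*} [CommRing R] (F : FormalGroup R)

theorem coeff_of_degree_one {m : Fin 2 →₀ ℕ} (hm : m.degree = 1) : coeff m F.toPowerSeries = 1 := by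
  have h := eq_pairExp m
  rw [h, degree_pairExp] at hm
  obtain ⟨h0, h1⟩ | ⟨h0, h1⟩ : (m 0 = 1 ∧ m 1 = 0) ∨ (m 0 = 0 ∧ m 1 = 1) := by lia
  · rw [h, h0, h1]
    simpa [pairExp] using F.lin_coeff_X
  · rw [h, h0, h1]
    simpa [pairExp] using F.lin_coeff_Y

theorem genericSeries_map : genericSeries.map
    (MvPolynomial.eval₂Hom (Int.castRingHom R) fun m => coeff m.1 F.toPowerSeries) =
      F.toPowerSeries := by
  ext m
  rw [MvPowerSeries.coeff_map, coeff_genericSeries]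
  split_ifs with h1 h2
  · rw [MvPolynomial.eval₂Hom_X']
  · rw [map_one, coeff_of_degree_one F h2]
  · rw [map_zero, (Finsupp.degree_eq_zero_iff m).1 (by lia)]
    exact F.zero_constantCoeff.symm

/-- The homomorphism from the Lazard ring that classifies a commutative formal group law. -/
noncomputable def classify [F.IsComm] : Lazard →+* R :=
  Ideal.Quotient.lift lazardIdeal
    (MvPolynomial.eval₂Hom (Int.castRingHom R) fun m => coeff m.1 F.toPowerSeries) <| by
    intro a ha
    rw [← RingHom.mem_ker]
    refine (Ideal.span_le.2 ?_ : lazardIdeal ≤ _) ha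
    rintro _ (⟨m, rfl⟩ | ⟨m, rfl⟩)
    · rw [SetLike.mem_coe, RingHom.mem_ker, ← MvPowerSeries.coeff_map,
        map_assocDefect _ constantCoeff_genericSeries, genericSeries_map, assocDefect, F.assoc,
        sub_self, map_zero]
    · rw [SetLike.mem_coe, RingHom.mem_ker, ← MvPowerSeries.coeff_map,
        map_commDefect, genericSeries_map, commDefect, ← FormalGroup.IsComm.comm, sub_self,
        map_zero]

theorem map_classify [F.IsComm] : lazardLaw.toPowerSeries.map (classify F) = F.toPowerSeries := by
  conv_rhs => rw [← genericSeries_map F]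
  ext m
  rw [MvPowerSeries.coeff_map, MvPowerSeries.coeff_map]
  change classify F (coeff m (genericSeries.map lazardMk)) = _
  rw [MvPowerSeries.coeff_map]
  rfl

theorem classify_coeff [F.IsComm] (m : Fin 2 →₀ ℕ) :
    classify F (coeff m lazardLaw.toPowerSeries) = coeff m F.toPowerSeries := by
  rw [← MvPowerSeries.coeff_map, map_classify]

end Universal

/-- Integers `c` with `∑ c i * n.choose i` equal to a generator of the ideal spanned by the
`n.choose i` with `0 < i < n`. -/
noncomputable def bezoutCoeff (n : ℕ) : ℕ → ℤ :=
  if hn : 2 ≤ n then (exists_choose_bezout hn).choose_spec.choose_spec.choose else 0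

theorem bezoutCoeff_spec {n : ℕ} (hn : 2 ≤ n) : ∃ (d : ℤ) (β : ℕ → ℤ), d ≠ 0 ∧
    (∀ i, 0 < i → i < n → (n.choose i : ℤ) = β i * d) ∧
    ∑ i ∈ Finset.Ioo 0 n, bezoutCoeff n i * β i = 1 := by
  rw [bezoutCoeff, dif_pos hn]
  exact ⟨_, _, (exists_choose_bezout hn).choose_spec.choose_spec.choose_spec⟩

/-- The combination of the coefficients of degree `n` of a formal group law that generates them
modulo coefficients of lower degree. -/
noncomputable def lazardParam {R : Type*} [CommRing R] (F : FormalGroup R) (n : ℕ) : R :=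
  ∑ l ∈ Finset.Ioo 0 n, bezoutCoeff n l • coeff (pairExp l (n - l)) F.toPowerSeries

theorem classify_lazardParam {R : Type*} [CommRing R] (F : FormalGroup R) [F.IsComm] (n : ℕ) :
    classify F (lazardParam lazardLaw n) = lazardParam F n := by
  rw [lazardParam, map_sum]
  exact Finset.sum_congr rfl fun l _ => by rw [map_zsmul, classify_coeff]

/-- The parameters generate the ring of coefficients. By induction on the degree `n`, the
coefficients of that degree form a cocycle modulo the subring `A`, hence are multiples of the
parameter. -/
theorem coeff_mem_of_lazardParam_mem {R : Type*} [CommRing R] (F : FormalGroup R) [F.IsComm]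
    (A : Subring R) (hA : ∀ n, 2 ≤ n → lazardParam F n ∈ A) (m : Fin 2 →₀ ℕ) :
    coeff m F.toPowerSeries ∈ A := by
  induction hn : m.degree using Nat.strong_induction_on generalizing m with
  | _ n ih =>
    obtain rfl | rfl | hn2 : n = 0 ∨ n = 1 ∨ 2 ≤ n := by lia
    · rw [(Finsupp.degree_eq_zero_iff m).1 hn, MvPowerSeries.coeff_zero_eq_constantCoeff_apply,
        F.zero_constantCoeff]
      exact zero_mem A
    · rw [coeff_of_degree_one F hn]
      exact one_mem A
    · rw [eq_pairExp m, degree_pairExp] at hn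
      rw [eq_pairExp m]
      by_cases h0 : m 0 = 0
      · rw [show m 1 = n by lia, h0, (coeff_pairExp_zero F hn2).2]
        exact zero_mem A
      by_cases h1 : m 1 = 0
      · rw [show m 0 = n by lia, h1, (coeff_pairExp_zero F hn2).1]
        exact zero_mem A
      obtain ⟨d, β, hd, hβ, hc⟩ := bezoutCoeff_spec hn2
      have hγ := isBinomialCocycle_coeff F A hn2 fun m' hm' => ih _ hm' m' rfl
      have key := hγ.eq_smul_sum hd hβ hc (i := m 0) (by lia) (by lia)
      have hmap : ∑ l ∈ Finset.Ioo 0 n, bezoutCoeff n l • (QuotientAddGroup.mk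
          (s := A.toAddSubgroup) (coeff (pairExp l (n - l)) F.toPowerSeries)) =
          QuotientAddGroup.mk (s := A.toAddSubgroup) (lazardParam F n) := by
        rw [lazardParam]
        exact (map_sum (QuotientAddGroup.mk' A.toAddSubgroup) _ _).symm
      have hz : (QuotientAddGroup.mk (s := A.toAddSubgroup) (lazardParam F n)) = 0 :=
        (QuotientAddGroup.eq_zero_iff _).2 (hA n hn2)
      rw [hmap, hz, smul_zero, show n - m 0 = m 1 by lia] at key
      exact (QuotientAddGroup.eq_zero_iff _).1 key

/-- The homomorphism from a polynomial ring that maps the variables to the parameters of the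
universal formal group law. -/
noncomputable def lazardHom : MvPolynomial ℕ ℤ →+* Lazard :=
  MvPolynomial.eval₂Hom (Int.castRingHom Lazard) fun k => lazardParam lazardLaw (k + 2)

theorem lazardHom_surjective : Function.Surjective lazardHom := by
  rw [← RingHom.range_eq_top, eq_top_iff]
  rintro x -
  obtain ⟨p, rfl⟩ := lazardMk_surjective x
  have hc := coeff_mem_of_lazardParam_mem lazardLaw lazardHom.range fun n hn =>
    ⟨MvPolynomial.X (n - 2), by
      rw [lazardHom, MvPolynomial.eval₂Hom_X', Nat.sub_add_cancel hn]⟩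
  induction p using MvPolynomial.induction_on with
  | C a => exact ⟨MvPolynomial.C a, by simp⟩
  | add p q hp hq => rw [map_add]; exact add_mem hp hq
  | mul_X p m hp =>
    rw [map_mul]
    refine mul_mem hp ?_
    have h : coeff m.1 lazardLaw.toPowerSeries = lazardMk (MvPolynomial.X m) := by
      change coeff m.1 (genericSeries.map lazardMk) = _
      rw [MvPowerSeries.coeff_map, coeff_genericSeries, dif_pos m.2]
    rw [← h]
    exact hc m.1

end LazardRing

/-! ### Formal group laws with a logarithm -/

section Logarithm

open MvPowerSeries (C X coeff constantCoeff)

variable {K ρ : Type*} [CommRing K]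

theorem mvSubst_subst {σ : Type*} {v : ρ → MvPowerSeries σ K} (hv : MvPowerSeries.HasSubst v)
    (f : PowerSeries K) {u : MvPowerSeries ρ K} (hu : constantCoeff u = 0) :
    MvPowerSeries.subst v (f.subst u) = f.subst (MvPowerSeries.subst v u) :=
  MvPowerSeries.subst_comp_subst_apply (hasSubst_of_constantCoeff hu).const hv f

section Congruence

variable [Finite ρ]

theorem psSubst_sub_subst_mem_pow {n k : ℕ} {u v : MvPowerSeries ρ K}
    (hu : constantCoeff u = 0) (hv : constantCoeff v = 0)
    (h : u - v ∈ varsIdeal ρ K ^ (k + 1)) {f : PowerSeries K} (hf : f ∈ varsIdeal Unit K ^ n) :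
    f.subst u - f.subst v ∈ varsIdeal ρ K ^ (n + k) := by
  have hs := (hasSubst_of_constantCoeff hu).const
  have hs' := (hasSubst_of_constantCoeff hv).const
  rw [PowerSeries.subst_def, PowerSeries.subst_def, ← MvPowerSeries.substAlgHom_apply hs,
    ← MvPowerSeries.substAlgHom_apply hs']
  refine map_sub_map_mem_pow (fun i => ?_) (fun i => ?_) (fun i => ?_) hf
  · rw [MvPowerSeries.substAlgHom_X]
    exact mem_varsIdeal_of_constantCoeff hu
  · rw [MvPowerSeries.substAlgHom_X]
    exact mem_varsIdeal_of_constantCoeff hv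
  · rw [MvPowerSeries.substAlgHom_X, MvPowerSeries.substAlgHom_X]
    exact h

theorem psSubst_sub_subst_mem {n : ℕ} {u v : MvPowerSeries ρ K}
    (hu : constantCoeff u = 0) (hv : constantCoeff v = 0)
    (h : u - v ∈ varsIdeal ρ K ^ n) (f : PowerSeries K) :
    f.subst u - f.subst v ∈ varsIdeal ρ K ^ n := by
  have hs := (hasSubst_of_constantCoeff hu).const
  have hs' := (hasSubst_of_constantCoeff hv).const
  rw [PowerSeries.subst_def, PowerSeries.subst_def, ← MvPowerSeries.substAlgHom_apply hs,
    ← MvPowerSeries.substAlgHom_apply hs']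
  refine map_sub_map_mem le_rfl (N := varsIdeal ρ K) (fun i => ?_) (fun i => ?_) f
  · rw [MvPowerSeries.substAlgHom_X]
    exact mem_varsIdeal_of_constantCoeff hu
  · rw [MvPowerSeries.substAlgHom_X, MvPowerSeries.substAlgHom_X]
    exact h

theorem sub_X_mem_sq {f : PowerSeries K} (h0 : PowerSeries.constantCoeff f = 0)
    (h1 : PowerSeries.coeff 1 f = 1) : f - PowerSeries.X ∈ varsIdeal Unit K ^ 2 := by
  refine mem_varsIdeal_pow fun m hm => ?_
  have hm' : m = Finsupp.single () (m ()) := by ext; simp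
  have hc : ∀ g : PowerSeries K, coeff m g = PowerSeries.coeff (m ()) g := fun g =>
    congrArg (fun e => coeff e g) hm'
  rw [hc]
  rw [hm', Finsupp.degree_single] at hm
  rw [map_sub]
  obtain h | h : m () = 0 ∨ m () = 1 := by lia
  · rw [h, PowerSeries.coeff_zero_X, PowerSeries.coeff_zero_eq_constantCoeff_apply, h0, sub_self]
  · rw [h, PowerSeries.coeff_one_X, h1, sub_self]

theorem psSubst_sub_mem {k : ℕ} {f : PowerSeries K} (h0 : PowerSeries.constantCoeff f = 0)
    (h1 : PowerSeries.coeff 1 f = 1) {u v : MvPowerSeries ρ K}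
    (hu : constantCoeff u = 0) (hv : constantCoeff v = 0)
    (h : u - v ∈ varsIdeal ρ K ^ (k + 1)) :
    f.subst u - f.subst v - (u - v) ∈ varsIdeal ρ K ^ (k + 2) := by
  have := psSubst_sub_subst_mem_pow hu hv h (sub_X_mem_sq h0 h1)
  have hs := hasSubst_of_constantCoeff hu
  have hs' := hasSubst_of_constantCoeff hv
  rw [PowerSeries.subst_sub hs, PowerSeries.subst_sub hs', PowerSeries.subst_X hs,
    PowerSeries.subst_X hs', add_comm 2 k] at this
  convert this using 1
  ring

theorem psSubst_sub_self_mem {f : PowerSeries K} (h0 : PowerSeries.constantCoeff f = 0)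
    (h1 : PowerSeries.coeff 1 f = 1) {u : MvPowerSeries ρ K} (hu : constantCoeff u = 0) :
    f.subst u - u ∈ varsIdeal ρ K ^ 2 := by
  have := psSubst_sub_mem h0 h1 (k := 0) hu (map_zero _) (by
    rw [sub_zero, zero_add, pow_one]; exact mem_varsIdeal_of_constantCoeff hu)
  rwa [PowerSeries.subst_zero_of_constantCoeff_zero h0, sub_zero, sub_zero] at this

end Congruence

theorem constantCoeff_psSubst {f : PowerSeries K} (h0 : PowerSeries.constantCoeff f = 0)
    {u : MvPowerSeries ρ K} (hu : constantCoeff u = 0) : constantCoeff (f.subst u) = 0 :=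
  PowerSeries.constantCoeff_subst_eq_zero hu f h0

variable {f : PowerSeries K}

/-- The inverse under composition of a power series `X + ⋯`. -/
noncomputable def expOf (h1 : PowerSeries.coeff 1 f = 1) : PowerSeries K :=
  f.substInvOfIsUnit (h1 ▸ isUnit_one)

theorem constantCoeff_expOf (h1 : PowerSeries.coeff 1 f = 1) :
    PowerSeries.constantCoeff (expOf h1) = 0 := PowerSeries.constantCoeff_substInvOfIsUnit _ _

theorem coeff_one_expOf (h1 : PowerSeries.coeff 1 f = 1) :
    PowerSeries.coeff 1 (expOf h1) = 1 := by
  rw [expOf, PowerSeries.coeff_one_substInvOfIsUnit]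
  have : (h1 ▸ isUnit_one : IsUnit (PowerSeries.coeff 1 f)).unit = 1 := Units.ext h1
  rw [this, inv_one, Units.val_one]

theorem log_exp (h0 : PowerSeries.constantCoeff f = 0) (h1 : PowerSeries.coeff 1 f = 1)
    {u : MvPowerSeries ρ K} (hu : constantCoeff u = 0) : f.subst ((expOf h1).subst u) = u := by
  have hs := hasSubst_of_constantCoeff hu
  rw [expOf, ← PowerSeries.subst_comp_subst_apply (PowerSeries.HasSubst.substInvOfIsUnit _ _) hs,
    PowerSeries.subst_substInvOfIsUnit_right _ h0, PowerSeries.subst_X hs]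

theorem exp_log (h0 : PowerSeries.constantCoeff f = 0) (h1 : PowerSeries.coeff 1 f = 1)
    {u : MvPowerSeries ρ K} (hu : constantCoeff u = 0) : (expOf h1).subst (f.subst u) = u := by
  have hs := hasSubst_of_constantCoeff hu
  rw [← PowerSeries.subst_comp_subst_apply (PowerSeries.HasSubst.of_constantCoeff_zero h0) hs,
    expOf, PowerSeries.subst_substInvOfIsUnit_left _ h0, PowerSeries.subst_X hs]

variable (h0 : PowerSeries.constantCoeff f = 0) (h1 : PowerSeries.coeff 1 f = 1)

/-- The power series `f⁻¹(f(X₀) + f(X₁))`. -/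
noncomputable def logSeries : MvPowerSeries (Fin 2) K :=
  (expOf h1).subst (f.subst (X 0 : MvPowerSeries (Fin 2) K) + f.subst (X 1))

include h0

theorem constantCoeff_log_add {u v : MvPowerSeries ρ K} (hu : constantCoeff u = 0)
    (hv : constantCoeff v = 0) : constantCoeff (f.subst u + f.subst v) = 0 := by
  rw [map_add, constantCoeff_psSubst h0 hu, constantCoeff_psSubst h0 hv, add_zero]

theorem logSeries_subst {u v : MvPowerSeries ρ K} (hu : constantCoeff u = 0)
    (hv : constantCoeff v = 0) :
    (logSeries h1).subst ![u, v] = (expOf h1).subst (f.subst u + f.subst v) := by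
  have hX := MvPowerSeries.constantCoeff_X (σ := Fin 2) (R := K)
  have hs := hasSubst_vec hu hv
  rw [logSeries, mvSubst_subst hs _ (constantCoeff_log_add h0 (hX 0) (hX 1)),
    MvPowerSeries.subst_add hs, mvSubst_subst hs _ (hX 0), mvSubst_subst hs _ (hX 1),
    MvPowerSeries.subst_X hs, MvPowerSeries.subst_X hs]
  rfl

theorem constantCoeff_logSeries : constantCoeff (logSeries h1) = 0 :=
  have hX := MvPowerSeries.constantCoeff_X (σ := Fin 2) (R := K)
  constantCoeff_psSubst (constantCoeff_expOf h1) (constantCoeff_log_add h0 (hX 0) (hX 1))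

theorem logSeries_sub_mem : logSeries h1 - (X 0 + X 1) ∈ varsIdeal (Fin 2) K ^ 2 := by
  have hX := MvPowerSeries.constantCoeff_X (σ := Fin 2) (R := K)
  have e1 := psSubst_sub_self_mem (constantCoeff_expOf h1) (coeff_one_expOf h1)
    (constantCoeff_log_add h0 (hX 0) (hX 1))
  have e2 := psSubst_sub_self_mem h0 h1 (hX 0)
  have e3 := psSubst_sub_self_mem h0 h1 (hX 1)
  convert add_mem e1 (add_mem e2 e3) using 1
  rw [logSeries]
  ring

theorem log_logSeries : f.subst (logSeries h1) = f.subst (X 0 : MvPowerSeries (Fin 2) K) +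
    f.subst (X 1) := by
  have hX := MvPowerSeries.constantCoeff_X (σ := Fin 2) (R := K)
  exact log_exp h0 h1 (constantCoeff_log_add h0 (hX 0) (hX 1))

theorem coeff_logSeries_linear (i : Fin 2) : coeff (Finsupp.single i 1) (logSeries h1) = 1 := by
  have h := coeff_eq_zero_of_mem_varsIdeal_pow (logSeries_sub_mem h0 h1)
    (m := Finsupp.single i 1) (by simp)
  rw [map_sub, sub_eq_zero] at h
  rw [h, map_add]
  fin_cases i <;> simp [MvPowerSeries.coeff_X, Finsupp.single_left_inj]

/-- The formal group law with logarithm `f`. -/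
noncomputable def logLaw : FormalGroup K where
  toPowerSeries := logSeries h1
  zero_constantCoeff := constantCoeff_logSeries h0 h1
  lin_coeff_X := coeff_logSeries_linear h0 h1 0
  lin_coeff_Y := coeff_logSeries_linear h0 h1 1
  assoc := by
    have hX := MvPowerSeries.constantCoeff_X (σ := Fin 3) (R := K)
    have hF := constantCoeff_logSeries h0 h1
    rw [logSeries_subst h0 h1 (constantCoeff_subst_eq_zero hF (hX 0) (hX 1)) (hX 2),
      logSeries_subst h0 h1 (hX 0) (constantCoeff_subst_eq_zero hF (hX 1) (hX 2)),
      logSeries_subst h0 h1 (hX 0) (hX 1), logSeries_subst h0 h1 (hX 1) (hX 2),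
      log_exp h0 h1 (constantCoeff_log_add h0 (hX 0) (hX 1)),
      log_exp h0 h1 (constantCoeff_log_add h0 (hX 1) (hX 2)), add_assoc]

instance : (logLaw h0 h1).IsComm := ⟨by
  have hX := MvPowerSeries.constantCoeff_X (σ := Fin 2) (R := K)
  change logSeries h1 = (logSeries h1).subst ![X 1, X 0]
  rw [logSeries_subst h0 h1 (hX 1) (hX 0), add_comm]
  rfl⟩

end Logarithm

/-! ### The structure of the Lazard ring -/

section LogarithmChange

open MvPowerSeries (C X coeff constantCoeff)

variable {K : Type*} [CommRing K] {f f' : PowerSeries K}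
  (h0 : PowerSeries.constantCoeff f = 0) (h1 : PowerSeries.coeff 1 f = 1)
  (h0' : PowerSeries.constantCoeff f' = 0) (h1' : PowerSeries.coeff 1 f' = 1)
include h0 h0'

/-- Adding `a X ^ n` to the logarithm changes the formal group law by
`-a ((X₀ + X₁) ^ n - X₀ ^ n - X₁ ^ n)`, up to terms of degree greater than `n`. -/
theorem logSeries_sub_logSeries_mem {n : ℕ} (hn : 2 ≤ n) {a : K}
    (hf : f' = f + a • PowerSeries.X ^ n) :
    logSeries h1' - (logSeries h1 - a • ((X 0 + X 1) ^ n - X 0 ^ n - X 1 ^ n)) ∈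
      varsIdeal (Fin 2) K ^ (n + 1) := by
  have hX := MvPowerSeries.constantCoeff_X (σ := Fin 2) (R := K)
  set D : MvPowerSeries (Fin 2) K := (X 0 + X 1) ^ n - X 0 ^ n - X 1 ^ n with hD
  set G := logSeries h1 - a • D with hG
  have hn0 : n ≠ 0 := by lia
  have hDn : a • D ∈ varsIdeal (Fin 2) K ^ n := by
    have hm := X_mem_varsIdeal (τ := Fin 2) (R := K)
    have : a • D = C a * D := MvPowerSeries.smul_eq_C_mul D a
    rw [this]
    exact Ideal.mul_mem_left _ _ (sub_mem (sub_mem (Ideal.pow_mem_pow (add_mem (hm 0) (hm 1)) n)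
      (Ideal.pow_mem_pow (hm 0) n)) (Ideal.pow_mem_pow (hm 1) n))
  have hD0 : constantCoeff (a • D) = 0 := by
    rw [← MvPowerSeries.coeff_zero_eq_constantCoeff_apply]
    exact coeff_eq_zero_of_mem_varsIdeal_pow hDn (by simp; lia)
  have hF0 := constantCoeff_logSeries h0 h1
  have hG0 : constantCoeff G = 0 := by rw [hG, map_sub, hF0, hD0, sub_zero]
  have hXX : constantCoeff (X 0 + X 1 : MvPowerSeries (Fin 2) K) = 0 := by
    rw [map_add, hX, hX, add_zero]
  have hsubst : ∀ {u : MvPowerSeries (Fin 2) K}, constantCoeff u = 0 →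
      f'.subst u = f.subst u + a • u ^ n := fun {u} hu => by
    have hs := hasSubst_of_constantCoeff hu
    rw [hf, PowerSeries.subst_add hs, PowerSeries.subst_smul hs, PowerSeries.subst_pow hs,
      PowerSeries.subst_X hs]
  obtain ⟨k, rfl⟩ := Nat.exists_eq_add_of_le' (show 1 ≤ n by lia)
  have e1 := psSubst_sub_mem h0 h1 hG0 hF0 (k := k) (by
    rw [hG, sub_sub_cancel_left]; exact neg_mem hDn)
  have hXn : (PowerSeries.X ^ (k + 1) : PowerSeries K) ∈ varsIdeal Unit K ^ (k + 1) :=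
    Ideal.pow_mem_pow (X_mem_varsIdeal ()) _
  have e2 := psSubst_sub_subst_mem_pow hG0 hXX (k := 1) (by
    rw [hG, sub_right_comm]
    exact sub_mem (logSeries_sub_mem h0 h1) (Ideal.pow_le_pow_right hn hDn)) hXn
  rw [PowerSeries.subst_pow (hasSubst_of_constantCoeff hG0),
    PowerSeries.subst_pow (hasSubst_of_constantCoeff hXX),
    PowerSeries.subst_X (hasSubst_of_constantCoeff hG0),
    PowerSeries.subst_X (hasSubst_of_constantCoeff hXX)] at e2
  have e3 : f'.subst G - (f'.subst (X 0 : MvPowerSeries (Fin 2) K) + f'.subst (X 1)) ∈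
      varsIdeal (Fin 2) K ^ (k + 1 + 1) := by
    rw [hsubst hG0, hsubst (hX 0), hsubst (hX 1)]
    convert add_mem e1 (Ideal.mul_mem_left _ (C a) e2) using 1
    rw [log_logSeries h0 h1, hG]
    simp only [MvPowerSeries.smul_eq_C_mul, hD]
    ring
  have e4 := psSubst_sub_subst_mem (constantCoeff_psSubst h0' hG0)
    (constantCoeff_log_add h0' (hX 0) (hX 1)) e3 (expOf h1')
  rw [exp_log h0' h1' hG0] at e4
  rw [← neg_sub]
  exact neg_mem e4

/-- A change of the logarithm in degree `n` does not affect the parameters of lower degree. -/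
theorem lazardParam_logLaw_of_lt {n k : ℕ} (hn : 2 ≤ n) {a : K}
    (hf : f' = f + a • PowerSeries.X ^ n) (hk : k < n) :
    lazardParam (logLaw h0' h1') k = lazardParam (logLaw h0 h1) k := by
  rw [lazardParam, lazardParam]
  refine Finset.sum_congr rfl fun l hl => congrArg _ ?_
  obtain ⟨hl0, hl1⟩ := Finset.mem_Ioo.1 hl
  have hdeg : (pairExp l (k - l)).degree = k := by rw [degree_pairExp]; lia
  have key := coeff_eq_zero_of_mem_varsIdeal_pow
    (logSeries_sub_logSeries_mem h0 h1 h0' h1' hn hf) (m := pairExp l (k - l)) (by lia)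
  have hm := X_mem_varsIdeal (τ := Fin 2) (R := K)
  have hD : (X 0 + X 1) ^ n - X 0 ^ n - X 1 ^ n ∈ varsIdeal (Fin 2) K ^ n :=
    sub_mem (sub_mem (Ideal.pow_mem_pow (add_mem (hm 0) (hm 1)) n)
      (Ideal.pow_mem_pow (hm 0) n)) (Ideal.pow_mem_pow (hm 1) n)
  have hD' := coeff_eq_zero_of_mem_varsIdeal_pow hD (m := pairExp l (k - l)) (by lia)
  rw [map_sub, map_sub, MvPowerSeries.coeff_smul, hD', mul_zero, sub_zero, sub_eq_zero] at key
  exact key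

/-- A change of the logarithm in degree `n` shifts the parameter of degree `n` by a nonzero integral
multiple of the change, so that over a field of characteristic zero it can be given any value. -/
theorem lazardParam_logLaw_self {n : ℕ} (hn : 2 ≤ n) {a : K}
    (hf : f' = f + a • PowerSeries.X ^ n) :
    lazardParam (logLaw h0' h1') n = lazardParam (logLaw h0 h1) n -
      a * ((∑ l ∈ Finset.Ioo 0 n, bezoutCoeff n l * (n.choose l : ℤ) : ℤ) : K) := by
  rw [lazardParam, lazardParam, Int.cast_sum, Finset.mul_sum, ← Finset.sum_sub_distrib]
  refine Finset.sum_congr rfl fun l hl => ?_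
  obtain ⟨hl0, hl1⟩ := Finset.mem_Ioo.1 hl
  have key := coeff_eq_zero_of_mem_varsIdeal_pow
    (logSeries_sub_logSeries_mem h0 h1 h0' h1' hn hf) (m := pairExp l (n - l))
    (by rw [degree_pairExp]; lia)
  have c0 : coeff (pairExp l (n - l)) ((X 0 + X 1) ^ n : MvPowerSeries (Fin 2) K) =
      n.choose l := by
    have hXX : constantCoeff (X 0 + X 1 : MvPowerSeries (Fin 2) K) = 0 := by
      rw [map_add, MvPowerSeries.constantCoeff_X, MvPowerSeries.constantCoeff_X, add_zero]
    have := PowerSeries.coeff_subst_X_zero_add_X_one (PowerSeries.X ^ n : PowerSeries K)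
      (pairExp l (n - l))
    rw [PowerSeries.subst_pow (hasSubst_of_constantCoeff hXX),
      PowerSeries.subst_X (hasSubst_of_constantCoeff hXX)] at this
    rw [this]
    simp [pairExp, Nat.add_sub_cancel' hl1.le]
  have c1 : coeff (pairExp l (n - l)) (X 0 ^ n : MvPowerSeries (Fin 2) K) = 0 := by
    rw [← mul_one (X 0 ^ n), ← pow_zero (X 1), coeff_pairExp_monomial, if_neg (by lia)]
  have c2 : coeff (pairExp l (n - l)) (X 1 ^ n : MvPowerSeries (Fin 2) K) = 0 := by
    rw [← one_mul (X 1 ^ n), ← pow_zero (X 0), coeff_pairExp_monomial, if_neg (by lia)]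
  rw [map_sub, map_sub, MvPowerSeries.coeff_smul, map_sub, map_sub, c0, c1, c2, sub_eq_zero] at key
  change bezoutCoeff n l • coeff _ (logSeries h1') = bezoutCoeff n l • coeff _ (logSeries h1) - _
  rw [key]
  push_cast
  simp only [zsmul_eq_mul]
  ring

end LogarithmChange

/-- Over a field of characteristic zero, the parameters of a commutative formal group law can be
prescribed. -/
theorem exists_lazardParam_eq {K : Type*} [Field K] [CharZero K] (t : ℕ → K) (N : ℕ) :
    ∃ F : FormalGroup K, ∃ _ : F.IsComm, ∀ n, 2 ≤ n → n < N → lazardParam F n = t n := by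
  suffices ∃ (f : PowerSeries K) (h0 : PowerSeries.constantCoeff f = 0)
      (h1 : PowerSeries.coeff 1 f = 1),
      ∀ n, 2 ≤ n → n < N → lazardParam (logLaw h0 h1) n = t n by
    obtain ⟨f, h0, h1, h⟩ := this
    exact ⟨logLaw h0 h1, inferInstance, h⟩
  induction N with
  | zero => exact ⟨PowerSeries.X, by simp, by simp, fun n _ h => by lia⟩
  | succ n ih =>
    obtain ⟨f, h0, h1, h⟩ := ih
    by_cases hn : 2 ≤ n
    · obtain ⟨d, β, hd, hβ, hc⟩ := bezoutCoeff_spec hn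
      have hsum : ∑ l ∈ Finset.Ioo 0 n, bezoutCoeff n l * (n.choose l : ℤ) = d := by
        rw [← one_mul d, ← hc, Finset.sum_mul]
        refine Finset.sum_congr rfl fun l hl => ?_
        obtain ⟨hl0, hl1⟩ := Finset.mem_Ioo.1 hl
        rw [hβ l hl0 hl1, mul_assoc]
      set a : K := (lazardParam (logLaw h0 h1) n - t n) / d with ha
      have h0' : PowerSeries.constantCoeff (f + a • PowerSeries.X ^ n) = 0 := by
        rw [map_add, h0, zero_add, ← PowerSeries.coeff_zero_eq_constantCoeff_apply,
          PowerSeries.coeff_smul, PowerSeries.coeff_X_pow, if_neg (by lia), smul_zero]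
      have h1' : PowerSeries.coeff 1 (f + a • PowerSeries.X ^ n) = 1 := by
        rw [map_add, h1, PowerSeries.coeff_smul, PowerSeries.coeff_X_pow, if_neg (by lia),
          smul_zero, add_zero]
      refine ⟨_, h0', h1', fun k hk hkn => ?_⟩
      obtain hlt | rfl := (Nat.lt_succ_iff.1 hkn).lt_or_eq
      · rw [lazardParam_logLaw_of_lt h0 h1 h0' h1' hn rfl hlt, h k hk hlt]
      · rw [lazardParam_logLaw_self h0 h1 h0' h1' hn rfl, hsum, ha,
          div_mul_cancel₀ _ (Int.cast_ne_zero.2 hd), sub_sub_cancel]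
    · exact ⟨f, h0, h1, fun k hk hkn => by lia⟩

/-- A polynomial in the kernel vanishes at the parameters of every formal group law over `ℚ`, and
these attain any finite list of rational values. -/
theorem lazardHom_injective : Function.Injective lazardHom := by
  rw [injective_iff_map_eq_zero]
  intro p hp
  refine MvPolynomial.map_injective (Int.castRingHom ℚ) Int.cast_injective ?_
  rw [map_zero]
  refine MvPolynomial.funext fun t => ?_
  rw [map_zero]
  obtain ⟨F, hF, h⟩ := exists_lazardParam_eq (fun n => t (n - 2)) (p.vars.sup id + 3)
  have h1 : (classify F).comp lazardHom =
      MvPolynomial.eval₂Hom (Int.castRingHom ℚ) fun k => lazardParam F (k + 2) := by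
    refine MvPolynomial.ringHom_ext (fun r => by simp) fun i => ?_
    rw [RingHom.comp_apply, lazardHom, MvPolynomial.eval₂Hom_X', MvPolynomial.eval₂Hom_X',
      classify_lazardParam]
  have h2 := RingHom.congr_fun h1 p
  rw [RingHom.comp_apply, hp, map_zero] at h2
  rw [MvPolynomial.eval_map]
  refine Eq.trans ?_ h2.symm
  change MvPolynomial.eval₂Hom (Int.castRingHom ℚ) t p = _
  refine MvPolynomial.eval₂Hom_congr' rfl (fun i hi _ => ?_) rfl
  have : i ≤ p.vars.sup id := Finset.le_sup (f := id) hi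
  rw [h (i + 2) (by lia) (by lia), Nat.add_sub_cancel]

/-- **Lazard's theorem**: the Lazard ring is a polynomial ring. -/
noncomputable def lazardEquiv : MvPolynomial ℕ ℤ ≃+* Lazard :=
  RingEquiv.ofBijective lazardHom ⟨lazardHom_injective, lazardHom_surjective⟩

instance : IsDomain Lazard := lazardEquiv.symm.toMulEquiv.isDomain _

instance : CharZero Lazard := charZero_of_injective_ringHom lazardEquiv.injective

/-! ### Base change of formal group algebras -/

section BaseChange

variable {R₀ R : Type*} [CommRing R₀] [CommRing R] {F₀ : FormalGroup R₀} (F : FormalGroup R)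
  [F₀.IsComm] (φ : R₀ →+* R)
  {σ : Type*} [Finite σ] {M M' : Type*} [AddCommGroup M] [AddCommGroup M']
  (e : Module.Basis σ ℤ M) (f : M →+ M')

theorem xvar_mem_fgaLevel_one (l : M) : xvar F l ∈ fgaLevel F M 1 := by
  have h : Ideal.Quotient.mk (fgaLevel F M 1) (xvar F l) ∈ quotVars F M 1 ^ 1 := by
    rw [pow_one]
    exact Ideal.subset_span ⟨l, rfl⟩
  rw [quotVars_pow] at h
  exact Ideal.Quotient.eq_zero_iff_mem.1 h

/-- The homomorphism `R₀⟦M⟧ → R⟦M'⟧` of formal group algebras over a homomorphism `R₀ → R` that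
respects the formal group laws, with `x_l ↦ x_{f l}`. -/
noncomputable def fgaBaseChange : FormalGroupAlgebra F₀ M →+* FormalGroupAlgebra F M' :=
  ((toFga F fun i => f (e i) : MvPowerSeries σ R →ₐ[R] _) : MvPowerSeries σ R →+* _).comp
    ((MvPowerSeries.map φ).comp
      ((fgaEquiv F₀ e).symm : FormalGroupAlgebra F₀ M →+* MvPowerSeries σ R₀))

theorem fgaBaseChange_toFga (g : MvPowerSeries σ R₀) :
    fgaBaseChange F φ e f (toFga F₀ e g) = toFga F (fun i => f (e i)) (g.map φ) := by
  have : (fgaEquiv F₀ e).symm (toFga F₀ e g) = g := (fgaEquiv F₀ e).symm_apply_apply g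
  change toFga F _ (MvPowerSeries.map φ ((fgaEquiv F₀ e).symm _)) = _
  rw [this]

theorem fgaBaseChange_algebraMap (r : R₀) :
    fgaBaseChange F φ e f (algebraMap R₀ (FormalGroupAlgebra F₀ M) r) =
      algebraMap R (FormalGroupAlgebra F M') (φ r) := by
  have h : algebraMap R₀ (FormalGroupAlgebra F₀ M) r = toFga F₀ e (MvPowerSeries.C r) :=
    ((toFga F₀ e).commutes r).symm
  rw [h, fgaBaseChange_toFga, MvPowerSeries.map_C]
  exact (toFga F fun i => f (e i)).commutes (φ r)

theorem fgaBaseChange_xvar_basis (i : σ) :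
    fgaBaseChange F φ e f (xvar F₀ (e i)) = xvar F (f (e i)) := by
  rw [← toFga_X, fgaBaseChange_toFga, MvPowerSeries.map_X, toFga_X]

theorem mk_fgaBaseChange_xvar_mem (n : ℕ) (l : M) :
    Ideal.Quotient.mk (fgaLevel F M' n) (fgaBaseChange F φ e f (xvar F₀ l)) ∈ quotVars F M' n := by
  obtain ⟨g, hg⟩ := toFga_surjective F₀ e (xvar F₀ l)
  have h := xvar_mem_fgaLevel_one F₀ l
  rw [← hg, toFga_mem_fgaLevel_iff] at h
  have := map_mem_pow_of_mem (N := quotVars F M' n) (φ := (Ideal.Quotient.mk (fgaLevel F M' n)).comp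
    ((fgaBaseChange F φ e f).comp (toFga F₀ e).toRingHom)) (fun i => by
      change Ideal.Quotient.mk _ (fgaBaseChange F φ e f (toFga F₀ e (MvPowerSeries.X i))) ∈ _
      rw [toFga_X, fgaBaseChange_xvar_basis]
      exact Ideal.subset_span ⟨_, rfl⟩) h
  change Ideal.Quotient.mk _ (fgaBaseChange F φ e f (toFga F₀ e g)) ∈ _ at this
  rwa [pow_one, hg] at this

variable {F φ} [F.IsComm] (hφ : F₀.toPowerSeries.map φ = F.toPowerSeries)
include hφ

/-- The images of the `x_l` are points of the formal group law. -/
noncomputable def baseChangePoint (n : ℕ) : M →+ NilPoint F (quotVars_pow F M' n) :=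
  AddMonoidHom.mk' (fun l => ⟨_, mk_fgaBaseChange_xvar_mem (F₀ := F₀) F φ e f n l⟩) fun l m =>
    NilPoint.ext <| by
      have hN := isHausdorff_of_pow_eq_bot (quotVars_pow F M' n)
      have hmem := mk_fgaBaseChange_xvar_mem (F₀ := F₀) F φ e f n
      rw [NilPoint.add_val, ← hφ]
      change Ideal.Quotient.mk (fgaLevel F M' n) (fgaBaseChange F φ e f (xvar F₀ (l + m))) = _
      rw [xvar_add]
      let ψ : MvPowerSeries (Fin 2) R →ₐ[R] FgaQuot F M' n :=
        nilEval (quotVars_pow F M' n) _ (NilPoint.vec_mem (hmem l) (hmem m))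
      have key : (Ideal.Quotient.mk (fgaLevel F M' n)).comp ((fgaBaseChange F φ e f).comp
          (toFga F₀ ![l, m]).toRingHom) = ψ.toRingHom.comp (MvPowerSeries.map φ) := by
        refine mvPowerSeries_ringHom_ext (quotVars F M' n) (fun r => ?_) (fun i => ?_) fun i => ?_
        · have h : toFga F₀ ![l, m] (MvPowerSeries.C r) = algebraMap R₀ _ r :=
            (toFga F₀ ![l, m]).commutes r
          change Ideal.Quotient.mk _ (fgaBaseChange F φ e f (toFga F₀ ![l, m] _)) =
            ψ (MvPowerSeries.map φ _)
          rw [h, fgaBaseChange_algebraMap, MvPowerSeries.map_C]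
          exact (ψ.commutes (φ r)).symm
        · change Ideal.Quotient.mk _ (fgaBaseChange F φ e f (toFga F₀ ![l, m] _)) =
            ψ (MvPowerSeries.map φ _)
          rw [toFga_X, MvPowerSeries.map_X]
          refine Eq.trans ?_ (nilEval_X _ _ i).symm
          fin_cases i <;> rfl
        · change Ideal.Quotient.mk _ (fgaBaseChange F φ e f (toFga F₀ ![l, m] _)) ∈ _
          rw [toFga_X]
          exact hmem _
      exact RingHom.congr_fun key F₀.toPowerSeries

theorem fgaBaseChange_xvar (l : M) : fgaBaseChange F φ e f (xvar F₀ l) = xvar F (f l) := by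
  rw [← sub_eq_zero]
  refine eq_zero_of_forall_mem_fgaLevel F fun n => ?_
  have h : (baseChangePoint e f hφ n).toIntLinearMap =
      ((quotPoint F M' n).comp f).toIntLinearMap := e.ext fun i => NilPoint.ext <| by
    change Ideal.Quotient.mk _ (fgaBaseChange F φ e f (xvar F₀ (e i))) = _
    rw [fgaBaseChange_xvar_basis]
    rfl
  exact Ideal.Quotient.eq.1 (congrArg NilPoint.val (DFunLike.congr_fun h l))

theorem fgaBaseChange_fgaMap (g : M →+ M) (g' : M' →+ M') (hg : ∀ l, f (g l) = g' (f l))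
    (z : FormalGroupAlgebra F₀ M) :
    fgaBaseChange F φ e f (fgaMap F₀ g z) = fgaMap F g' (fgaBaseChange F φ e f z) := by
  have key : (fgaBaseChange F φ e f).comp (fgaMap F₀ g : FormalGroupAlgebra F₀ M →+* FormalGroupAlgebra F₀ M) =
      (fgaMap F g' : FormalGroupAlgebra F M' →+* FormalGroupAlgebra F M').comp (fgaBaseChange F φ e f) := by
    refine fga_ringHom_ext F₀ e (augIdeal F M') (fun r => ?_) (fun i => ?_) fun i => ?_
    · rw [RingHom.comp_apply, RingHom.coe_coe, AlgHom.commutes, RingHom.comp_apply,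
        fgaBaseChange_algebraMap, RingHom.coe_coe, AlgHom.commutes]
    · rw [RingHom.comp_apply, RingHom.coe_coe, fgaMap_xvar, RingHom.comp_apply,
        fgaBaseChange_xvar e f hφ, fgaBaseChange_xvar e f hφ, RingHom.coe_coe, fgaMap_xvar, hg]
    · rw [RingHom.comp_apply, RingHom.coe_coe, fgaMap_xvar, fgaBaseChange_xvar e f hφ]
      exact xvar_mem_augIdeal F _
  exact RingHom.congr_fun key z

end BaseChange

/-! ### The universal case: the Lazard ring and the root lattice -/

section RootLattice

open RootPairing.weylGroup (ofIdx)

variable {ι X Y : Type*} [AddCommGroup X] [AddCommGroup Y] (P : RootDatum ι X Y)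

/-- The root lattice. -/
abbrev RootLattice : Type _ := P.rootSpan ℤ

/-- A root, as an element of the root lattice. -/
abbrev latRoot (a : ι) : RootLattice P := P.rootSpanMem ℤ a

theorem smul_mem_rootSpan (w : P.weylGroup) {l : X} (hl : l ∈ P.rootSpan ℤ) :
    w • l ∈ P.rootSpan ℤ := by
  refine Submodule.span_induction (p := fun l _ => w • l ∈ P.rootSpan ℤ) ?_ ?_ ?_ ?_ hl
  · rintro _ ⟨a, rfl⟩
    rw [← root_smul]
    exact Submodule.subset_span ⟨_, rfl⟩
  · rw [smul_zero]
    exact zero_mem _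
  · intro x y _ _ hx hy
    rw [smul_add]
    exact add_mem hx hy
  · intro k x _ hx
    have : w • (k • x) = k • w • x := map_zsmul (DistribSMul.toAddMonoidHom X w) k x
    rw [this]
    exact Submodule.smul_mem _ k hx

/-- The action of the Weyl group on `ℤ γ ⊕` the root lattice. -/
noncomputable def latMap (w : P.weylGroup) : ℤ × RootLattice P →+ ℤ × RootLattice P :=
  (AddMonoidHom.id ℤ).prodMap
    { toFun := fun l => ⟨w • (l : X), smul_mem_rootSpan P w l.2⟩
      map_zero' := Subtype.ext (smul_zero w)
      map_add' := fun l m => Subtype.ext (smul_add w (l : X) (m : X)) }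

theorem latMap_latRoot (w : P.weylGroup) (a : ι) :
    latMap P w (0, latRoot P a) = (0, latRoot P (w • a)) :=
  Prod.ext rfl (Subtype.ext (root_smul w a).symm)

theorem latMap_gamma (w : P.weylGroup) : latMap P w (1, 0) = (1, 0) :=
  Prod.ext rfl (Subtype.ext (smul_zero w))

theorem latMap_one : latMap P 1 = AddMonoidHom.id _ :=
  AddMonoidHom.ext fun l => Prod.ext rfl (Subtype.ext (one_smul _ (l.2 : X)))

theorem latMap_mul (v w : P.weylGroup) : latMap P (v * w) = (latMap P v).comp (latMap P w) :=
  AddMonoidHom.ext fun l => Prod.ext rfl (Subtype.ext (mul_smul v w (l.2 : X)))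

theorem latRoot_neg (a : ι) : latRoot P (ofIdx P a • a) = -latRoot P a :=
  Subtype.ext (by
    change P.root (P.reflectionPerm a a) = -P.root a
    rw [P.root_reflectionPerm, P.reflection_apply_self])

/-- The pairing with the coroot of `a`, on `ℤ γ ⊕` the root lattice. -/
noncomputable def latCoroot (a : ι) : ℤ × RootLattice P →+ ℤ :=
  ((P.coroot' a).toAddMonoidHom.comp (P.rootSpan ℤ).subtype.toAddMonoidHom).comp
    (AddMonoidHom.snd _ _)

theorem sub_latMap_refl (a : ι) (l : ℤ × RootLattice P) :
    l = latCoroot P a l • ((0, latRoot P a) : ℤ × RootLattice P) + latMap P (ofIdx P a) l := by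
  refine Prod.ext ?_ (Subtype.ext ?_)
  · change l.1 = (latCoroot P a l • (0 : ℤ)) + l.1
    rw [smul_zero, zero_add]
  · change (l.2 : X) = P.coroot' a (l.2 : X) • P.root a + ofIdx P a • (l.2 : X)
    rw [refl_smul_eq, P.reflection_apply]
    abel

/-- Every root is a primitive vector of the root lattice, being conjugate to a simple root. -/
theorem exists_latRoot_eq_one [Finite ι] [P.IsReduced] (b : P.Base) (a : ι) :
    ∃ c : RootLattice P →+ ℤ, c (latRoot P a) = 1 := by
  induction a using b.induction_reflect with
  | h₀ a ha =>
    obtain ⟨c, hc⟩ := ha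
    refine ⟨-c, ?_⟩
    have : latRoot P (P.reflectionPerm a a) = -latRoot P a := latRoot_neg P a
    rw [this, AddMonoidHom.neg_apply, map_neg, hc, neg_neg]
  | h₁ i hi =>
    refine ⟨(b.toWeightBasisInt.coord ⟨i, hi⟩).toAddMonoidHom, ?_⟩
    have : latRoot P i = b.toWeightBasisInt ⟨i, hi⟩ :=
      Subtype.ext (b.coe_toWeightBasisInt_apply ⟨i, hi⟩).symm
    rw [this]
    simp
  | h₂ a i ha hi =>
    obtain ⟨c, hc⟩ := ha
    refine ⟨c.comp ((AddMonoidHom.snd _ _).comp ((latMap P (ofIdx P i)).comp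
      (AddMonoidHom.inr ℤ (RootLattice P)))), ?_⟩
    change c (latMap P (ofIdx P i) (0, latRoot P (ofIdx P i • a))).2 = 1
    rw [latMap_latRoot, refl_idx_smul_self, hc]

theorem latRoot_ne_smul [P.IsReduced] {a c : ι} (h1 : c ≠ a) (h2 : c ≠ ofIdx P a • a) (k : ℤ) :
    latRoot P c ≠ k • latRoot P a := by
  intro h
  have hk : P.root c = k • P.root a := congrArg Subtype.val h
  have hdep : ¬ LinearIndependent ℤ ![P.root a, P.root c] := by
    rw [LinearIndependent.pair_iff]
    intro hlin
    have := hlin k (-1) (by rw [hk, neg_smul, one_smul, add_neg_cancel])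
    lia
  obtain h | h := RootPairing.IsReduced.eq_or_eq_neg a c hdep
  · exact h1 (P.root.injective h).symm
  · refine h2 (P.root.injective ?_)
    change P.root c = P.root (P.reflectionPerm a a)
    rw [P.root_reflectionPerm, P.reflection_apply_self, h, neg_neg]

end RootLattice

section Universal

open RootPairing.weylGroup (ofIdx)

variable {ι X Y : Type*} [AddCommGroup X] [AddCommGroup Y] (P : RootDatum ι X Y)

/-- The formal group algebra of `ℤ γ ⊕` the root lattice for the universal formal group law. -/
abbrev UnivRing : Type _ := FormalGroupAlgebra lazardLaw (ℤ × RootLattice P)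

/-- The action of the Weyl group on the universal formal group algebra. -/
noncomputable def univMap (w : P.weylGroup) : UnivRing P →+* UnivRing P :=
  (fgaMap lazardLaw (latMap P w) : UnivRing P →ₐ[Lazard] UnivRing P)

/-- The multiplicative set generated by the `x_a`, `a` a root. -/
noncomputable def univMonoid : Submonoid (UnivRing P) :=
  Submonoid.closure (Set.range fun a : ι => xvar lazardLaw (0, latRoot P a))

/-- The localization of the universal formal group algebra at the roots. -/
abbrev UnivLoc : Type _ := Localization (univMonoid P)

theorem univMap_xvar (w : P.weylGroup) (l : ℤ × RootLattice P) :
    univMap P w (xvar lazardLaw l) = xvar lazardLaw (latMap P w l) := fgaMap_xvar _ _ _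

theorem univMap_one (z : UnivRing P) : univMap P 1 z = z := by
  change fgaMap lazardLaw (latMap P 1) z = z
  rw [latMap_one, fgaMap_id]

theorem univMap_mul (v w : P.weylGroup) (z : UnivRing P) :
    univMap P (v * w) z = univMap P v (univMap P w z) := by
  change fgaMap lazardLaw (latMap P (v * w)) z =
    fgaMap lazardLaw (latMap P v) (fgaMap lazardLaw (latMap P w) z)
  rw [fgaMap_fgaMap, latMap_mul]

theorem univMonoid_le_comap (w : P.weylGroup) :
    univMonoid P ≤ (univMonoid P).comap (univMap P w) := by
  conv_lhs => rw [univMonoid]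
  rw [Submonoid.closure_le]
  rintro _ ⟨a, rfl⟩
  rw [SetLike.mem_coe, Submonoid.mem_comap, univMap_xvar, latMap_latRoot]
  exact Submonoid.subset_closure ⟨w • a, rfl⟩

noncomputable instance : MulSemiringAction P.weylGroup (UnivLoc P) :=
  locAction (univMonoid P) (univMap P) (univMap_one P) (univMap_mul P) (univMonoid_le_comap P)

theorem univ_smul_algebraMap (w : P.weylGroup) (z : UnivRing P) :
    w • algebraMap (UnivRing P) (UnivLoc P) z = algebraMap (UnivRing P) (UnivLoc P)
      (univMap P w z) :=
  locAction_algebraMap (univMonoid P) (univMap P) (univMap_one P) (univMap_mul P)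
    (univMonoid_le_comap P) w z

theorem isUnit_univ_root (a : ι) :
    IsUnit (algebraMap (UnivRing P) (UnivLoc P) (xvar lazardLaw (0, latRoot P a))) :=
  IsLocalization.map_units (UnivLoc P) (⟨_, Submonoid.subset_closure ⟨a, rfl⟩⟩ : univMonoid P)

/-- The elements `x_a` and `t = x_γ` of the universal localized formal group algebra. -/
noncomputable def univDatum : TwistDatum P (UnivLoc P) where
  x a := algebraMap (UnivRing P) (UnivLoc P) (xvar lazardLaw (0, latRoot P a))
  y a := Ring.inverse (algebraMap (UnivRing P) (UnivLoc P) (xvar lazardLaw (0, latRoot P a)))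
  t := algebraMap (UnivRing P) (UnivLoc P) (xvar lazardLaw (1, 0))
  x_mul_y a := Ring.mul_inverse_cancel _ (isUnit_univ_root P a)
  smul_x w a := by rw [univ_smul_algebraMap, univMap_xvar, latMap_latRoot]
  smul_t w := by rw [univ_smul_algebraMap, univMap_xvar, latMap_gamma]

variable (b : P.Base)

include b in
theorem free_rootLattice : Module.Free ℤ (RootLattice P) := Module.Free.of_basis b.toWeightBasisInt

include b in
theorem finite_rootLattice : Module.Finite ℤ (RootLattice P) :=
  Module.Finite.of_basis b.toWeightBasisInt

include b in
theorem univ_algebraMap_injective :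
    Function.Injective (algebraMap (UnivRing P) (UnivLoc P)) := by
  have := free_rootLattice P b
  have := finite_rootLattice P b
  have := isDomain_fga (M := ℤ × RootLattice P) lazardLaw
  refine IsLocalization.injective (M := univMonoid P) _ ?_
  rw [univMonoid, Submonoid.closure_le]
  rintro _ ⟨a, rfl⟩
  rw [SetLike.mem_coe, mem_nonZeroDivisors_iff_ne_zero]
  refine xvar_ne_zero lazardLaw fun h => P.ne_zero a ?_
  exact congrArg (fun l : ℤ × RootLattice P => (l.2 : X)) h

include b in
/-- The universal case satisfies the hypotheses of the residue argument: the formal group algebra of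
the root lattice over the Lazard ring is a domain of characteristic zero and the roots are
primitive vectors, so that modulo `x_a` only the `x_l` with `l` a multiple of the root are zero
divisors. -/
theorem univDatum_isResidual [Finite ι] [P.IsReduced] :
    (univDatum P).IsResidual (algebraMap (UnivRing P) (UnivLoc P)).range := by
  have hfree := free_rootLattice P b
  have hfin := finite_rootLattice P b
  have hdom := isDomain_fga (M := ℤ × RootLattice P) lazardLaw
  have hinj := univ_algebraMap_injective P b
  have hxy := (univDatum P).x_mul_y
  have hx : ∀ a, (univDatum P).x a =
    algebraMap (UnivRing P) (UnivLoc P) (xvar lazardLaw (0, latRoot P a)) := fun a => rfl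
  have hdvd : ∀ (a : ι) (z q : UnivRing P), z = xvar lazardLaw (0, latRoot P a) * q →
      algebraMap (UnivRing P) (UnivLoc P) z * (univDatum P).y a = algebraMap _ _ q :=
    fun a z q h => by rw [h, map_mul, ← hx, mul_right_comm, hxy, one_mul]
  -- `x_a` divides `z` in the formal group algebra if it divides `g z` and `g` is not a zero
  -- divisor modulo `x_a`
  have hdiv : ∀ (a : ι) (g : UnivRing P),
      (∀ z, xvar lazardLaw (0, latRoot P a) ∣ g * z → xvar lazardLaw (0, latRoot P a) ∣ z) →
      ∀ f ∈ (algebraMap (UnivRing P) (UnivLoc P)).range,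
        algebraMap _ _ g * (f * (univDatum P).y a) ∈ (algebraMap (UnivRing P) (UnivLoc P)).range →
        f * (univDatum P).y a ∈ (algebraMap (UnivRing P) (UnivLoc P)).range := by
    rintro a g hg _ ⟨z, rfl⟩ ⟨q, hq⟩
    obtain ⟨q', hq'⟩ := hg z ⟨q, hinj (by
      rw [map_mul, map_mul, hq, ← hx]
      linear_combination (-(algebraMap (UnivRing P) (UnivLoc P) g *
        algebraMap (UnivRing P) (UnivLoc P) z)) * hxy a)⟩
    exact ⟨q', (hdvd a z q' hq').symm⟩
  have hprim : ∀ (a : ι) (l : ℤ × RootLattice P),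
      (∀ k : ℤ, l ≠ k • ((0, latRoot P a) : ℤ × RootLattice P)) →
      ∀ z, xvar lazardLaw (0, latRoot P a) ∣ xvar lazardLaw l * z →
        xvar lazardLaw (0, latRoot P a) ∣ z := fun a l hl z h => by
    obtain ⟨c, hc⟩ := exists_latRoot_eq_one P b a
    exact xvar_dvd_of_dvd_mul lazardLaw (c.comp (AddMonoidHom.snd ℤ (RootLattice P))) hc hl h
  refine ⟨fun a => ⟨_, rfl⟩, ⟨_, rfl⟩, ?_, ?_, fun a => ?_, fun a c f hf h1 h2 h => ?_,
    fun a c f hf h => ?_, fun q => ?_⟩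
  · rintro w _ ⟨z, rfl⟩
    exact ⟨univMap P w z, (univ_smul_algebraMap P w z).symm⟩
  · rintro a _ ⟨z, rfl⟩
    obtain ⟨q, hq⟩ := xvar_dvd_fgaMap_sub lazardLaw (AddMonoidHom.id _) (latMap P (ofIdx P a))
      (latCoroot P a) (0, latRoot P a) (sub_latMap_refl P a) z
    rw [fgaMap_id] at hq
    refine ⟨q, ?_⟩
    rw [univ_smul_algebraMap, ← map_sub, mul_comm]
    exact (hdvd a _ q hq).symm
  · obtain ⟨g, hg⟩ := exists_xvar_add_neg lazardLaw ((0, latRoot P a) : ℤ × RootLattice P)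
    have hneg : (univDatum P).x (ofIdx P a • a) =
        algebraMap (UnivRing P) (UnivLoc P) (xvar lazardLaw (-(0, latRoot P a))) := by
      rw [hx, latRoot_neg, Prod.neg_mk, neg_zero]
    refine ⟨g, ?_⟩
    have h := congrArg (algebraMap (UnivRing P) (UnivLoc P)) hg
    rw [map_add, map_mul, map_mul, ← hneg, ← hx] at h
    have e1 := hxy a
    have e2 := hxy (ofIdx P a • a)
    generalize (univDatum P).x (ofIdx P a • a) = x' at *
    generalize (univDatum P).y (ofIdx P a • a) = y' at *
    generalize (univDatum P).x a = x at *
    generalize (univDatum P).y a = y at *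
    linear_combination (-(y * y')) * h + (y' - x' * y' * algebraMap (UnivRing P) (UnivLoc P) g) * e1
      + (y - algebraMap (UnivRing P) (UnivLoc P) g) * e2
  · refine hdiv a _ (hprim a _ fun k hk => ?_) f hf h
    exact latRoot_ne_smul P h1 h2 k (congrArg Prod.snd hk)
  · obtain ⟨u, hu, hux⟩ := exists_xvar_sub_eq lazardLaw ((1, 0) : ℤ × RootLattice P)
      (0, latRoot P c)
    refine hdiv a _ (fun z hz => ?_) f hf (by
      rw [map_sub]
      exact h)
    rw [hux, mul_right_comm] at hz
    refine hprim a _ (fun k hk => ?_) z ((hu.dvd_mul_right).1 hz)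
    have := congrArg Prod.fst hk
    simp at this
  · obtain ⟨z, s, rfl⟩ := IsLocalization.exists_mk'_eq (univMonoid P) q
    refine ⟨algebraMap _ _ (s : UnivRing P), ?_, z, ?_⟩
    · have h2 : univMonoid P ≤ (Submonoid.closure (Set.range (univDatum P).x)).comap
          (algebraMap (UnivRing P) (UnivLoc P)) := by
        conv_lhs => rw [univMonoid]
        rw [Submonoid.closure_le]
        rintro _ ⟨a, rfl⟩
        exact Submonoid.subset_closure ⟨a, rfl⟩
      exact h2 s.2
    · exact (IsLocalization.mk'_spec' (UnivLoc P) z s).symm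

end Universal

/-! ### Specialization of the universal case -/

section Specialization

open RootPairing.weylGroup (ofIdx)

variable {ι X Y : Type*} [AddCommGroup X] [AddCommGroup Y] {P : RootDatum ι X Y}

/-- The coefficients of the words are compatible with equivariant ring homomorphisms. -/
theorem TwistDatum.coeff_word_map {Q Q' : Type*} [CommRing Q] [CommRing Q']
    [MulSemiringAction P.weylGroup Q] [MulSemiringAction P.weylGroup Q'] (E : TwistDatum P Q)
    (E' : TwistDatum P Q') (ψ : Q →+* Q') (hψ : ∀ (w : P.weylGroup) q, ψ (w • q) = w • ψ q)
    (hx : ∀ a, ψ (E.x a) = E'.x a) (ht : ψ E.t = E'.t) (b : P.Base) (J : List b.support)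
    (w : P.weylGroup) : ψ ((E.word b J).coeff w) = (E'.word b J).coeff w := by
  have hy : ∀ a, ψ (E.y a) = E'.y a := fun a => by
    have h := congrArg ψ (E.x_mul_y a)
    rw [map_mul, map_one, hx] at h
    calc ψ (E.y a) = (E'.x a * E'.y a) * ψ (E.y a) := by rw [E'.x_mul_y, one_mul]
      _ = E'.x a * ψ (E.y a) * E'.y a := by ring
      _ = E'.y a := by rw [h, one_mul]
  induction J generalizing w with
  | nil =>
    simp only [TwistDatum.word, List.map_nil, List.prod_nil, SkewMonoidAlgebra.coeff_one]
    by_cases h : w = 1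
    · subst h
      rw [Finsupp.single_eq_same, Finsupp.single_eq_same, map_one]
    · rw [Finsupp.single_eq_of_ne h, Finsupp.single_eq_of_ne h, map_zero]
  | cons i J ih =>
    rw [E.word_cons, E.coeff_T_mul, E'.word_cons, E'.coeff_T_mul]
    simp only [map_add, map_mul, map_sub, map_one, hy, ht, ih, hψ]

variable {R : Type*} [CommRing R] (F : FormalGroup R)

theorem algebraMap_sx_mul_xInv (a : ι) :
    algebraMap (BaseRing F P) (LocRing F P) (sx F P (P.root a)) * xInv F P (P.root a) = 1 :=
  Ring.mul_inverse_cancel _ (isUnit_root F P a)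

variable (P) in
/-- The elements `x_a` and `t = x_γ` of the localized formal group algebra. -/
noncomputable def heckeDatum : TwistDatum P (LocRing F P) where
  x a := algebraMap (BaseRing F P) (LocRing F P) (sx F P (P.root a))
  y a := xInv F P (P.root a)
  t := algebraMap (BaseRing F P) (LocRing F P) (sgamma F P)
  x_mul_y := algebraMap_sx_mul_xInv F
  smul_x w a := by rw [weyl_smul_algebraMap, weylMap_root]; rfl
  smul_t w := by rw [weyl_smul_algebraMap, weylMap_sgamma]

theorem sEmb_eq (f : BaseRing F P) :
    sEmb F P f = SkewMonoidAlgebra.single 1 (algebraMap (BaseRing F P) (LocRing F P) f) := rfl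

theorem lusztigElt_eq (a : ι) : lusztigElt F P a = (heckeDatum P F).T a := by
  rw [lusztigElt, demazureElt, sEmb_eq, mul_sub, SkewMonoidAlgebra.single_mul_single,
    SkewMonoidAlgebra.single_mul_single, TwistDatum.T, one_mul, one_mul, one_smul,
    sub_eq_add_neg, add_assoc, ← SkewMonoidAlgebra.single_neg, ← SkewMonoidAlgebra.single_add,
    neg_add_eq_sub]
  rfl

variable (b : P.Base)

theorem lusztigWord_nil : lusztigWord F b [] = 1 := by simp [lusztigWord]

theorem lusztigWord_cons (i : b.support) (J : List b.support) :
    lusztigWord F b (i :: J) = lusztigElt F P i * lusztigWord F b J := by simp [lusztigWord]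

theorem lusztigWord_eq (J : List b.support) :
    lusztigWord F b J = (heckeDatum P F).word b J := by
  induction J with
  | nil => rw [lusztigWord_nil]; simp [TwistDatum.word]
  | cons i J ih => rw [lusztigWord_cons, TwistDatum.word_cons, ih, lusztigElt_eq]

section

variable [F.IsComm]

/-- The embedding of `ℤ γ ⊕` the root lattice into `ℤ γ ⊕ X`. -/
noncomputable def latIncl (P : RootDatum ι X Y) : ℤ × RootLattice P →+ ℤ × X :=
  (AddMonoidHom.id ℤ).prodMap (P.rootSpan ℤ).subtype.toAddMonoidHom

/-- The specialization homomorphism from the universal formal group algebra. -/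
noncomputable def specialize : UnivRing P →+* BaseRing F P :=
  fgaBaseChange F (classify F) ((Module.Basis.singleton Unit ℤ).prod b.toWeightBasisInt)
    (latIncl P)

theorem specialize_xvar (l : ℤ × RootLattice P) :
    specialize F b (xvar lazardLaw l) = xvar F (latIncl P l) :=
  fgaBaseChange_xvar _ _ (map_classify F) l

theorem specialize_univMap (w : P.weylGroup) (z : UnivRing P) :
    specialize F b (univMap P w z) = weylMap F P w (specialize F b z) := by
  have h : ∀ l, latIncl P (latMap P w l) =
      (AddMonoidHom.id ℤ).prodMap (DistribSMul.toAddMonoidHom X w) (latIncl P l) := fun l =>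
    Prod.ext rfl rfl
  exact fgaBaseChange_fgaMap ((Module.Basis.singleton Unit ℤ).prod b.toWeightBasisInt)
    (latIncl P) (map_classify F) (latMap P w) _ h z

theorem specialize_root (a : ι) :
    specialize F b (xvar lazardLaw (0, latRoot P a)) = sx F P (P.root a) :=
  specialize_xvar F b _

theorem univMonoid_le_comap_specialize :
    univMonoid P ≤ (rootMonoid F P).comap (specialize F b) := by
  rw [univMonoid, Submonoid.closure_le]
  rintro _ ⟨a, rfl⟩
  rw [SetLike.mem_coe, Submonoid.mem_comap, specialize_root]
  exact Submonoid.subset_closure ⟨a, rfl⟩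

/-- The specialization homomorphism between the localizations. -/
noncomputable def specializeLoc : UnivLoc P →+* LocRing F P :=
  IsLocalization.map (LocRing F P) (specialize F b) (univMonoid_le_comap_specialize F b)

theorem specializeLoc_algebraMap (z : UnivRing P) :
    specializeLoc F b (algebraMap (UnivRing P) (UnivLoc P) z) =
      algebraMap (BaseRing F P) (LocRing F P) (specialize F b z) :=
  IsLocalization.map_eq _ z

theorem specializeLoc_smul (w : P.weylGroup) (q : UnivLoc P) :
    specializeLoc F b (w • q) = w • specializeLoc F b q := by
  have : (specializeLoc F b).comp (MulSemiringAction.toRingHom P.weylGroup (UnivLoc P) w) =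
      (MulSemiringAction.toRingHom P.weylGroup (LocRing F P) w).comp (specializeLoc F b) := by
    refine IsLocalization.ringHom_ext (univMonoid P) (RingHom.ext fun z => ?_)
    change specializeLoc F b (w • algebraMap (UnivRing P) (UnivLoc P) z) =
      w • specializeLoc F b (algebraMap (UnivRing P) (UnivLoc P) z)
    rw [univ_smul_algebraMap, specializeLoc_algebraMap, specializeLoc_algebraMap,
      weyl_smul_algebraMap, specialize_univMap]
  exact RingHom.congr_fun this q

theorem specializeLoc_coeff_word (J : List b.support) (w : P.weylGroup) :
    specializeLoc F b (((univDatum P).word b J).coeff w) = (lusztigWord F b J).coeff w := by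
  rw [lusztigWord_eq]
  refine (univDatum P).coeff_word_map (heckeDatum P F) (specializeLoc F b)
    (specializeLoc_smul F b) (fun a => ?_) ?_ b J w
  · exact (specializeLoc_algebraMap F b _).trans (by rw [specialize_root]; rfl)
  · exact (specializeLoc_algebraMap F b _).trans (by rw [specialize_xvar]; rfl)

end

theorem coeff_finset_sum {k G α : Type*} [AddCommMonoid k] (s : Finset α)
    (f : α → SkewMonoidAlgebra k G) (v : G) :
    (∑ i ∈ s, f i).coeff v = ∑ i ∈ s, (f i).coeff v := by
  have : (∑ i ∈ s, f i).coeff = ∑ i ∈ s, (f i).coeff :=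
    map_sum (SkewMonoidAlgebra.coeffAddEquiv (k := k) (G := G)) f s
  rw [this, Finsupp.finsetSum_apply]

theorem coeff_smul_eq (f : BaseRing F P) (z : TwistedAlgebra F P) (w : P.weylGroup) :
    (f • z).coeff w = algebraMap (BaseRing F P) (LocRing F P) f * z.coeff w := by
  rw [SkewMonoidAlgebra.coeff_smul, Finsupp.smul_apply, Algebra.smul_def]

/-- Every product of the `T_i` is a combination of the `T_{I_w}` with coefficients in `S`. -/
theorem lusztigWord_mem_span [F.IsComm] [Finite ι] [P.IsReduced] [Fintype P.weylGroup]
    {I : P.weylGroup → List b.support} (hI : ∀ w, IsReducedWord b (I w) w) (J : List b.support) :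
    ∃ c : P.weylGroup → BaseRing F P,
      lusztigWord F b J = ∑ w, c w • lusztigWord F b (I w) := by
  obtain ⟨c, hc, h⟩ := (univDatum_isResidual P b).word_mem_span b hI J
  choose z hz using hc
  refine ⟨fun w => specialize F b (z w), SkewMonoidAlgebra.ext fun v => ?_⟩
  have h2 := congrArg (fun y => specializeLoc F b (SkewMonoidAlgebra.coeff y v)) h
  simp only [specializeLoc_coeff_word, coeff_finset_sum, map_sum] at h2
  rw [h2, coeff_finset_sum]
  refine Finset.sum_congr rfl fun w _ => ?_
  rw [coeff_smul_eq, SkewMonoidAlgebra.coeff_smul, Finsupp.smul_apply, smul_eq_mul, map_mul,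
    specializeLoc_coeff_word, ← hz, specializeLoc_algebraMap]

end Specialization

/-! ### Relations, linear independence and the span of the basis -/

section Relations

open RootPairing.weylGroup (ofIdx)

variable {ι X Y : Type*} [AddCommGroup X] [AddCommGroup Y] {P : RootDatum ι X Y}

namespace TwistDatum

variable {Q : Type*} [CommRing Q] [MulSemiringAction P.weylGroup Q] (E : TwistDatum P Q)

theorem T_mul_single_one (a : ι) (q : Q) :
    E.T a * .single 1 q - .single 1 (ofIdx P a • q) * E.T a =
      .single 1 (E.t * (E.y a * (q - ofIdx P a • q))) := by
  have h : ∀ u v : Q, (SkewMonoidAlgebra.single 1 u : SkewMonoidAlgebra Q P.weylGroup) -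
      .single 1 v = .single 1 (u - v) := fun u v => by
    rw [sub_eq_add_neg, sub_eq_add_neg, SkewMonoidAlgebra.single_add, SkewMonoidAlgebra.single_neg]
  rw [T, add_mul, mul_add]
  simp only [SkewMonoidAlgebra.single_mul_single, mul_one, one_mul, one_smul]
  rw [mul_comm (ofIdx P a • q) (1 - _), add_sub_add_right_eq_sub, h]
  congr 1
  ring

/-- The quadratic relation for `T_a`. -/
theorem T_quadratic {a : ι} (ha : ofIdx P a ≠ 1) :
    (E.T a - 1) * (E.T a + 1 - .single 1 (E.t * (E.y a + E.y (ofIdx P a • a)))) = 0 := by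
  set z := E.T a + 1 - .single 1 (E.t * (E.y a + E.y (ofIdx P a • a))) with hz
  have hT : E.T a = .single 1 (E.t * E.y a) + .single (ofIdx P a) (1 - E.t * E.y a) := rfl
  -- `z` is invariant under `δ_{s_a}`
  have hinv : .single (ofIdx P a) 1 * z = z := by
    have hz' : z = .single 1 (1 - E.t * E.y (ofIdx P a • a)) +
        .single (ofIdx P a) (1 - E.t * E.y a) := by
      rw [hz, hT, SkewMonoidAlgebra.one_def]
      refine SkewMonoidAlgebra.ext fun w => ?_
      simp only [sub_eq_add_neg, ← SkewMonoidAlgebra.single_neg, SkewMonoidAlgebra.coeff_add,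
        Finsupp.add_apply, SkewMonoidAlgebra.coeff_single]
      by_cases hw : w = 1
      · subst hw
        simp only [Finsupp.single_eq_same, Finsupp.single_eq_of_ne ha.symm]
        ring
      · simp only [Finsupp.single_eq_of_ne hw]
        ring
    rw [hz', mul_add, SkewMonoidAlgebra.single_mul_single, SkewMonoidAlgebra.single_mul_single,
      refl_mul_self, mul_one, one_mul, one_mul]
    simp only [smul_sub, smul_one, smul_mul', E.smul_t, E.smul_y, refl_idx_smul_self]
    rw [add_comm]
  have h1 : E.T a - 1 = .single 1 (1 - E.t * E.y a) * (.single (ofIdx P a) 1 - 1) := by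
    rw [mul_sub, SkewMonoidAlgebra.single_mul_single, one_smul, mul_one, one_mul, mul_one, hT,
      sub_eq_add_neg _ (SkewMonoidAlgebra.single 1 _), ← SkewMonoidAlgebra.single_neg, neg_sub,
      sub_eq_add_neg (E.t * _), SkewMonoidAlgebra.single_add, SkewMonoidAlgebra.single_neg,
      SkewMonoidAlgebra.one_def]
    abel
  rw [h1, mul_assoc, sub_mul, hinv, one_mul, sub_self, mul_zero]

end TwistDatum

variable {R : Type*} [CommRing R] (F : FormalGroup R)

theorem smul_eq_sEmb_mul (f : BaseRing F P) (z : TwistedAlgebra F P) : f • z = sEmb F P f * z := by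
  refine SkewMonoidAlgebra.ext fun w => ?_
  rw [coeff_smul_eq, sEmb_eq, SkewMonoidAlgebra.coeff_single_one_mul]

theorem zero_smul_eq_zero (z : TwistedAlgebra F P) : (0 : BaseRing F P) • z = 0 := by
  rw [smul_eq_sEmb_mul, map_zero, zero_mul]

theorem sum_smul_eq_sum [Fintype P.weylGroup] (a : P.weylGroup →₀ BaseRing F P)
    (z : P.weylGroup → TwistedAlgebra F P) :
    (a.sum fun w c => c • z w) = ∑ w, a w • z w :=
  Finsupp.sum_fintype a _ fun w => zero_smul_eq_zero F (z w)

section Integrality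

variable (P) in
/-- The pairing with the coroot of `a`, on `ℤ γ ⊕ X`. -/
def prodCoroot (a : ι) : ℤ × X →+ ℤ := (P.coroot' a).toAddMonoidHom.comp (AddMonoidHom.snd _ _)

variable [F.IsComm] [Module.Free ℤ X] [Module.Finite ℤ X]

theorem exists_demazure (a : ι) (f : BaseRing F P) :
    ∃ q, f - weylMap F P (ofIdx P a) f = sx F P (P.root a) * q := by
  have h := xvar_dvd_fgaMap_sub F (AddMonoidHom.id (ℤ × X))
    ((AddMonoidHom.id ℤ).prodMap (DistribSMul.toAddMonoidHom X (ofIdx P a)))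
    (prodCoroot P a) (0, P.root a) (fun l => by
      refine Prod.ext ?_ ?_
      · change l.1 = (prodCoroot P a l • (0 : ℤ)) + l.1
        rw [smul_zero, zero_add]
      · change l.2 = P.coroot' a l.2 • P.root a + ofIdx P a • l.2
        rw [refl_smul_eq, P.reflection_apply]
        abel) f
  rwa [fgaMap_id] at h

/-- The operator `Δ_a` on `S`. -/
noncomputable def demazure (a : ι) (f : BaseRing F P) : BaseRing F P := (exists_demazure F a f).choose

theorem demazure_spec (a : ι) (f : BaseRing F P) :
    f - weylMap F P (ofIdx P a) f = sx F P (P.root a) * demazure F a f :=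
  (exists_demazure F a f).choose_spec

theorem algebraMap_demazure (a : ι) (f : BaseRing F P) :
    algebraMap (BaseRing F P) (LocRing F P) (demazure F a f) = demazureOp F P a f := by
  rw [demazureOp, demazure_spec, map_mul, mul_right_comm, algebraMap_sx_mul_xInv, one_mul]

end Integrality

theorem exists_root_add_root_neg [F.IsComm] (P : RootDatum ι X Y) (a : ι) :
    ∃ g : BaseRing F P, sx F P (P.root a) + sx F P (-P.root a) =
      sx F P (P.root a) * sx F P (-P.root a) * g := by
  have := exists_xvar_add_neg F ((0, P.root a) : ℤ × X)
  rwa [Prod.neg_mk, neg_zero] at this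

/-- The element `κ_a` of `S`. -/
noncomputable def kappaBase [F.IsComm] (P : RootDatum ι X Y) (a : ι) : BaseRing F P :=
  (exists_root_add_root_neg F P a).choose

variable (P) in
theorem root_neg (a : ι) : P.root (ofIdx P a • a) = -P.root a := by
  change P.root (P.reflectionPerm a a) = -P.root a
  rw [P.root_reflectionPerm, P.reflection_apply_self]

theorem algebraMap_kappaBase [F.IsComm] (a : ι) :
    algebraMap (BaseRing F P) (LocRing F P) (kappaBase F P a) = kappa F P a := by
  have h : sx F P (P.root a) + sx F P (-P.root a) =
      sx F P (P.root a) * sx F P (-P.root a) * kappaBase F P a :=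
    (exists_root_add_root_neg F P a).choose_spec
  have h2 := congrArg (algebraMap (BaseRing F P) (LocRing F P)) h
  rw [map_add, map_mul, map_mul] at h2
  have e1 := algebraMap_sx_mul_xInv (P := P) F a
  have e2 := algebraMap_sx_mul_xInv (P := P) F (ofIdx P a • a)
  rw [root_neg P] at e2
  rw [kappa]
  generalize algebraMap (BaseRing F P) (LocRing F P) (sx F P (P.root a)) = x at *
  generalize algebraMap (BaseRing F P) (LocRing F P) (sx F P (-P.root a)) = x' at *
  generalize xInv F P (P.root a) = y at *
  generalize xInv F P (-P.root a) = y' at *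
  linear_combination (-(y * y')) * h2 +
    (y' - x' * y' * algebraMap (BaseRing F P) (LocRing F P) (kappaBase F P a)) * e1
      + (y - algebraMap (BaseRing F P) (LocRing F P) (kappaBase F P a)) * e2

variable (b : P.Base)

theorem lusztigElt_comm [F.IsComm] [Module.Free ℤ X] [Module.Finite ℤ X] (a : ι) (f : BaseRing F P) :
    lusztigElt F P a * sEmb F P f - sEmb F P (weylMap F P (ofIdx P a) f) * lusztigElt F P a =
      sEmb F P (sgamma F P * demazure F a f) := by
  have h := (heckeDatum P F).T_mul_single_one a (algebraMap (BaseRing F P) (LocRing F P) f)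
  rw [weyl_smul_algebraMap, ← map_sub] at h
  rw [lusztigElt_eq, sEmb_eq, sEmb_eq, h, sEmb_eq, map_mul, algebraMap_demazure, demazureOp,
    mul_comm (algebraMap _ _ (f - _))]
  rfl

theorem lusztigElt_quadratic [F.IsComm] {a : ι} (ha : ofIdx P a ≠ 1) :
    (lusztigElt F P a - 1) * (lusztigElt F P a + 1 -
      sEmb F P (sgamma F P * kappaBase F P a)) = 0 := by
  have h := (heckeDatum P F).T_quadratic ha
  rw [lusztigElt_eq, sEmb_eq, map_mul, algebraMap_kappaBase, kappa, ← root_neg P]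
  exact h

/-- The coefficient at `w` of a combination of the `T_{I_v}`, if no `v > w` contributes to it. -/
theorem coeff_sum_of_maximal [Finite ι] [P.IsReduced] [Fintype P.weylGroup]
    {I : P.weylGroup → List b.support} (hI : ∀ w, IsReducedWord b (I w) w) (c : P.weylGroup → BaseRing F P)
    (w : P.weylGroup) (hw : ∀ v, BruhatLT b w v → c v = 0) :
    (∑ v, c v • lusztigWord F b (I v)).coeff w =
      (heckeDatum P F).lead b w * algebraMap (BaseRing F P) (LocRing F P) (c w) := by
  rw [coeff_finset_sum, Finset.sum_eq_single w]
  · rw [coeff_smul_eq, lusztigWord_eq, (heckeDatum P F).coeff_of_reduced b (hI w), mul_comm]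
  · intro v _ hv
    rw [coeff_smul_eq]
    by_cases h0 : (lusztigWord F b (I v)).coeff w = 0
    · rw [h0, mul_zero]
    rw [lusztigWord_eq] at h0
    obtain ⟨K, hK, rfl⟩ := (heckeDatum P F).exists_sublist_of_coeff_ne_zero b h0
    obtain ⟨h1, h2⟩ := (isReducedWord_iff b).1 (hI v)
    obtain h | h := bruhat_of_sublist b hK (by rw [h1, h2])
    · exact absurd (h.trans h1) (Ne.symm hv)
    · rw [h1] at h
      rw [hw v h, map_zero, zero_mul]
  · exact fun h => absurd (Finset.mem_univ w) h

section Independent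

variable [F.IsComm] [Module.Free ℤ X] [Module.Finite ℤ X] (hreg : IsSigmaRegular F P)
include hreg

theorem rootMonoid_le_nonZeroDivisors : rootMonoid F P ≤ nonZeroDivisors (BaseRing F P) := by
  rw [rootMonoid, Submonoid.closure_le]
  rintro _ ⟨a, rfl⟩
  rw [SetLike.mem_coe, mem_nonZeroDivisors_iff]
  have h : ∀ z, sx F P (P.root a) * z = 0 → z = 0 := fun z => xvar_inr_mul_cancel F (hreg a)
  exact ⟨h, fun z hz => h z (by rwa [mul_comm])⟩

theorem algebraMap_injective : Function.Injective (algebraMap (BaseRing F P) (LocRing F P)) :=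
  IsLocalization.injective (M := rootMonoid F P) _ (rootMonoid_le_nonZeroDivisors F hreg)

/-- Up to the unit `x_a`, the element `1 - x_γ / x_a` is `x_a - x_γ`, which is not a zero divisor of
`S`. -/
theorem one_sub_mul_cancel (a : ι) {q : LocRing F P}
    (hq : (1 - (heckeDatum P F).t * (heckeDatum P F).y a) * q = 0) : q = 0 := by
  obtain ⟨z, s, rfl⟩ := IsLocalization.exists_mk'_eq (rootMonoid F P) q
  have h1 : algebraMap (BaseRing F P) (LocRing F P) ((sgamma F P - sx F P (P.root a)) * z) = 0 := by
    have hs := IsLocalization.mk'_spec' (LocRing F P) z s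
    have hxy : algebraMap (BaseRing F P) (LocRing F P) (sx F P (P.root a)) *
      (heckeDatum P F).y a = 1 := (heckeDatum P F).x_mul_y a
    have ht : algebraMap (BaseRing F P) (LocRing F P) (sgamma F P) = (heckeDatum P F).t := rfl
    rw [map_mul, map_sub, ← hs, ht]
    linear_combination (-(algebraMap (BaseRing F P) (LocRing F P) s *
      algebraMap (BaseRing F P) (LocRing F P) (sx F P (P.root a)))) * hq -
      (heckeDatum P F).t * (algebraMap (BaseRing F P) (LocRing F P) s *
        IsLocalization.mk' (LocRing F P) z s) * hxy
  have h2 := algebraMap_injective F hreg (h1.trans (map_zero _).symm)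
  rw [gamma_sub_mul_cancel F _ h2, IsLocalization.mk'_zero]

theorem lead_mul_cancel [Finite ι] (w : P.weylGroup) {q : LocRing F P}
    (hq : (heckeDatum P F).lead b w * q = 0) : q = 0 := by
  classical
  rw [TwistDatum.lead] at hq
  generalize inversions b w = s at hq
  induction s using Finset.induction_on with
  | empty => rwa [Finset.prod_empty, one_mul] at hq
  | insert a s ha ih =>
    rw [Finset.prod_insert ha, mul_assoc] at hq
    exact ih (one_sub_mul_cancel F hreg a hq)

variable [Finite ι] [P.IsReduced] {I : P.weylGroup → List b.support}
  (hI : ∀ w, IsReducedWord b (I w) w)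
include hI

/-- Compare the coefficients at an element of maximal length in the support of the relation. -/
theorem eq_zero_of_sum_eq_zero [Fintype P.weylGroup] {c : P.weylGroup → BaseRing F P}
    (hc : ∑ v, c v • lusztigWord F b (I v) = 0) (w : P.weylGroup) : c w = 0 := by
  classical
  by_contra hw
  obtain ⟨u, hu, hmax⟩ := Finset.exists_max_image (Finset.univ.filter fun v => c v ≠ 0) (len b)
    ⟨w, by simpa using hw⟩
  rw [Finset.mem_filter] at hu
  have h := coeff_sum_of_maximal F b hI c u fun v hv => by
    by_contra hv0
    exact (hmax v (by simpa using hv0)).not_gt hv.len_lt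
  rw [hc] at h
  exact hu.2 (algebraMap_injective F hreg
    ((lead_mul_cancel F b hreg u h.symm).trans (map_zero _).symm))

theorem linearIndependent_lusztigWord [Finite P.weylGroup] :
    LinearIndependent (BaseRing F P) fun w => lusztigWord F b (I w) := by
  have := Fintype.ofFinite P.weylGroup
  rw [Fintype.linearIndependent_iff]
  exact fun c hc => eq_zero_of_sum_eq_zero F b hreg hI hc

end Independent

section Span

theorem lusztigWord_mem (J : List b.support) : lusztigWord F b J ∈ heckeAlgebra F b := by
  induction J with
  | nil => rw [lusztigWord_nil]; exact one_mem _
  | cons i J ih => rw [lusztigWord_cons]; exact mul_mem (lusztigElt_mem F b i) ih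

variable [F.IsComm] [Finite ι] [P.IsReduced] {I : P.weylGroup → List b.support}
  (hI : ∀ w, IsReducedWord b (I w) w)
include hI

theorem lusztigWord_mem_submodule_span [Finite P.weylGroup] (J : List b.support) :
    lusztigWord F b J ∈
      Submodule.span (BaseRing F P) (Set.range fun w => lusztigWord F b (I w)) := by
  have := Fintype.ofFinite P.weylGroup
  obtain ⟨c, hc⟩ := lusztigWord_mem_span F b hI J
  rw [hc]
  exact sum_mem fun w _ => Submodule.smul_mem _ _ (Submodule.subset_span ⟨w, rfl⟩)

/-- The span contains `S` and the `T_i`, and is closed under products since the words are spanned by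
the chosen ones and `S` can be moved to the left of a word. -/
theorem span_lusztigWord [Module.Free ℤ X] [Module.Finite ℤ X] [Finite P.weylGroup] :
    (Submodule.span (BaseRing F P) (Set.range fun w => lusztigWord F b (I w)) :
      Set (TwistedAlgebra F P)) = heckeAlgebra F b := by
  set N := Submodule.span (BaseRing F P) (Set.range fun w => lusztigWord F b (I w)) with hN
  have hJ := lusztigWord_mem_submodule_span F b hI
  refine Set.Subset.antisymm ?_ ?_
  · intro z hz
    refine Submodule.span_induction (p := fun z _ => z ∈ heckeAlgebra F b) ?_ (zero_mem _)
      (fun x y _ _ => add_mem) (fun f z _ hz => ?_) hz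
    · rintro _ ⟨w, rfl⟩
      exact lusztigWord_mem F b (I w)
    · rw [smul_eq_sEmb_mul]
      exact mul_mem (sEmb_mem F b f) hz
  -- the span is stable under left multiplication by the generators
  · have hT : ∀ (i : b.support) (z), z ∈ N → lusztigElt F P i * z ∈ N := fun i z hz => by
      refine Submodule.span_induction (p := fun z _ => lusztigElt F P i * z ∈ N) ?_
        (by rw [mul_zero]; exact zero_mem _)
        (fun x y _ _ hx hy => by rw [mul_add]; exact add_mem hx hy) (fun f z hz ih => ?_) hz
      · rintro _ ⟨w, rfl⟩
        rw [← lusztigWord_cons]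
        exact hJ _
      · rw [smul_eq_sEmb_mul, ← mul_assoc, sub_eq_iff_eq_add.1 (lusztigElt_comm F (i : ι) f),
          add_mul, mul_assoc, ← smul_eq_sEmb_mul, ← smul_eq_sEmb_mul]
        exact add_mem (Submodule.smul_mem _ _ hz) (Submodule.smul_mem _ _ ih)
    have key : ∀ x ∈ heckeAlgebra F b, ∀ z ∈ N, x * z ∈ N := fun x hx => by
      refine Algebra.adjoin_induction (p := fun x _ => ∀ z ∈ N, x * z ∈ N) ?_ ?_ ?_ ?_ hx
      · rintro _ (⟨f, rfl⟩ | ⟨i, rfl⟩) z hz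
        · rw [← smul_eq_sEmb_mul]
          exact Submodule.smul_mem _ _ hz
        · exact hT i z hz
      · intro r z hz
        have : algebraMap R (TwistedAlgebra F P) r = sEmb F P (algebraMap R _ r) :=
          ((sEmb F P).commutes r).symm
        rw [this, ← smul_eq_sEmb_mul]
        exact Submodule.smul_mem _ _ hz
      · intro x y _ _ hx hy z hz
        rw [add_mul]
        exact add_mem (hx z hz) (hy z hz)
      · intro x y _ _ hx hy z hz
        rw [mul_assoc]
        exact hx _ (hy z hz)
    intro x hx
    have := key x hx 1 (lusztigWord_nil F b ▸ hJ [])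
    rwa [mul_one] at this

end Span

/-- Two products along reduced words of the same element differ by terms that are smaller in the
Bruhat order. -/
theorem exists_bruhat_expansion [F.IsComm] [Module.Free ℤ X] [Module.Finite ℤ X] [Finite ι]
    [P.IsReduced] [Finite P.weylGroup] (hreg : IsSigmaRegular F P) {I : P.weylGroup → List b.support}
    (hI : ∀ w, IsReducedWord b (I w) w) {v : P.weylGroup} {I' : List b.support}
    (hI' : IsReducedWord b I' v) :
    ∃ a : P.weylGroup →₀ BaseRing F P, (∀ w, a w ≠ 0 → BruhatLT b w v) ∧
      lusztigWord F b (I v) - lusztigWord F b I' = a.sum fun w c => c • lusztigWord F b (I w) := by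
  classical
  have := Fintype.ofFinite P.weylGroup
  obtain ⟨c, hc⟩ := lusztigWord_mem_span F b hI I'
  obtain ⟨h1, h2⟩ := (isReducedWord_iff b).1 hI'
  -- an element of maximal length violating this would be in the support of the word along `I'`,
  -- with coefficient `lead * c`
  have hsupp : ∀ w, c w ≠ 0 → w = v ∨ BruhatLT b w v := by
    by_contra! hbad
    obtain ⟨w, hw⟩ := hbad
    obtain ⟨u, hu, hmax⟩ := Finset.exists_max_image
      (Finset.univ.filter fun w => c w ≠ 0 ∧ w ≠ v ∧ ¬ BruhatLT b w v) (len b)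
      ⟨w, by simpa using hw⟩
    obtain ⟨-, hu0, huv, hub⟩ := Finset.mem_filter.1 hu
    have h := coeff_sum_of_maximal F b hI c u fun w' hw' => by
      by_contra hw0
      by_cases hb : w' = v ∨ BruhatLT b w' v
      · obtain rfl | hb := hb
        · exact hub hw'
        · exact hub (Relation.TransGen.trans hw' hb)
      · rw [not_or] at hb
        exact (hmax w' (Finset.mem_filter.2 ⟨Finset.mem_univ _, hw0, hb⟩)).not_gt hw'.len_lt
    rw [← hc] at h
    have h0 : (lusztigWord F b I').coeff u = 0 := by
      by_contra hne
      rw [lusztigWord_eq] at hne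
      obtain ⟨K, hK, rfl⟩ := (heckeDatum P F).exists_sublist_of_coeff_ne_zero b hne
      obtain h | h := bruhat_of_sublist b hK (by rw [h1, h2])
      · exact huv (h.trans h1)
      · exact hub (h1 ▸ h)
    rw [h0] at h
    exact hu0 (algebraMap_injective F hreg
      ((lead_mul_cancel F b hreg u h.symm).trans (map_zero _).symm))
  have hv : c v = 1 := by
    have h := coeff_sum_of_maximal F b hI c v fun w hw => by
      by_contra hw0
      obtain rfl | h := hsupp w hw0
      · exact hw.len_lt.false
      · exact (hw.len_lt.trans h.len_lt).false
    rw [← hc, lusztigWord_eq, (heckeDatum P F).coeff_of_reduced b hI'] at h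
    have h3 : (heckeDatum P F).lead b v *
        (algebraMap (BaseRing F P) (LocRing F P) (c v) - 1) = 0 := by
      rw [mul_sub, ← h, mul_one, sub_self]
    have h4 := lead_mul_cancel F b hreg v h3
    rw [sub_eq_zero] at h4
    exact algebraMap_injective F hreg (h4.trans (map_one _).symm)
  refine ⟨Finsupp.equivFunOnFinite.symm fun w => if w = v then 0 else -c w, fun w hw => ?_, ?_⟩
  · rw [Finsupp.equivFunOnFinite_symm_apply_apply] at hw
    split_ifs at hw with hwv
    · exact absurd rfl hw
    · exact (hsupp w (neg_ne_zero.1 hw)).resolve_left hwv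
  · rw [sum_smul_eq_sum, hc,
      ← Finset.add_sum_erase _ _ (Finset.mem_univ v),
      ← Finset.add_sum_erase (a := v) _ _ (Finset.mem_univ v), hv, one_smul, sub_add_cancel_left]
    simp only [Finsupp.equivFunOnFinite_symm_apply_apply]
    rw [if_true, zero_smul_eq_zero, zero_add, ← Finset.sum_neg_distrib]
    refine Finset.sum_congr rfl fun w hw => ?_
    rw [if_neg (Finset.ne_of_mem_erase hw), neg_smul]

end Relations

/-! ### Rank two: the difference of the two braid words -/

section RankTwo

open RootPairing.weylGroup (ofIdx)

variable {ι X Y : Type*} [AddCommGroup X] [AddCommGroup Y] {P : RootDatum ι X Y}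
variable (b : P.Base) [Finite ι] [P.IsReduced]

include b in
/-- The Weyl group acts faithfully on the finite set of roots, since an element of positive length
makes some positive root negative. -/
theorem finite_weylGroup : Finite P.weylGroup := by
  refine Finite.of_injective (fun (w : P.weylGroup) (a : ι) => w • a) fun v w h => ?_
  have htriv : ∀ a : ι, (v⁻¹ * w)⁻¹ • a = a := fun a => by
    have := congrFun h a
    rw [mul_inv_rev, inv_inv, mul_smul, inv_smul_eq_iff]
    exact this
  obtain ⟨J, hJ, hl⟩ := exists_length_eq_len b (v⁻¹ * w)
  cases J with
  | nil => exact inv_mul_eq_one.1 hJ.symm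
  | cons i J =>
    have := not_isPos_of_cons b ((isReducedWord_iff b).2 ⟨hJ, hl⟩)
    rw [htriv] at this
    exact absurd (isPos_simple b i) this

omit [Finite ι] [P.IsReduced] in
theorem altWord_succ_eq_append {B : Type*} (i j : B) (k : ℕ) :
    ∃ l, altWord i j (k + 1) = altWord i j k ++ [l] := by
  induction k generalizing i j with
  | zero => exact ⟨i, rfl⟩
  | succ k ih =>
    obtain ⟨l, hl⟩ := ih j i
    exact ⟨l, congrArg (List.cons i) hl⟩

theorem coxNum_ne_zero (i j : b.support) : coxNum b i j ≠ 0 := by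
  have := finite_weylGroup b
  exact (orderOf_pos _).ne'

/-- If `k + 1 = m_{ij}`, the element `s_i s_j ⋯` with `k` factors carries the last simple root of
the word `i, j, …` of length `k + 1` to `α_j`. -/
theorem wordProd_altWord_smul_last {i j l : b.support} {k : ℕ} (hk : k + 1 = coxNum b i j)
    (hl : altWord i j (k + 1) = altWord i j k ++ [l]) :
    wordProd b (altWord i j k) • (l : ι) = j := by
  set w := wordProd b (altWord i j k) with hw
  have h0 : w * ofIdx P l = ofIdx P j * w := by
    have h := wordProd_altWord_coxNum b i j
    rw [← hk, hl, wordProd_append, wordProd_cons, wordProd_nil, mul_one] at h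
    exact h.trans (wordProd_cons b j _)
  have hlen : len b w = k := len_altWord b (Or.inl (by lia))
  have hlen' : len b (w * ofIdx P l) = k + 1 := by
    have : w * ofIdx P l = wordProd b (altWord i j (k + 1)) := by
      rw [hl, wordProd_append, wordProd_cons, wordProd_nil, mul_one]
    rw [this]
    exact len_altWord b (Or.inl hk.le)
  refine refl_injective_of_isPos b ?_ (isPos_simple b j) ?_
  · have := (len_lt_refl_mul_iff b (w := w⁻¹) (isPos_simple b l)).1 (by
      rw [← refl_inv (l : ι), ← mul_inv_rev, len_inv, len_inv, hlen, hlen']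
      exact k.lt_succ_self)
    rwa [inv_inv] at this
  · rw [refl_smul, h0, mul_inv_cancel_right]

namespace TwistDatum

variable {Q : Type*} [CommRing Q] [MulSemiringAction P.weylGroup Q] (E : TwistDatum P Q)

/-- A product along a word in `i` and `j` of length at most `m_{ij}` is supported on the elements
of the dihedral group of at most that length. -/
theorem exists_altWord_of_coeff_ne_zero {i j : b.support} {J : List b.support}
    (hJ : ∀ l ∈ J, l = i ∨ l = j) (hl : J.length ≤ coxNum b i j) {v : P.weylGroup}
    (hv : (E.word b J).coeff v ≠ 0) :
    v = wordProd b (altWord i j (len b v)) ∨ v = wordProd b (altWord j i (len b v)) := by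
  obtain ⟨K, hK, rfl⟩ := E.exists_sublist_of_coeff_ne_zero b hv
  obtain ⟨N, hN, hle, -⟩ := wordProd_eq_dihedralElt b i j K fun l h => hJ l (hK.subset h)
  have hKl := hK.length_le
  rw [Int.abs_eq_natAbs] at hle
  have h := wordProd_altWord b i j N.natAbs
  have hlen : wordProd b K = wordProd b (altWord i j N.natAbs) ∨
      wordProd b K = wordProd b (altWord j i N.natAbs) := by
    rw [h.1, h.2, hN]
    obtain h | h := Int.natAbs_eq N
    · exact Or.inl (by rw [← h])
    · exact Or.inr (by rw [← h])
  have h1 : N.natAbs ≤ coxNum b i j := by lia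
  obtain h | h := hlen
  · have := len_altWord b (i := i) (j := j) (Or.inl h1)
    rw [h, this]
    exact Or.inl rfl
  · have := len_altWord b (i := j) (j := i) (Or.inl (coxNum_comm b i j ▸ h1))
    rw [h, this]
    exact Or.inr rfl

/-- The coefficient of a word of length `m_{ij}` in a length one less: it comes from omitting the
last letter of the first word, and from omitting the first letter of the second. -/
theorem coeff_braid_word {i j : b.support} {k : ℕ} (hk : k + 1 = coxNum b i j) :
    (E.word b (altWord i j (k + 1))).coeff (wordProd b (altWord i j k)) =
      (E.word b (altWord j i (k + 1))).coeff (wordProd b (altWord i j k)) := by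
  obtain ⟨l, hl⟩ := altWord_succ_eq_append i j k
  have hlast := wordProd_altWord_smul_last b hk hl
  set w := wordProd b (altWord i j k) with hw
  have hlen : len b w = k := len_altWord b (Or.inl (by lia))
  have hred : IsReducedWord b (altWord i j k) w := by
    rw [isReducedWord_iff, altWord_length, hlen]
    exact ⟨rfl, rfl⟩
  have htop : len b (ofIdx P j * w) = k + 1 := by
    have : ofIdx P j * w = wordProd b (altWord j i (k + 1)) := (wordProd_cons b j _).symm
    rw [this]
    exact len_altWord b (Or.inl (by rw [coxNum_comm, hk]))
  have htop' : w * (ofIdx P l)⁻¹ = ofIdx P j * w := by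
    rw [← hlast, refl_smul, inv_mul_cancel_right, refl_inv]
  have hzero : (E.word b (altWord i j k)).coeff (ofIdx P j * w) = 0 :=
    E.coeff_of_length_lt b (by rw [altWord_length, htop]; exact k.lt_succ_self)
  have hT : E.word b [l] =
    .single 1 (E.t * E.y l) + .single (ofIdx P l) (1 - E.t * E.y l) := by
    simp [word, T]
  rw [hl, word_append, hT, mul_add, SkewMonoidAlgebra.coeff_add, Finsupp.add_apply,
    SkewMonoidAlgebra.coeff_mul_single_one, SkewMonoidAlgebra.coeff_mul_single, htop', hzero,
    E.coeff_of_reduced b hred, smul_mul', E.smul_t, E.smul_y, hlast]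
  change _ = (E.word b (j :: altWord i j k)).coeff w
  rw [word_cons, coeff_T_mul, E.coeff_of_reduced b hred, hzero, smul_zero]
  ring

omit [Finite ι] [P.IsReduced] [MulSemiringAction P.weylGroup Q] in
theorem coeff_sub_apply (z z' : SkewMonoidAlgebra Q P.weylGroup) (w : P.weylGroup) :
    (z - z').coeff w = z.coeff w - z'.coeff w := by
  rw [SkewMonoidAlgebra.coeff_sub, Finsupp.sub_apply]

/-- The two braid words for `i` and `j` have the same coefficients in lengths `m_{ij} - 1` and
above. -/
theorem coeff_braid_sub {i j : b.support} {v : P.weylGroup} (hv : coxNum b i j ≤ len b v + 1) :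
    (E.word b (altWord i j (coxNum b i j)) - E.word b (altWord j i (coxNum b i j))).coeff v = 0 := by
  have hm := coxNum_ne_zero b i j
  obtain ⟨k, hk⟩ := Nat.exists_eq_succ_of_ne_zero hm
  by_contra hne
  rw [coeff_sub_apply] at hne
  have hor : (E.word b (altWord i j (coxNum b i j))).coeff v ≠ 0 ∨
      (E.word b (altWord j i (coxNum b i j))).coeff v ≠ 0 := by
    by_contra! h
    rw [h.1, h.2, sub_zero] at hne
    exact hne rfl
  have hle : len b v ≤ coxNum b i j := by
    by_contra! hlt
    obtain h | h := hor <;> exact h (E.coeff_of_length_lt b (by rwa [altWord_length]))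
  have hdih : v = wordProd b (altWord i j (len b v)) ∨ v = wordProd b (altWord j i (len b v)) := by
    obtain h | h := hor
    · exact E.exists_altWord_of_coeff_ne_zero b (fun l hl => mem_altWord hl)
        (altWord_length i j _).le h
    · exact E.exists_altWord_of_coeff_ne_zero b (fun l hl => (mem_altWord hl).symm)
        (altWord_length j i _).le h
  obtain hl | hl : len b v = coxNum b i j ∨ len b v = k := by lia
  · have hv0 : v = wordProd b (altWord i j (coxNum b i j)) := by
      rw [hl, ← wordProd_altWord_coxNum b i j, or_self] at hdih
      exact hdih
    rw [E.coeff_of_reduced b (w := v) ((isReducedWord_iff b).2 ⟨hv0.symm, by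
        rw [altWord_length, hl]⟩),
      E.coeff_of_reduced b (w := v) ((isReducedWord_iff b).2 ⟨by
        rw [hv0, wordProd_altWord_coxNum], by rw [altWord_length, hl]⟩), sub_self] at hne
    exact hne rfl
  · rw [hl] at hdih
    rw [hk] at hne
    obtain h | h := hdih
    · rw [h, E.coeff_braid_word b hk.symm, sub_self] at hne
      exact hne rfl
    · rw [h, E.coeff_braid_word b (i := j) (j := i) (by rw [coxNum_comm, hk]), sub_self] at hne
      exact hne rfl

theorem coeff_T_one (i : b.support) : (E.T i).coeff 1 = E.t * E.y i := by
  rw [T, SkewMonoidAlgebra.coeff_add, Finsupp.add_apply, SkewMonoidAlgebra.coeff_single,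
    SkewMonoidAlgebra.coeff_single, Finsupp.single_eq_same,
    Finsupp.single_eq_of_ne (simpleRefl_ne_one b i).symm, add_zero]

theorem coeff_T_self (i : b.support) : (E.T i).coeff (ofIdx P i) = 1 - E.t * E.y i := by
  rw [T, SkewMonoidAlgebra.coeff_add, Finsupp.add_apply, SkewMonoidAlgebra.coeff_single,
    SkewMonoidAlgebra.coeff_single, Finsupp.single_eq_same,
    Finsupp.single_eq_of_ne (simpleRefl_ne_one b i), zero_add]

omit [Finite ι] [P.IsReduced] in
theorem coeff_T_of_ne (a : ι) {w : P.weylGroup} (h1 : w ≠ 1) (h2 : w ≠ ofIdx P a) :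
    (E.T a).coeff w = 0 := by
  rw [T, SkewMonoidAlgebra.coeff_add, Finsupp.add_apply, SkewMonoidAlgebra.coeff_single,
    SkewMonoidAlgebra.coeff_single, Finsupp.single_eq_of_ne h1, Finsupp.single_eq_of_ne h2,
    add_zero]

variable {i j : b.support} (hij : i ≠ j)
include hij

omit [Finite ι] in
theorem _root_.FormalHecke.simpleRefl_ne : ofIdx P (i : ι) ≠ ofIdx P j :=
  fun h => hij (simpleRefl_injective b h)

theorem coeff_T_mul_T_one : (E.T i * E.T j).coeff 1 = E.t ^ 2 * (E.y i * E.y j) := by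
  rw [coeff_T_mul, mul_one, coeff_T_one,
    E.coeff_T_of_ne _ (simpleRefl_ne_one b i) (simpleRefl_ne b hij), smul_zero]
  ring

theorem coeff_T_mul_T_left :
    (E.T i * E.T j).coeff (ofIdx P i) = (1 - E.t * E.y i) * (E.t * E.y (ofIdx P i • j)) := by
  rw [coeff_T_mul, refl_mul_self, coeff_T_one,
    E.coeff_T_of_ne _ (simpleRefl_ne_one b i) (simpleRefl_ne b hij), smul_mul', smul_t, smul_y]
  ring

theorem coeff_T_mul_T_right :
    (E.T i * E.T j).coeff (ofIdx P j) = E.t * E.y i * (1 - E.t * E.y j) := by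
  rw [coeff_T_mul, coeff_T_self, E.coeff_T_of_ne _ (w := ofIdx P i * ofIdx P j), smul_zero]
  · ring
  · intro h
    refine simpleRefl_ne b hij ?_
    rw [← refl_inv (j : ι)]
    exact eq_inv_of_mul_eq_one_left h
  · intro h
    exact simpleRefl_ne_one b i (mul_eq_right.1 h)

end TwistDatum

end RankTwo

/-! ### The deformed braid relations -/

section Braid

open RootPairing.weylGroup (ofIdx)

variable {ι X Y : Type*} [AddCommGroup X] [AddCommGroup Y] {P : RootDatum ι X Y}
variable (b : P.Base) [Finite ι] [P.IsReduced]

/-- The root `s_i α_j = s_j α_i`, equal to `α_i + α_j`, is the middle positive root of a subsystem of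
type `A₂`. -/
theorem refl_smul_eq_of_coxNum_eq_three {i j : b.support} (h : coxNum b i j = 3) :
    ofIdx P (i : ι) • (j : ι) = ofIdx P (j : ι) • (i : ι) := by
  have h1 := wordProd_altWord_smul_last b (i := i) (j := j) (l := i) (k := 2) h.symm rfl
  have h2 : wordProd b (altWord i j 2) = ofIdx P i * ofIdx P j := by
    change wordProd b [i, j] = _
    rw [wordProd_cons, wordProd_cons, wordProd_nil, mul_one]
  rw [h2, mul_smul] at h1
  exact (congrArg (ofIdx P (i : ι) • ·) h1.symm).trans (refl_idx_smul_self _ _)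

theorem root_refl_smul_of_coxNum_eq_three {i j : b.support} (hij : i ≠ j)
    (h : coxNum b i j = 3) :
    P.root (ofIdx P (i : ι) • (j : ι)) = P.root i + P.root j := by
  have h1 : P.root (ofIdx P (i : ι) • (j : ι)) = P.root (ofIdx P (j : ι) • (i : ι)) :=
    congrArg P.root (refl_smul_eq_of_coxNum_eq_three b h)
  rw [root_smul, root_smul, refl_smul_eq, refl_smul_eq, P.reflection_apply_root,
    P.reflection_apply_root] at h1
  have hli := b.linearIndependent_pair_of_ne hij
  rw [LinearIndependent.pair_iff] at hli
  obtain ⟨h2, -⟩ := hli (-1 - P.pairing j i) (1 + P.pairing i j) (by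
    have := sub_eq_zero.2 h1
    rw [← this]
    module)
  rw [root_smul, refl_smul_eq, P.reflection_apply_root, show P.pairing j i = -1 by linarith]
  module

namespace TwistDatum

variable {Q : Type*} [CommRing Q] [MulSemiringAction P.weylGroup Q] (E : TwistDatum P Q)
variable {i j : b.support}

omit [Finite ι] [P.IsReduced] in
theorem word_altWord_three (h3 : coxNum b i j = 3) :
    E.word b (altWord i j (coxNum b i j)) - E.word b (altWord j i (coxNum b i j)) =
      E.T i * (E.T j * E.T i) - E.T j * (E.T i * E.T j) := by
  rw [h3]
  change E.word b [i, j, i] - E.word b [j, i, j] = _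
  simp [word]

variable (hij : i ≠ j)
include hij

theorem coeff_T_mul_T_mul_T_one : (E.T i * (E.T j * E.T i)).coeff 1 =
    E.t ^ 3 * (E.y i ^ 2 * E.y j) + (1 - E.t * E.y i) *
      (E.t * E.y (ofIdx P i • j) * (1 - E.t * E.y (ofIdx P i • i))) := by
  rw [coeff_T_mul, mul_one, E.coeff_T_mul_T_one b hij.symm, E.coeff_T_mul_T_right b hij.symm]
  simp only [smul_mul', smul_sub, smul_one, smul_t, smul_y]
  ring

theorem coeff_T_mul_T_mul_T_left : (E.T i * (E.T j * E.T i)).coeff (ofIdx P i) =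
    (1 - E.t * E.y i) * E.t ^ 2 *
      (E.y i * E.y j + E.y (ofIdx P i • j) * E.y (ofIdx P i • i)) := by
  rw [coeff_T_mul, refl_mul_self, E.coeff_T_mul_T_one b hij.symm,
    E.coeff_T_mul_T_right b hij.symm]
  simp only [smul_mul', smul_pow', smul_t, smul_y]
  ring

theorem coeff_T_mul_T_mul_T_middle (h3 : coxNum b i j = 3) :
    (E.T i * (E.T j * E.T i)).coeff (ofIdx P j) =
    (1 - E.t * E.y j) * E.t ^ 2 * (E.y i * E.y (ofIdx P i • j)) := by
  have hred : ∀ {k l : b.support}, k ≠ l → coxNum b k l = 3 →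
      len b (ofIdx P k * ofIdx P l) = 2 := fun {k l} _ h => by
    have := len_altWord b (i := k) (j := l) (k := 2) (Or.inl (by rw [h]; decide))
    have h2 : wordProd b (altWord k l 2) = ofIdx P k * ofIdx P l := by
      change wordProd b [k, l] = _
      rw [wordProd_cons, wordProd_cons, wordProd_nil, mul_one]
    rwa [h2] at this
  have h4 := hred hij h3
  have h5 := hred hij.symm (coxNum_comm b i j ▸ h3)
  have hne : ofIdx P (i : ι) * ofIdx P j ≠ ofIdx P j * ofIdx P i := fun h => by
    have h6 : orderOf (simpleRefl b i * simpleRefl b j) ∣ 2 := orderOf_dvd_of_pow_eq_one (by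
      change (ofIdx P (i : ι) * ofIdx P j) ^ 2 = 1
      rw [pow_two]
      nth_rewrite 2 [h]
      rw [mul_assoc, refl_mul_cancel, refl_mul_self])
    have h7 : coxNum b i j ∣ 2 := h6
    rw [h3] at h7
    exact absurd h7 (by decide)
  have hz : (E.T j * E.T i).coeff (ofIdx P (i : ι) * ofIdx P j) = 0 := by
    have := E.coeff_eq_zero_of_reduced b (J := [j, i]) (v := ofIdx P (i : ι) * ofIdx P j)
      (w := ofIdx P (j : ι) * ofIdx P i) ((isReducedWord_iff b).2 ⟨by
        rw [wordProd_cons, wordProd_cons, wordProd_nil, mul_one], by rw [h5]; rfl⟩) hne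
      (by rw [h4, h5])
    simpa [word] using this
  rw [coeff_T_mul, hz, smul_zero, E.coeff_T_mul_T_left b hij.symm,
    ← refl_smul_eq_of_coxNum_eq_three b h3]
  ring

end TwistDatum

variable {R : Type*} [CommRing R] (F : FormalGroup R)

omit [Finite ι] [P.IsReduced] in
theorem sub_smul_eq (f g : BaseRing F P) (z : TwistedAlgebra F P) :
    (f - g) • z = f • z - g • z := by
  rw [smul_eq_sEmb_mul, smul_eq_sEmb_mul, smul_eq_sEmb_mul, map_sub, sub_mul]

variable [F.IsComm] [Module.Free ℤ X] [Module.Finite ℤ X] (hreg : IsSigmaRegular F P)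
  {I : P.weylGroup → List b.support} (hI : ∀ w, IsReducedWord b (I w) w)
include hreg hI

/-- The expansion of the difference of the two braid words involves only elements of length at most
`m_{ij} - 2`, because the leading terms of those of larger length would not cancel. -/
theorem exists_braid_expansion [Fintype P.weylGroup] (i j : b.support) :
    ∃ c : P.weylGroup → BaseRing F P, (∀ v, c v ≠ 0 → len b v + 2 ≤ coxNum b i j) ∧
      lusztigWord F b (altWord i j (coxNum b i j)) - lusztigWord F b (altWord j i (coxNum b i j)) =
        ∑ v, c v • lusztigWord F b (I v) := by
  obtain ⟨c₁, h₁⟩ := lusztigWord_mem_span F b hI (altWord i j (coxNum b i j))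
  obtain ⟨c₂, h₂⟩ := lusztigWord_mem_span F b hI (altWord j i (coxNum b i j))
  have hsum : lusztigWord F b (altWord i j (coxNum b i j)) -
      lusztigWord F b (altWord j i (coxNum b i j)) =
        ∑ v, (c₁ v - c₂ v) • lusztigWord F b (I v) := by
    rw [h₁, h₂, ← Finset.sum_sub_distrib]
    exact Finset.sum_congr rfl fun v _ => (sub_smul_eq F _ _ _).symm
  refine ⟨fun v => c₁ v - c₂ v, fun v hv => ?_, hsum⟩
  by_contra hlen
  classical
  obtain ⟨u, hu, hmax⟩ := Finset.exists_max_image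
    (Finset.univ.filter fun v => c₁ v - c₂ v ≠ 0 ∧ ¬ len b v + 2 ≤ coxNum b i j) (len b)
    ⟨v, by simpa using ⟨hv, not_le.1 hlen⟩⟩
  obtain ⟨-, hu0, hul⟩ := Finset.mem_filter.1 hu
  have h := coeff_sum_of_maximal F b hI (fun v => c₁ v - c₂ v) u fun w hw => by
    by_contra hw0
    have h1 := hw.len_lt
    exact (hmax w (Finset.mem_filter.2 ⟨Finset.mem_univ _, hw0, by lia⟩)).not_gt h1
  rw [← hsum, lusztigWord_eq, lusztigWord_eq,
    (heckeDatum P F).coeff_braid_sub b (by lia)] at h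
  exact hu0 (algebraMap_injective F hreg
    ((lead_mul_cancel F b hreg u h.symm).trans (map_zero _).symm))

/-- The only possible term is at `1`, and the coefficient of `T_i T_j` there is `x_γ ^ 2 / (x_i x_j)`,
symmetric in `i` and `j`. -/
theorem eq_zero_of_braid_expansion_two [Fintype P.weylGroup] {i j : b.support} (hij : i ≠ j)
    (h2 : coxNum b i j = 2) {c : P.weylGroup → BaseRing F P}
    (hc : ∀ v, c v ≠ 0 → len b v + 2 ≤ coxNum b i j)
    (hsum : lusztigWord F b (altWord i j (coxNum b i j)) -
      lusztigWord F b (altWord j i (coxNum b i j)) = ∑ v, c v • lusztigWord F b (I v))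
    (v : P.weylGroup) : c v = 0 := by
  by_contra hv
  have h0 : len b v = 0 := by have := hc v hv; lia
  obtain ⟨J, hJ, hl⟩ := exists_length_eq_len b v
  rw [h0, List.length_eq_zero_iff] at hl
  rw [hl, wordProd_nil] at hJ
  subst hJ
  have h := coeff_sum_of_maximal F b hI c 1 fun w hw => by
    by_contra hw0
    have := hw.len_lt
    have := hc w hw0
    lia
  have hw : ∀ k l : b.support, (heckeDatum P F).word b (altWord k l 2) =
      (heckeDatum P F).T k * (heckeDatum P F).T l := fun k l => by
    change (heckeDatum P F).word b [k, l] = _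
    simp [TwistDatum.word]
  rw [← hsum, lusztigWord_eq, lusztigWord_eq, h2, hw, hw, TwistDatum.coeff_sub_apply,
    (heckeDatum P F).coeff_T_mul_T_one b hij, (heckeDatum P F).coeff_T_mul_T_one b hij.symm,
    mul_comm ((heckeDatum P F).y i), sub_self] at h
  exact hv (algebraMap_injective F hreg
    ((lead_mul_cancel F b hreg 1 h.symm).trans (map_zero _).symm))

end Braid

/-! ### The braid relation for `m_{ij} = 3` -/

section BraidThree

open RootPairing.weylGroup (ofIdx)

variable {ι X Y : Type*} [AddCommGroup X] [AddCommGroup Y] {P : RootDatum ι X Y}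
variable (b : P.Base) [Finite ι] [P.IsReduced]

theorem eq_simple_of_len_eq_one {v : P.weylGroup} (h : len b v = 1) {J : List b.support}
    (hJ : IsReducedWord b J v) : ∃ i : b.support, v = ofIdx P i ∧ J = [i] := by
  obtain ⟨h1, h2⟩ := (isReducedWord_iff b).1 hJ
  obtain ⟨i, rfl⟩ := List.length_eq_one_iff.1 (h2.trans h)
  refine ⟨i, ?_, rfl⟩
  rw [← h1, wordProd_cons, wordProd_nil, mul_one]

theorem word_simple {i : b.support} {J : List b.support} (hJ : IsReducedWord b J (ofIdx P i)) :
    J = [i] := by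
  obtain ⟨k, hk, rfl⟩ := eq_simple_of_len_eq_one b (len_simple b i) hJ
  rw [simpleRefl_injective b hk]

theorem eq_nil_of_isReducedWord_one {J : List b.support} (hJ : IsReducedWord b J 1) : J = [] := by
  obtain ⟨-, h2⟩ := (isReducedWord_iff b).1 hJ
  rwa [len_one, List.length_eq_zero_iff] at h2

variable {R : Type*} [CommRing R] (F : FormalGroup R)

omit [Finite ι] [P.IsReduced] in
theorem kappa_eq (a : ι) :
    kappa F P a = (heckeDatum P F).y a + (heckeDatum P F).y (ofIdx P a • a) := by
  rw [kappa, ← root_neg P]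
  rfl

theorem kappaTwo_eq {i j : b.support} (hij : i ≠ j) (h : coxNum b i j = 3) :
    kappaTwo F P i j = (heckeDatum P F).y (ofIdx P (i : ι) • (j : ι)) *
      ((heckeDatum P F).y j - (heckeDatum P F).y (ofIdx P (i : ι) • (i : ι))) -
      (heckeDatum P F).y i * (heckeDatum P F).y j := by
  rw [kappaTwo, ← root_refl_smul_of_coxNum_eq_three b hij h, ← root_neg P]
  rfl

theorem lead_simple (i : b.support) : (heckeDatum P F).lead b (ofIdx P (i : ι)) =
    1 - (heckeDatum P F).t * (heckeDatum P F).y i := by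
  have := (heckeDatum P F).lead_simple_mul b (i := i) (w := 1) (by
    rw [inv_one, one_smul]; exact isPos_simple b i)
  rwa [mul_one, TwistDatum.lead_one, smul_one, mul_one] at this

variable [F.IsComm] [Module.Free ℤ X] [Module.Finite ℤ X] (hreg : IsSigmaRegular F P)
  {I : P.weylGroup → List b.support} (hI : ∀ w, IsReducedWord b (I w) w)
  [Fintype P.weylGroup] {i j : b.support} (hij : i ≠ j) (h3 : coxNum b i j = 3)
  {c : P.weylGroup → BaseRing F P} (hc : ∀ v, c v ≠ 0 → len b v + 2 ≤ coxNum b i j)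
  (hsum : lusztigWord F b (altWord i j (coxNum b i j)) -
      lusztigWord F b (altWord j i (coxNum b i j)) = ∑ v, c v • lusztigWord F b (I v))
include hI h3 hc hsum

omit [F.IsComm] [Module.Free ℤ X] [Module.Finite ℤ X] in
theorem coeff_braid_three_of_len_eq_one {v : P.weylGroup} (hv : len b v = 1) :
    (heckeDatum P F).lead b v * algebraMap (BaseRing F P) (LocRing F P) (c v) =
    ((heckeDatum P F).T i * ((heckeDatum P F).T j * (heckeDatum P F).T i)).coeff v -
      ((heckeDatum P F).T j * ((heckeDatum P F).T i * (heckeDatum P F).T j)).coeff v := by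
  have h := coeff_sum_of_maximal F b hI c v fun w hw => by
    by_contra hw0
    have := hw.len_lt
    have := hc w hw0
    lia
  rw [← hsum, lusztigWord_eq, lusztigWord_eq, (heckeDatum P F).word_altWord_three b h3,
    TwistDatum.coeff_sub_apply] at h
  exact h.symm

include hreg

omit h3 hc hsum hI [P.IsReduced] [Fintype P.weylGroup] in
theorem lead_mul_left_cancel (v : P.weylGroup) {p q : LocRing F P}
    (h : (heckeDatum P F).lead b v * p = (heckeDatum P F).lead b v * q) : p = q :=
  sub_eq_zero.1 (lead_mul_cancel F b hreg v (by rw [mul_sub, h, sub_self]))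

include hij

theorem braid_three_right : algebraMap (BaseRing F P) (LocRing F P) (c (ofIdx P j)) =
    (heckeDatum P F).t ^ 2 * kappaTwo F P j i := by
  have h := coeff_braid_three_of_len_eq_one b F hI h3 hc hsum (len_simple b j)
  rw [(heckeDatum P F).coeff_T_mul_T_mul_T_middle b hij h3,
    (heckeDatum P F).coeff_T_mul_T_mul_T_left b hij.symm] at h
  refine lead_mul_left_cancel b F hreg _ (h.trans ?_)
  rw [lead_simple, kappaTwo_eq b F hij.symm (coxNum_comm b i j ▸ h3),
    refl_smul_eq_of_coxNum_eq_three b h3]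
  ring

theorem braid_three_left : algebraMap (BaseRing F P) (LocRing F P) (c (ofIdx P i)) =
    -((heckeDatum P F).t ^ 2 * kappaTwo F P i j) := by
  have h := coeff_braid_three_of_len_eq_one b F hI h3 hc hsum (len_simple b i)
  rw [(heckeDatum P F).coeff_T_mul_T_mul_T_left b hij,
    (heckeDatum P F).coeff_T_mul_T_mul_T_middle b hij.symm (coxNum_comm b i j ▸ h3)] at h
  refine lead_mul_left_cancel b F hreg _ (h.trans ?_)
  rw [lead_simple, kappaTwo_eq b F hij h3, refl_smul_eq_of_coxNum_eq_three b h3]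
  ring

theorem braid_three_eq_zero {v : P.weylGroup} (hj : v ≠ ofIdx P j) (hi : v ≠ ofIdx P i)
    (h1 : v ≠ 1) : c v = 0 := by
  by_contra hv
  have hle := hc v hv
  have hv0 : len b v ≠ 0 := fun h => by
    obtain ⟨J, hJ, hl⟩ := exists_length_eq_len b v
    rw [h, List.length_eq_zero_iff] at hl
    rw [hl, wordProd_nil] at hJ
    exact h1 hJ.symm
  have hv1 : len b v = 1 := by lia
  have key : ∀ k l : b.support, k ≠ l → coxNum b k l = 3 → v ≠ ofIdx P k → v ≠ ofIdx P l →
      ((heckeDatum P F).T k * ((heckeDatum P F).T l * (heckeDatum P F).T k)).coeff v = 0 := by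
    intro k l hkl h hk hl
    by_contra hne
    have hw : (heckeDatum P F).T k * ((heckeDatum P F).T l * (heckeDatum P F).T k) =
        (heckeDatum P F).word b [k, l, k] := by simp [TwistDatum.word]
    rw [hw] at hne
    have := (heckeDatum P F).exists_altWord_of_coeff_ne_zero b (i := k) (j := l) (by simp)
      (by rw [h]; rfl) hne
    rw [hv1] at this
    change v = wordProd b [k] ∨ v = wordProd b [l] at this
    rw [wordProd_cons, wordProd_cons, wordProd_nil, mul_one, mul_one] at this
    exact this.elim hk hl
  have h := coeff_braid_three_of_len_eq_one b F hI h3 hc hsum hv1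
  rw [key i j hij h3 hi hj, key j i hij.symm (coxNum_comm b i j ▸ h3) hj hi, sub_zero] at h
  exact hv (algebraMap_injective F hreg
    ((lead_mul_cancel F b hreg v h).trans (map_zero _).symm))

/-- The coefficient at `1`, from the comparison of the coefficients of `δ_1` after subtracting the
contributions of `T_i` and `T_j`. -/
theorem braid_three_one : algebraMap (BaseRing F P) (LocRing F P) (c 1) =
    (heckeDatum P F).t ^ 2 *
      ((kappa F P j - kappa F P i) * xInv F P (P.root i + P.root j)) := by
  classical
  have hone : ∀ k : b.support, (1 : P.weylGroup) ≠ ofIdx P k := fun k =>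
    (simpleRefl_ne_one b k).symm
  have hword : ∀ k : b.support, (lusztigWord F b (I (ofIdx P k))).coeff 1 =
      (heckeDatum P F).t * (heckeDatum P F).y k := fun k => by
    rw [word_simple b (hI _), lusztigWord_cons, lusztigWord_nil, mul_one, lusztigElt_eq,
      (heckeDatum P F).coeff_T_one]
  have h := congrArg (fun z => z.coeff (1 : P.weylGroup)) hsum
  rw [coeff_finset_sum, ← Finset.sum_subset (Finset.subset_univ {1, ofIdx P (i : ι), ofIdx P j})
      fun v _ hv => by
        simp only [Finset.mem_insert, Finset.mem_singleton, not_or] at hv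
        rw [braid_three_eq_zero b F hreg hI hij h3 hc hsum hv.2.2 hv.2.1 hv.1,
          zero_smul_eq_zero]
        rfl,
    Finset.sum_insert (by simp [hone]), Finset.sum_insert (by
      rw [Finset.mem_singleton]; exact simpleRefl_ne b hij), Finset.sum_singleton,
    coeff_smul_eq, coeff_smul_eq, coeff_smul_eq, hword, hword,
    eq_nil_of_isReducedWord_one b (hI 1), lusztigWord_nil, SkewMonoidAlgebra.coeff_one,
    Finsupp.single_eq_same, lusztigWord_eq, lusztigWord_eq,
    (heckeDatum P F).word_altWord_three b h3, TwistDatum.coeff_sub_apply,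
    (heckeDatum P F).coeff_T_mul_T_mul_T_one b hij,
    (heckeDatum P F).coeff_T_mul_T_mul_T_one b hij.symm,
    braid_three_left b F hreg hI hij h3 hc hsum, braid_three_right b F hreg hI hij h3 hc hsum,
    kappaTwo_eq b F hij h3, kappaTwo_eq b F hij.symm (coxNum_comm b i j ▸ h3),
    ← refl_smul_eq_of_coxNum_eq_three b h3] at h
  have hx : xInv F P (P.root i + P.root j) =
      (heckeDatum P F).y (ofIdx P (i : ι) • (j : ι)) := by
    rw [← root_refl_smul_of_coxNum_eq_three b hij h3]
    rfl
  rw [hx, kappa_eq, kappa_eq]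
  linear_combination -h

end BraidThree

/-! ### Algebras satisfying the relations are spanned by the products along reduced words -/

section Presentation

open RootPairing.weylGroup (ofIdx)

variable {ι X Y : Type*} [AddCommGroup X] [AddCommGroup Y] {P : RootDatum ι X Y} {b : P.Base}
variable {S A : Type*} [CommRing S] [Ring A] (σ : S →+* A) (τ : b.support → A)

/-- The product of the elements `τ_i` along a word in the simple roots. -/
def prodWord (J : List b.support) : A := (J.map τ).prod

theorem prodWord_nil : prodWord τ [] = 1 := rfl

theorem prodWord_cons (i : b.support) (J : List b.support) :
    prodWord τ (i :: J) = τ i * prodWord τ J := by simp [prodWord]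

theorem prodWord_append (J K : List b.support) :
    prodWord τ (J ++ K) = prodWord τ J * prodWord τ K := by simp [prodWord]

/-- The left `S`-span of the products along words of length less than `n`. -/
def shortSpan (n : ℕ) : AddSubgroup A :=
  AddSubgroup.closure {z | ∃ f J, J.length < n ∧ z = σ f * prodWord τ J}

theorem mul_prodWord_mem_shortSpan {n : ℕ} (f : S) {J : List b.support} (h : J.length < n) :
    σ f * prodWord τ J ∈ shortSpan σ τ n :=
  AddSubgroup.subset_closure ⟨f, J, h, rfl⟩

theorem prodWord_mem_shortSpan {n : ℕ} {J : List b.support} (h : J.length < n) :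
    prodWord τ J ∈ shortSpan σ τ n := by
  have := mul_prodWord_mem_shortSpan σ τ 1 h
  rwa [map_one, one_mul] at this

theorem shortSpan_le {n : ℕ} (N : AddSubgroup A)
    (h : ∀ f J, J.length < n → σ f * prodWord τ J ∈ N) : shortSpan σ τ n ≤ N := by
  rw [shortSpan, AddSubgroup.closure_le]
  rintro _ ⟨f, J, hJ, rfl⟩
  exact h f J hJ

theorem shortSpan_mono {m n : ℕ} (h : m ≤ n) : shortSpan σ τ m ≤ shortSpan σ τ n :=
  shortSpan_le σ τ _ fun f _ hJ => mul_prodWord_mem_shortSpan σ τ f (hJ.trans_le h)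

theorem mul_prodWord_mem_shortSpan_add {n : ℕ} {z : A} (hz : z ∈ shortSpan σ τ n)
    (K : List b.support) : z * prodWord τ K ∈ shortSpan σ τ (n + K.length) := by
  refine shortSpan_le σ τ ((shortSpan σ τ (n + K.length)).comap
    (AddMonoidHom.mulRight (prodWord τ K))) (fun g J hJ => ?_) hz
  change σ g * prodWord τ J * prodWord τ K ∈ shortSpan σ τ (n + K.length)
  rw [mul_assoc, ← prodWord_append]
  exact mul_prodWord_mem_shortSpan σ τ _ (by rw [List.length_append]; lia)

/-- Elements `τ_i` that satisfy, over `S`, relations of the form of the commutation, quadratic and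
deformed braid relations of a Hecke algebra. -/
structure IsHeckeSystem : Prop where
  comm (i : b.support) (f : S) : ∃ g h, τ i * σ f = σ g * τ i + σ h
  quad (i : b.support) : ∃ g h, τ i * τ i = σ g * τ i + σ h
  braid (i j : b.support) (hij : i ≠ j) :
    prodWord τ (altWord i j (coxNum b i j)) - prodWord τ (altWord j i (coxNum b i j)) ∈
      shortSpan σ τ (coxNum b i j)

namespace IsHeckeSystem

variable {σ τ} (H : IsHeckeSystem σ τ)
include H

theorem mul_mem_shortSpan (i : b.support) {n : ℕ} {z : A} (hz : z ∈ shortSpan σ τ n) :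
    τ i * z ∈ shortSpan σ τ (n + 1) := by
  refine shortSpan_le σ τ ((shortSpan σ τ (n + 1)).comap (AddMonoidHom.mulLeft (τ i)))
    (fun f J hJ => ?_) hz
  change τ i * (σ f * prodWord τ J) ∈ shortSpan σ τ (n + 1)
  obtain ⟨g, h, hgh⟩ := H.comm i f
  rw [← mul_assoc, hgh, add_mul, mul_assoc, ← prodWord_cons]
  exact add_mem (mul_prodWord_mem_shortSpan σ τ _ (by rw [List.length_cons]; lia))
    (mul_prodWord_mem_shortSpan σ τ _ (by lia))

theorem prodWord_mul_mem_shortSpan (K : List b.support) {n : ℕ} {z : A}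
    (hz : z ∈ shortSpan σ τ n) : prodWord τ K * z ∈ shortSpan σ τ (K.length + n) := by
  induction K with
  | nil => rwa [prodWord_nil, one_mul, List.length_nil, zero_add]
  | cons i K ih =>
    rw [prodWord_cons, mul_assoc, List.length_cons, Nat.add_right_comm]
    exact H.mul_mem_shortSpan i ih

/-- Braid moves change the products along words only by products along shorter words. -/
theorem prodWord_sub_mem_of_eqvGen {J K : List b.support} (h : Relation.EqvGen (BraidMove b) J K) :
    J.length = K.length ∧ prodWord τ J - prodWord τ K ∈ shortSpan σ τ J.length := by
  induction h with
  | rel J K h =>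
    obtain ⟨L, M, i, j, hij⟩ := h
    refine ⟨by simp [altWord_length], ?_⟩
    rw [prodWord_append, prodWord_append, prodWord_append, prodWord_append, ← mul_sub, ← sub_mul]
    have := H.prodWord_mul_mem_shortSpan L
      (mul_prodWord_mem_shortSpan_add σ τ (H.braid i j hij) M)
    simpa [altWord_length] using this
  | refl J => exact ⟨rfl, by rw [sub_self]; exact zero_mem _⟩
  | symm J K _ ih =>
    refine ⟨ih.1.symm, ?_⟩
    rw [← neg_sub, ← ih.1]
    exact neg_mem ih.2
  | trans J K L _ _ ih₁ ih₂ =>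
    refine ⟨ih₁.1.trans ih₂.1, ?_⟩
    rw [← sub_add_sub_cancel _ (prodWord τ K)]
    exact add_mem ih₁.2 (ih₁.1 ▸ ih₂.2)

variable [Finite ι] [P.IsReduced]

theorem prodWord_sub_mem {J K : List b.support} {w : P.weylGroup} (hJ : IsReducedWord b J w)
    (hK : IsReducedWord b K w) : prodWord τ J - prodWord τ K ∈ shortSpan σ τ J.length :=
  (H.prodWord_sub_mem_of_eqvGen (eqvGen_braidMove b hJ hK)).2

/-- If a reduced word becomes non-reduced after prepending a letter, braid moves bring an equal letter
to its front, and the quadratic relation shortens it. -/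
theorem prodWord_mem_of_not_reduced {J : List b.support}
    (hJ : len b (wordProd b J) ≠ J.length) : prodWord τ J ∈ shortSpan σ τ J.length := by
  induction J with
  | nil => exact absurd (len_one b) hJ
  | cons i J ih =>
    rw [prodWord_cons, List.length_cons]
    by_cases hred : len b (wordProd b J) = J.length
    · have hneg : ¬ b.IsPos ((wordProd b J)⁻¹ • (i : ι)) := fun h => by
        have := len_simple_mul_of_isPos b h
        rw [← wordProd_cons, hred] at this
        exact hJ this
      obtain ⟨K, hK, hl⟩ := exists_length_eq_len b (ofIdx P i * wordProd b J)
      have hlen := len_simple_mul_of_not_isPos b hneg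
      have hiK : IsReducedWord b (i :: K) (wordProd b J) := by
        rw [isReducedWord_iff, wordProd_cons, hK, refl_mul_cancel, List.length_cons, hl, hlen]
        exact ⟨rfl, rfl⟩
      have hsub := H.mul_mem_shortSpan i
        (H.prodWord_sub_mem ((isReducedWord_self_iff b).2 hred) hiK)
      obtain ⟨g, h, hgh⟩ := H.quad i
      have hKJ : K.length + 1 = J.length := by rw [hl, hlen, hred]
      rw [mul_sub, prodWord_cons, ← mul_assoc, hgh, add_mul, mul_assoc, ← prodWord_cons] at hsub
      have := add_mem hsub (add_mem (mul_prodWord_mem_shortSpan σ τ (n := J.length + 1) g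
        (J := i :: K) (by rw [List.length_cons]; lia))
        (mul_prodWord_mem_shortSpan σ τ (n := J.length + 1) h (J := K) (by lia)))
      rwa [prodWord_cons τ i K, sub_add_cancel, prodWord_cons] at this
    · exact H.mul_mem_shortSpan i (ih hred)

/-- The products along words are left combinations of the products along chosen reduced words. -/
theorem exists_prodWord_eq_sum [Fintype P.weylGroup] {I : P.weylGroup → List b.support}
    (hI : ∀ w, IsReducedWord b (I w) w) (J : List b.support) :
    ∃ c : P.weylGroup → S, prodWord τ J = ∑ w, σ (c w) * prodWord τ (I w) := by
  classical
  let N : AddSubgroup A :=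
    { carrier := {z | ∃ c : P.weylGroup → S, z = ∑ w, σ (c w) * prodWord τ (I w)}
      zero_mem' := ⟨0, by simp⟩
      add_mem' := by
        rintro _ _ ⟨c, rfl⟩ ⟨d, rfl⟩
        exact ⟨c + d, by simp [add_mul, Finset.sum_add_distrib]⟩
      neg_mem' := by
        rintro _ ⟨c, rfl⟩
        exact ⟨-c, by simp⟩ }
  have hscalar : ∀ (f : S) {z}, z ∈ N → σ f * z ∈ N := by
    rintro f _ ⟨c, rfl⟩
    exact ⟨fun w => f * c w, by simp [Finset.mul_sum, mul_assoc]⟩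
  have hbasis : ∀ w, prodWord τ (I w) ∈ N := fun w =>
    ⟨Pi.single w 1, by
      rw [Finset.sum_eq_single w (fun v _ hv => by rw [Pi.single_eq_of_ne hv, map_zero, zero_mul])
        fun h => absurd (Finset.mem_univ w) h, Pi.single_eq_same, map_one, one_mul]⟩
  suffices h : ∀ n, shortSpan σ τ n ≤ N from
    h _ (prodWord_mem_shortSpan σ τ J.length.lt_succ_self)
  intro n
  induction n with
  | zero => exact shortSpan_le σ τ N fun f J hJ => absurd hJ (Nat.not_lt_zero _)
  | succ n ih =>
    refine shortSpan_le σ τ N fun f J hJ => hscalar f ?_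
    by_cases hred : len b (wordProd b J) = J.length
    · have h1 := H.prodWord_sub_mem ((isReducedWord_self_iff b).2 hred) (hI (wordProd b J))
      have h2 := add_mem (ih (shortSpan_mono σ τ (Nat.le_of_lt_succ hJ) h1)) (hbasis (wordProd b J))
      rwa [sub_add_cancel] at h2
    · exact ih (shortSpan_mono σ τ (Nat.le_of_lt_succ hJ) (H.prodWord_mem_of_not_reduced hred))

theorem mul_sum_mem [Fintype P.weylGroup] {I : P.weylGroup → List b.support}
    (hI : ∀ w, IsReducedWord b (I w) w) (i : b.support) (c : P.weylGroup → S) :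
    ∃ d : P.weylGroup → S, τ i * ∑ w, σ (c w) * prodWord τ (I w) =
      ∑ w, σ (d w) * prodWord τ (I w) := by
  choose g h hgh using fun w => H.comm i (c w)
  choose e he using fun w => H.exists_prodWord_eq_sum hI (i :: I w)
  refine ⟨fun v => ∑ w, g w * e w v + h v, ?_⟩
  simp only [map_add, map_sum, map_mul, add_mul, Finset.sum_mul, Finset.sum_add_distrib]
  rw [Finset.sum_comm, ← Finset.sum_add_distrib, Finset.mul_sum]
  refine Finset.sum_congr rfl fun w _ => ?_
  rw [← mul_assoc, hgh, add_mul, mul_assoc, ← prodWord_cons, he, Finset.mul_sum]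
  simp only [mul_assoc]

end IsHeckeSystem

variable {R : Type*} [CommRing R] {F : FormalGroup R}
variable {k : b.support → BaseRing F P} {D : b.support → BaseRing F P → BaseRing F P}
  {I : P.weylGroup → List b.support} {u : b.support → b.support → P.weylGroup →₀ BaseRing F P}

section RingQuot

variable (k D I u)

/-- The homomorphism from `S` to the algebra defined by generators and relations. -/
noncomputable def relEmb : BaseRing F P →ₐ[R] RingQuot (HeckeRel F b k D I u) where
  toFun f := RingQuot.mkAlgHom R _ (gS F b f)
  map_one' := by
    have := RingQuot.mkAlgHom_rel R (HeckeRel.scalar (k := k) (D := D) (I := I) (u := u) (1 : R))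
    rwa [map_one, map_one, map_one] at this
  map_mul' f g :=
    (RingQuot.mkAlgHom_rel R (HeckeRel.mul f g)).trans (map_mul _ _ _)
  map_zero' := by
    have := RingQuot.mkAlgHom_rel R (HeckeRel.scalar (k := k) (D := D) (I := I) (u := u) (0 : R))
    rwa [map_zero, map_zero, map_zero] at this
  map_add' f g :=
    (RingQuot.mkAlgHom_rel R (HeckeRel.add f g)).trans (map_add _ _ _)
  commutes' r :=
    (RingQuot.mkAlgHom_rel R (HeckeRel.scalar r)).trans (AlgHom.commutes _ r)

/-- The generators `T_i` of the algebra defined by generators and relations. -/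
noncomputable def relGen (i : b.support) : RingQuot (HeckeRel F b k D I u) :=
  RingQuot.mkAlgHom R _ (gT F b i)

theorem mkAlgHom_gWord (J : List b.support) :
    RingQuot.mkAlgHom R (HeckeRel F b k D I u) (gWord F b J) = prodWord (relGen k D I u) J := by
  induction J with
  | nil => simp [gWord, prodWord]
  | cons i J ih =>
    rw [prodWord_cons, ← ih, relGen, ← map_mul]
    simp [gWord]

theorem relGen_mul_relEmb (i : b.support) (f : BaseRing F P) :
    relGen k D I u i * relEmb k D I u f =
      relEmb k D I u (weylMap F P (simpleRefl b i) f) * relGen k D I u i +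
        relEmb k D I u (sgamma F P * D i f) := by
  have := RingQuot.mkAlgHom_rel R (HeckeRel.comm (k := k) (D := D) (I := I) (u := u) i f)
  rw [map_sub, map_mul, map_mul, sub_eq_iff_eq_add, add_comm] at this
  exact this

/-- The generators of the presented algebra satisfy the relations of a Hecke system. -/
theorem isHeckeSystem_relGen [Finite ι] [P.IsReduced]
    (hI : ∀ w, IsReducedWord b (I w) w)
    (hu : ∀ i j, i ≠ j → ∀ v, u i j v ≠ 0 → len b v + 2 ≤ coxNum b i j) :
    IsHeckeSystem (relEmb k D I u : BaseRing F P →+* _) (relGen k D I u) where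
  comm i f := ⟨_, _, relGen_mul_relEmb k D I u i f⟩
  quad i := by
    refine ⟨weylMap F P (simpleRefl b i) (sgamma F P * k i),
      sgamma F P * D i (sgamma F P * k i) + 1 - sgamma F P * k i, ?_⟩
    have h1 := relGen_mul_relEmb k D I u i (sgamma F P * k i)
    have h2 := RingQuot.mkAlgHom_rel R (HeckeRel.quad (k := k) (D := D) (I := I) (u := u) i)
    rw [map_zero, map_mul, map_sub, map_sub, map_add, map_one] at h2
    change (relGen k D I u i - 1) * (relGen k D I u i + 1 -
      relEmb k D I u (sgamma F P * k i)) = 0 at h2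
    rw [sub_mul, one_mul, mul_sub, mul_add, mul_one, h1, sub_eq_zero, sub_eq_iff_eq_add] at h2
    change _ = relEmb k D I u _ * _ + relEmb k D I u _
    rw [map_sub, map_add, map_one, eq_sub_of_add_eq h2]
    abel
  braid i j hij := by
    have := RingQuot.mkAlgHom_rel R (HeckeRel.braid (k := k) (D := D) (I := I) (u := u) i j hij)
    rw [map_sub, mkAlgHom_gWord, mkAlgHom_gWord] at this
    rw [this, Finsupp.sum, map_sum]
    refine sum_mem fun v hv => ?_
    rw [map_mul, mkAlgHom_gWord]
    refine mul_prodWord_mem_shortSpan _ _ (u i j v) ?_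
    have := hu i j hij v (Finsupp.mem_support_iff.1 hv)
    have hl : (I v).length = len b v := ((isReducedWord_iff b).1 (hI v)).2
    lia

/-- The presented algebra is spanned over `S` by the products along the chosen reduced words. -/
theorem exists_eq_sum_relEmb_mul [Finite ι] [P.IsReduced] [Fintype P.weylGroup]
    (hI : ∀ w, IsReducedWord b (I w) w)
    (hu : ∀ i j, i ≠ j → ∀ v, u i j v ≠ 0 → len b v + 2 ≤ coxNum b i j)
    (x : RingQuot (HeckeRel F b k D I u)) :
    ∃ c : P.weylGroup → BaseRing F P,
      x = ∑ w, relEmb k D I u (c w) * prodWord (relGen k D I u) (I w) := by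
  have H := isHeckeSystem_relGen k D I u hI hu
  obtain ⟨p, rfl⟩ := RingQuot.mkAlgHom_surjective R _ x
  obtain ⟨c₁, h₁⟩ := H.exists_prodWord_eq_sum hI []
  -- the set of combinations is stable under left multiplication by every element
  suffices h : ∀ c : P.weylGroup → BaseRing F P, ∃ d : P.weylGroup → BaseRing F P,
      RingQuot.mkAlgHom R (HeckeRel F b k D I u) p *
        ∑ w, relEmb k D I u (c w) * prodWord (relGen k D I u) (I w) =
        ∑ w, relEmb k D I u (d w) * prodWord (relGen k D I u) (I w) by
    obtain ⟨d, hd⟩ := h c₁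
    refine ⟨d, hd ▸ ?_⟩
    change _ = _ * ∑ w, (relEmb k D I u : BaseRing F P →+* RingQuot (HeckeRel F b k D I u)) (c₁ w) * _
    rw [← h₁, prodWord_nil, mul_one]
  have hscalar : ∀ (f : BaseRing F P) (c : P.weylGroup → BaseRing F P),
      relEmb k D I u f * ∑ w, relEmb k D I u (c w) * prodWord (relGen k D I u) (I w) =
        ∑ w, relEmb k D I u (f * c w) * prodWord (relGen k D I u) (I w) := fun f c => by
    simp only [Finset.mul_sum, map_mul, mul_assoc]
  induction p using FreeAlgebra.induction with
  | grade0 r =>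
    intro c
    refine ⟨fun w => algebraMap R _ r * c w, ?_⟩
    rw [← hscalar, AlgHom.commutes, AlgHom.commutes]
  | grade1 y =>
    intro c
    obtain f | i := y
    · exact ⟨_, hscalar f c⟩
    · exact H.mul_sum_mem hI i c
  | mul p q hp hq =>
    intro c
    obtain ⟨d, hd⟩ := hq c
    obtain ⟨e, he⟩ := hp d
    exact ⟨e, by rw [map_mul, mul_assoc, hd, he]⟩
  | add p q hp hq =>
    intro c
    obtain ⟨d, hd⟩ := hp c
    obtain ⟨e, he⟩ := hq c
    refine ⟨fun w => d w + e w, ?_⟩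
    simp only [map_add, add_mul, Finset.sum_add_distrib, hd, he]

end RingQuot

/-- The algebra defined by generators and relations is the Hecke algebra: it is spanned by the
products along the chosen reduced words, and the images of these are linearly independent. -/
theorem exists_presentation [F.IsComm] [Module.Free ℤ X] [Module.Finite ℤ X] [Finite ι]
    [P.IsReduced] (hreg : IsSigmaRegular F P) (hI : ∀ w, IsReducedWord b (I w) w)
    (hk : ∀ i, k i = kappaBase F P i) (hD : ∀ i f, D i f = demazure F (i : ι) f)
    (hu : ∀ i j, i ≠ j → ∀ v, u i j v ≠ 0 → len b v + 2 ≤ coxNum b i j)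
    (hbraid : ∀ i j, i ≠ j → lusztigWord F b (altWord i j (coxNum b i j)) -
      lusztigWord F b (altWord j i (coxNum b i j)) =
        (u i j).sum fun v c => c • lusztigWord F b (I v)) :
    ∃ e : RingQuot (HeckeRel F b k D I u) ≃ₐ[R] heckeAlgebra F b,
      (∀ f, (e (RingQuot.mkAlgHom R _ (gS F b f)) : TwistedAlgebra F P) = sEmb F P f) ∧
      (∀ i, (e (RingQuot.mkAlgHom R _ (gT F b i)) : TwistedAlgebra F P) = lusztigElt F P i) := by
  have := finite_weylGroup b
  have := Fintype.ofFinite P.weylGroup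
  let ψ : FreeAlgebra R (BaseRing F P ⊕ b.support) →ₐ[R] TwistedAlgebra F P :=
    FreeAlgebra.lift R (Sum.elim (fun f => sEmb F P f) fun i => lusztigElt F P i)
  have hψS : ∀ f, ψ (gS F b f) = sEmb F P f := fun f => FreeAlgebra.lift_ι_apply _ _
  have hψT : ∀ i, ψ (gT F b i) = lusztigElt F P i := fun i => FreeAlgebra.lift_ι_apply _ _
  have hψW : ∀ J, ψ (gWord F b J) = lusztigWord F b J := fun J => by
    induction J with
    | nil => rw [lusztigWord_nil]; simp [gWord]
    | cons i J ih =>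
      rw [lusztigWord_cons, ← ih, ← hψT, ← map_mul]
      simp [gWord]
  have hrel : ∀ ⦃x y⦄, HeckeRel F b k D I u x y → ψ x = ψ y := by
    rintro _ _ (⟨f, g⟩ | ⟨f, g⟩ | r | ⟨i, f⟩ | i | ⟨i, j, hij⟩)
    · rw [map_add, hψS, hψS, hψS, map_add]
    · rw [map_mul, hψS, hψS, hψS, map_mul]
    · rw [hψS, AlgHom.commutes, AlgHom.commutes]
    · rw [map_sub, map_mul, map_mul, hψS, hψS, hψS, hψT, hD]
      exact lusztigElt_comm F (i : ι) f
    · rw [map_mul, map_sub, map_sub, map_add, map_one, map_zero, hψT, hψS, hk]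
      exact lusztigElt_quadratic F (simpleRefl_ne_one b i)
    · rw [map_sub, hψW, hψW, hbraid i j hij, Finsupp.sum, Finsupp.sum, map_sum]
      refine Finset.sum_congr rfl fun v _ => ?_
      rw [map_mul, hψS, hψW, smul_eq_sEmb_mul]
  let Φ : RingQuot (HeckeRel F b k D I u) →ₐ[R] TwistedAlgebra F P :=
    RingQuot.liftAlgHom R ⟨ψ, hrel⟩
  have hΦ : ∀ p, Φ (RingQuot.mkAlgHom R _ p) = ψ p := RingQuot.liftAlgHom_mkAlgHom_apply R ψ hrel
  have hinj : Function.Injective Φ := by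
    rw [injective_iff_map_eq_zero]
    intro x hx
    obtain ⟨c, rfl⟩ := exists_eq_sum_relEmb_mul k D I u hI hu x
    have h0 : ∑ w, c w • lusztigWord F b (I w) = 0 := by
      rw [← hx, map_sum]
      refine Finset.sum_congr rfl fun w _ => ?_
      rw [map_mul, ← mkAlgHom_gWord, hΦ, hψW, smul_eq_sEmb_mul, ← hψS, ← hΦ]
      rfl
    refine Finset.sum_eq_zero fun w _ => ?_
    rw [eq_zero_of_sum_eq_zero F b hreg hI h0 w, map_zero, zero_mul]
  have hrange : Φ.range = heckeAlgebra F b := by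
    refine le_antisymm ?_ (Algebra.adjoin_le ?_)
    · rintro _ ⟨x, rfl⟩
      obtain ⟨c, rfl⟩ := exists_eq_sum_relEmb_mul k D I u hI hu x
      change Φ _ ∈ _
      rw [map_sum]
      refine sum_mem fun w _ => ?_
      rw [map_mul, ← mkAlgHom_gWord, hΦ, hψW]
      refine mul_mem ?_ (lusztigWord_mem F b (I w))
      change Φ (RingQuot.mkAlgHom R _ _) ∈ _
      rw [hΦ, hψS]
      exact sEmb_mem F b _
    · rintro _ (⟨f, rfl⟩ | ⟨i, rfl⟩)
      · exact ⟨_, (hΦ _).trans (hψS f)⟩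
      · exact ⟨_, (hΦ _).trans (hψT i)⟩
  refine ⟨(AlgEquiv.ofInjective Φ hinj).trans (Subalgebra.equivOfEq _ _ hrange), fun f => ?_,
    fun i => ?_⟩
  · exact (hΦ _).trans (hψS f)
  · exact (hΦ _).trans (hψT i)

end Presentation

end FormalHecke

theorem mainTheorem6 {R : Type*} [CommRing R] (F : FormalGroup R) [F.IsComm]
    {ι X Y : Type*} [Finite ι] [Nonempty ι] [AddCommGroup X] [AddCommGroup Y]
    [Module.Finite ℤ X] [Module.Finite ℤ Y]
    (P : RootDatum ι X Y) [P.IsReduced] (hss : IsSemisimple P) (b : P.Base)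
    (hreg : IsSigmaRegular F P)
    (I : P.weylGroup → List b.support) (hI : ∀ w, IsReducedWord b (I w) w) :
    -- (1) the `T_{I_w}` form a basis of the left `S`-module `H_F`
    (LinearIndependent (BaseRing F P) (fun w => lusztigWord F b (I w)) ∧
      (Submodule.span (BaseRing F P) (Set.range fun w => lusztigWord F b (I w)) :
        Set (TwistedAlgebra F P)) = heckeAlgebra F b) ∧
    -- (2) dependence of `T_{I_v}` on the reduced sequence
    (∀ (v : P.weylGroup) (I' : List b.support), IsReducedWord b I' v →
      ∃ a : P.weylGroup →₀ BaseRing F P, (∀ w, a w ≠ 0 → BruhatLT b w v) ∧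
        lusztigWord F b (I v) - lusztigWord F b I' = a.sum fun w c => c • lusztigWord F b (I w)) ∧
    -- (3) the presentation of `H_F`
    (∃ (k : b.support → BaseRing F P) (D : b.support → BaseRing F P → BaseRing F P)
      (u : b.support → b.support → P.weylGroup →₀ BaseRing F P),
      -- `κ_i` and `Δ_i(f)` lie in `S`
      (∀ i, algebraMap (BaseRing F P) (LocRing F P) (k i) = kappa F P i) ∧
      (∀ i f, algebraMap (BaseRing F P) (LocRing F P) (D i f) = demazureOp F P i f) ∧
      -- the deformed braid relations hold in `H_F`
      (∀ i j, i ≠ j →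
        (∀ v, u i j v ≠ 0 → len b v + 2 ≤ coxNum b i j) ∧
        lusztigWord F b (altWord i j (coxNum b i j)) - lusztigWord F b (altWord j i (coxNum b i j)) =
          (u i j).sum fun v c => c • lusztigWord F b (I v)) ∧
      -- they read `T_i T_j = T_j T_i` if `m_{ij} = 2`
      (∀ i j, i ≠ j → coxNum b i j = 2 → u i j = 0) ∧
      -- and `T_i T_j T_i - T_j T_i T_j =
      --   x_γ ^ 2 (κ_{ji} T_j - κ_{ij} T_i + (κ_j - κ_i) / x_{i+j})` if `m_{ij} = 3`
      (∀ i j, i ≠ j → coxNum b i j = 3 →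
        algebraMap (BaseRing F P) (LocRing F P) (u i j (simpleRefl b j)) =
          algebraMap (BaseRing F P) (LocRing F P) (sgamma F P) ^ 2 * kappaTwo F P j i ∧
        algebraMap (BaseRing F P) (LocRing F P) (u i j (simpleRefl b i)) =
          -(algebraMap (BaseRing F P) (LocRing F P) (sgamma F P) ^ 2 * kappaTwo F P i j) ∧
        algebraMap (BaseRing F P) (LocRing F P) (u i j 1) =
          algebraMap (BaseRing F P) (LocRing F P) (sgamma F P) ^ 2 *
            ((kappa F P j - kappa F P i) * xInv F P (P.root i + P.root j)) ∧
        ∀ v, v ≠ simpleRefl b j → v ≠ simpleRefl b i → v ≠ 1 → u i j v = 0) ∧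
      -- and `H_F` is presented by `S`, the `T_i` and the relations
      ∃ e : RingQuot (HeckeRel F b k D I u) ≃ₐ[R] heckeAlgebra F b,
        (∀ f, (e (RingQuot.mkAlgHom R _ (gS F b f)) : TwistedAlgebra F P) = sEmb F P f) ∧
        (∀ i, (e (RingQuot.mkAlgHom R _ (gT F b i)) : TwistedAlgebra F P) = lusztigElt F P i)) := by
  have : Module.IsReflexive ℤ X := .of_isPerfPair P.toLinearMap
  have : Module.Free ℤ X := inferInstance
  have := finite_weylGroup b
  have := Fintype.ofFinite P.weylGroup
  classical
  choose c hc hsum using exists_braid_expansion b F hreg hI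
  -- the coefficients for `i = j` are irrelevant
  let u : b.support → b.support → P.weylGroup →₀ BaseRing F P :=
    fun i j => Finsupp.equivFunOnFinite.symm (c i j)
  have hlen : ∀ i j, i ≠ j → ∀ v, u i j v ≠ 0 → len b v + 2 ≤ coxNum b i j :=
    fun i j _ v hv => hc i j v hv
  have hbraid : ∀ i j, i ≠ j → lusztigWord F b (altWord i j (coxNum b i j)) -
      lusztigWord F b (altWord j i (coxNum b i j)) =
        (u i j).sum fun v c => c • lusztigWord F b (I v) := fun i j _ => by
    rw [sum_smul_eq_sum]
    exact hsum i j
  refine ⟨⟨linearIndependent_lusztigWord F b hreg hI, span_lusztigWord F b hI⟩,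
    fun v I' hI' => exists_bruhat_expansion F b hreg hI hI',
    fun i => kappaBase F P i, fun i f => demazure F (i : ι) f, u,
    fun i => algebraMap_kappaBase F (i : ι), fun i f => algebraMap_demazure F (i : ι) f,
    fun i j hij => ⟨hlen i j hij, hbraid i j hij⟩, fun i j hij h2 => ?_, fun i j hij h3 => ?_,
    exists_presentation hreg hI (fun _ => rfl) (fun _ _ => rfl) hlen hbraid⟩
  · exact Finsupp.ext fun v =>
      eq_zero_of_braid_expansion_two b F hreg hI hij h2 (hc i j) (hsum i j) v
  · exact ⟨braid_three_right b F hreg hI hij h3 (hc i j) (hsum i j),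
      braid_three_left b F hreg hI hij h3 (hc i j) (hsum i j),
      braid_three_one b F hreg hI hij h3 (hc i j) (hsum i j),
      fun v hj hi h1 => braid_three_eq_zero b F hreg hI hij h3 (hc i j) (hsum i j) hj hi h1⟩
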